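/- **Notation.** Let $\mathbb G^{\mathrm o}(3,2)$ be the space of oriented two-dimensional linear subspaces of $\mathbb R^3$, identified with the unit simple 2-vectors $\xi\in\bigwedge_2\mathbb R^3$; let $\star\xi\in\mathbb S^2$ be the unit normal given by the Hodge star ($\star(v\wedge w)=v\times w$) and $T(\xi)=(\star\xi)^\perp$. An oriented 2-varifold $V$ is a Radon measure on $\mathbb R^3\times\mathbb G^{\mathrm o}(3,2)$; its weight $\mu_V$ is the push-forward of $V$ under $(x,\xi)\mapsto x$. A map $H\in L^2_{\mathrm{loc}}(\mu_V;\mathbb R^3)$ is called a generalized mean curvature of $V$ (without singular part) if $$\int \operatorname{div}_{T(\xi)}X(x)\,\mathrm dV(x,\xi)=-\int\langle X,H\rangle\,\mathrm d\mu_V\quad\text{for all }X\in C^1_c(\mathbb R^3;\mathbb R^3),$$ and $H(x)\wedge\star\xi=0$ for $V$-almost all $(x,\xi)$. For $c_0\in\mathbb R$ and $x_0\in\mathbb R^3$ put $$\mathcal H_{c_0}(V)=\frac14\int|H(x)-c_0(\star\xi)|^2\,\mathrm dV(x,\xi),\qquad \mathcal V_c(V,x_0)=-\int\frac{\langle x-x_0,\star\xi\rangle}{|x-x_0|^2}\,\mathrm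 dV(x,\xi),$$ $$\theta^{*2}(\mu_V,x_0)=\limsup_{\rho\to0+}\frac{\mu_V(\{y:|y-x_0|\le\rho\})}{\pi\rho^2}.$$ For a smooth embedding $f\colon\mathbb S^2\to\mathbb R^3$ let $\mu$ be the Riemannian measure of the pull-back metric, $n$ the unit normal induced by the orientation of $\mathbb S^2$ (where $\mathbb S^2$ is oriented by its inner unit normal), $H_f$ the mean curvature vector (trace of the second fundamental form), and $$\mathcal H^{\lambda,p}_{c_0}(f)=\frac14\int_{\mathbb S^2}|H_f-c_0n|^2\,\mathrm d\mu+\lambda\int_{\mathbb S^2}1\,\mathrm d\mu-\frac p3\int_{\mathbb S^2}\langle f,n\rangle\,\mathrm d\mu .$$ Let $\mathcal S^\infty$ be the set of smooth embeddings $f\colon\mathbb S^2\to\mathbb R^3$ for which $n$ is the inner unit normal, i.e. points into the bounded component of $\mathbb R^3\setminus f(\mathbb S^2)$. **Theorem.** 1. Let $V$ be an oriented 2-varifold on $\mathbb R^3$ with generalized mean curvature $H\in L^2_{\mathrm{loc}}(\mu_V;\mathbb R^3)$ without singular part, and suppose that $\operatorname{spt}\mu_V$ is compact. Let $c_0<0$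 and let $x_0\in\mathbb R^3$ satisfy $\theta^{*2}(\mu_V,x_0)\ge1$ and $\mathcal V_c(V,x_0)>0$. Then $\mathcal H_{c_0}(V)>4\pi$. 2. Let $c_0<0$ and $\lambda,p\ge0$. Then $\inf_{f\in\mathcal S^\infty}\mathcal H^{\lambda,p}_{c_0}(f)\le4\pi$, and this infimum is not attained in $\mathcal S^\infty$. -/

import Mathlib

open MeasureTheory Filter Topology Metric
open scoped ENNReal Manifold ContDiff

noncomputable section

namespace HelfrichLiYau

/-- Euclidean three-space. -/
abbrev E3 : Type := EuclideanSpace ℝ (Fin 3)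

/-- The Euclidean plane, used as a coordinate domain. -/
abbrev E2 : Type := EuclideanSpace ℝ (Fin 2)

/-- The unit sphere `𝕊²` of `ℝ³`. -/
abbrev S2 : Type := sphere (0 : E3) 1

/-! ### Oriented 2-varifolds -/

/-- The space of oriented 2-dimensional subspaces of `ℝ³`. The Hodge star `ξ ↦ ⋆ξ`
(`⋆(v ∧ w) = v × w`) is an isometry from the unit simple 2-vectors of `ℝ³` onto the unit sphere,
and the oriented plane `ξ` is recorded by its unit normal `⋆ξ`: an element `ξ` of this type *is*
the vector `⋆ξ`. -/
abbrev OrientedPlane : Type := S2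

/-- The underlying unoriented plane `T(ξ)`, the orthogonal complement of `⋆ξ`. -/
def OrientedPlane.plane (ξ : OrientedPlane) : Submodule ℝ E3 := (ℝ ∙ (ξ : E3))ᗮ

/-- Oriented 2-varifolds on `ℝ³`: Radon measures on `ℝ³ × 𝔾ᵒ(3,2)`. This product is locally compact
and second countable, so a Borel measure is Radon iff it is finite on compact sets. -/
structure OrientedVarifold where
  /-- the underlying Borel measure on the oriented Grassmann bundle -/
  measure : Measure (E3 × OrientedPlane)
  finite_on_compacts : IsFiniteMeasureOnCompacts measure

/-- The weight measure `μ_V`, the push forward of `V` under `(x, ξ) ↦ x`. -/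
def OrientedVarifold.weight (V : OrientedVarifold) : Measure E3 :=
  V.measure.map Prod.fst

/-- `div_T X (x) = ∑ⱼ ⟨eⱼ, DX(x) eⱼ⟩` for an orthonormal basis `(eⱼ)` of the subspace `T`. -/
def divAlong (T : Submodule ℝ E3) (X : E3 → E3) (x : E3) : ℝ :=
  ∑ j, inner ℝ (stdOrthonormalBasis ℝ T j : E3)
    (fderiv ℝ X x (stdOrthonormalBasis ℝ T j : E3))

/-- The first variation `δV(X) = ∫ div_{T(ξ)} X(x) dV(x, ξ)`. -/
def OrientedVarifold.firstVariation (V : OrientedVarifold) (X : E3 → E3) : ℝ :=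
  ∫ z, divAlong (OrientedPlane.plane z.2) X z.1 ∂V.measure

/-- `H ∈ L²_loc(μ; ℝ³)`. -/
def MemL2Loc (H : E3 → E3) (μ : Measure E3) : Prop :=
  ∀ K : Set E3, IsCompact K → MemLp H 2 (μ.restrict K)

/-- `H` is the generalized mean curvature of `V`, the first variation of `V` has no singular part,
and `H` is perpendicular: `δV(X) = -∫ ⟨X, H⟩ dμ_V` for all `X ∈ C¹_c(ℝ³; ℝ³)`, and
`H(x) ∧ ⋆ξ = 0`, i.e. `H(x) ∈ ℝ ⋆ξ`, for `V`-almost all `(x, ξ)`. -/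
structure OrientedVarifold.HasMeanCurvature (V : OrientedVarifold) (H : E3 → E3) : Prop where
  firstVariation_eq : ∀ X : E3 → E3, ContDiff ℝ 1 X → HasCompactSupport X →
    V.firstVariation X = -∫ x, inner ℝ (X x) (H x) ∂V.weight
  perpendicular : ∀ᵐ z ∂V.measure, H z.1 ∈ (ℝ ∙ (z.2 : E3))

/-- The Helfrich energy `ℋ_{c₀}(V) = ¼ ∫ |H(x) - c₀ ⋆ξ|² dV(x, ξ) ∈ [0, ∞]` of a varifold `V`
with generalized mean curvature `H`. -/
def OrientedVarifold.helfrich (V : OrientedVarifold) (H : E3 → E3) (c₀ : ℝ) : ℝ≥0∞ :=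
  4⁻¹ * ∫⁻ z, ‖H z.1 - c₀ • (z.2 : E3)‖ₑ ^ 2 ∂V.measure

/-- The concentrated volume `-∫ ⟨x - x₀, ⋆ξ⟩ / |x - x₀|² dV(x, ξ)` of `V` at `x₀`. (The value is `0`
if the integral does not exist, so `0 < V.concentratedVolume x₀` includes its existence.) -/
def OrientedVarifold.concentratedVolume (V : OrientedVarifold) (x₀ : E3) : ℝ :=
  -∫ z, inner ℝ (z.1 - x₀) (z.2 : E3) / ‖z.1 - x₀‖ ^ 2 ∂V.measure

/-- The upper 2-density `θ^{*2}(μ, x) = limsup_{ρ → 0+} μ(B_ρ(x)) / (π ρ²)`, with closed balls. -/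
def upperDensity (μ : Measure E3) (x : E3) : ℝ≥0∞ :=
  limsup (fun ρ : ℝ => μ (closedBall x ρ) / ENNReal.ofReal (Real.pi * ρ ^ 2)) (𝓝[>] 0)

/-! ### Classical geometry of a local parametrization -/

/-- The cross product on Euclidean three-space. -/
def cross (v w : E3) : E3 := WithLp.toLp 2 (crossProduct v.ofLp w.ofLp)

/-- The partial derivative `∂ᵢ u (y)`. -/
def partialDeriv {F : Type*} [NormedAddCommGroup F] [NormedSpace ℝ F]
    (i : Fin 2) (u : E2 → F) (y : E2) : F :=
  fderiv ℝ u y (EuclideanSpace.single i 1)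

/-- The first fundamental form `g_{ij} = ⟨∂ᵢ u, ∂ⱼ u⟩`. -/
def metricMatrix (u : E2 → E3) (y : E2) : Matrix (Fin 2) (Fin 2) ℝ :=
  Matrix.of fun i j => inner ℝ (partialDeriv i u y) (partialDeriv j u y)

/-- The unit normal `∂₁u × ∂₂u / |∂₁u × ∂₂u|`. -/
def paramNormal (u : E2 → E3) (y : E2) : E3 :=
  ‖cross (partialDeriv 0 u y) (partialDeriv 1 u y)‖⁻¹ •
    cross (partialDeriv 0 u y) (partialDeriv 1 u y)

/-- The scalar second fundamental form `h_{ij} = ⟨∂ᵢ∂ⱼ u, n⟩`. -/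
def secondFundamentalForm (u : E2 → E3) (y : E2) : Matrix (Fin 2) (Fin 2) ℝ :=
  Matrix.of fun i j => inner ℝ (partialDeriv i (partialDeriv j u) y) (paramNormal u y)

/-- The mean curvature vector, the trace `∑ g^{ij} h_{ij} n` of the second fundamental form. -/
def paramMeanCurvature (u : E2 → E3) (y : E2) : E3 :=
  (∑ i, ∑ j, (metricMatrix u y)⁻¹ i j * secondFundamentalForm u y i j) • paramNormal u y

/-! ### Maps of the sphere into space -/

lemma inner_eq_sum (v w : E3) : inner ℝ v w = v 0 * w 0 + v 1 * w 1 + v 2 * w 2 := by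
  simp [PiLp.inner_apply, Fin.sum_univ_three]
  ring

/-- The sphere is oriented by its inner unit normal: at every `p` there is a positively oriented
orthonormal tangent frame `(e₀, e₁)`, that is, one with `e₀ × e₁ = -p`. -/
lemma exists_frame (p : S2) :
    ∃ e : Fin 2 → E3, Orthonormal ℝ e ∧ cross (e 0) (e 1) = -(p : E3) := by
  have hp : ‖(p : E3)‖ = 1 := by simp
  have hp2 : inner ℝ (p : E3) (p : E3) = 1 := by
    rw [real_inner_self_eq_norm_sq, hp]; norm_num
  obtain ⟨v, hv, hv0⟩ : ∃ v ∈ (ℝ ∙ (p : E3))ᗮ, v ≠ 0 := by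
    apply Submodule.exists_mem_ne_zero_of_ne_bot
    intro h
    have h1 := Submodule.finrank_add_finrank_orthogonal (ℝ ∙ (p : E3))
    rw [h, finrank_span_singleton (by intro h0; simp [h0] at hp)] at h1
    simp at h1
  have hpv : inner ℝ (p : E3) v = 0 := Submodule.mem_orthogonal_singleton_iff_inner_right.1 hv
  set a : E3 := ‖v‖⁻¹ • v with ha
  have haa : inner ℝ a a = 1 := by
    rw [real_inner_self_eq_norm_sq, ha, norm_smul, norm_inv, norm_norm,
      inv_mul_cancel₀ (norm_ne_zero_iff.2 hv0)]
    norm_num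
  have hpa : inner ℝ (p : E3) a = 0 := by rw [ha, inner_smul_right, hpv, mul_zero]
  rw [inner_eq_sum] at hp2 haa hpa
  have hbb : inner ℝ (cross a p) (cross a p) = 1 := by
    rw [inner_eq_sum]
    simp [cross, crossProduct]
    linear_combination (a 0 * a 0 + a 1 * a 1 + a 2 * a 2) * hp2 + haa -
      (p.1 0 * a 0 + p.1 1 * a 1 + p.1 2 * a 2) * hpa
  have hab : inner ℝ a (cross a p) = 0 := by
    rw [inner_eq_sum]
    simp [cross, crossProduct]
    ring
  refine ⟨![a, cross a p], ?_, ?_⟩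
  · rw [orthonormal_iff_ite]
    rw [← inner_eq_sum] at haa
    intro i j
    fin_cases i <;> fin_cases j
    · simpa using haa
    · simpa using hab
    · simpa [real_inner_comm] using hab
    · simpa using hbb
  · ext i
    fin_cases i
    · simp [cross, crossProduct]
      linear_combination (-p.1 0) * haa + a 0 * hpa
    · simp [cross, crossProduct]
      linear_combination (-p.1 1) * haa + a 1 * hpa
    · simp [cross, crossProduct]
      linear_combination (-p.1 2) * haa + a 2 * hpa

/-- A positively oriented orthonormal frame of `T_p 𝕊²`. No quantity below depends on the choice. -/
def frame (p : S2) : Fin 2 → E3 := (exists_frame p).choose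

/-- The radial extension `x ↦ f(x / |x|)` of a map on the sphere. -/
def radialExtension (f : S2 → E3) (x : E3) : E3 :=
  if h : x = 0 then 0 else
    f ⟨‖x‖⁻¹ • x, by simp [norm_smul, inv_mul_cancel₀ (norm_ne_zero_iff.2 h)]⟩

/-- The map `f` in the positive chart of `𝕊²` centred at `p` that is given by central projection
onto the tangent plane: `s ↦ f((p + s₀e₀ + s₁e₁) / |p + s₀e₀ + s₁e₁|)`. In this chart the round
metric at the centre `s = 0` is the identity matrix. -/
def localParam (f : S2 → E3) (p : S2) (s : E2) : E3 :=
  radialExtension f ((p : E3) + s 0 • frame p 0 + s 1 • frame p 1)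

/-- The induced unit normal field (Gauss map) `n_f`. -/
def unitNormal (f : S2 → E3) (p : S2) : E3 := paramNormal (localParam f p) 0

/-- The mean curvature vector `H_f`. -/
def meanCurvature (f : S2 → E3) (p : S2) : E3 := paramMeanCurvature (localParam f p) 0

/-- The Riemannian measure `μ_f` of the pull-back metric `g_f`. Its density with respect to the
standard surface measure of `𝕊²` at `p` is `√(det g_f)`, computed in a chart in which the round
metric at `p` is the identity matrix. -/
def areaMeasure (f : S2 → E3) : Measure S2 :=
  (volume : Measure E3).toSphere.withDensity fun p =>
    ENNReal.ofReal (Real.sqrt (metricMatrix (localParam f p) 0).det)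

/-- The Helfrich energy `ℋ_{c₀}(f) = ¼ ∫ |H_f - c₀ n_f|² dμ_f`. -/
def helfrich (c₀ : ℝ) (f : S2 → E3) : ℝ :=
  1 / 4 * ∫ p, ‖meanCurvature f p - c₀ • unitNormal f p‖ ^ 2 ∂areaMeasure f

/-- The area `𝒜(f) = ∫ 1 dμ_f`. -/
def area (f : S2 → E3) : ℝ := ∫ _p, (1 : ℝ) ∂areaMeasure f

/-- The algebraic volume `𝒱(f) = -⅓ ∫ ⟨f, n_f⟩ dμ_f`. -/
def algVolume (f : S2 → E3) : ℝ :=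
  -(1 / 3) * ∫ p, inner ℝ (f p) (unitNormal f p) ∂areaMeasure f

/-- The penalized Canham–Helfrich energy `ℋ_{c₀} + λ 𝒜 + p 𝒱`. -/
def penalizedEnergy (c₀ lam p : ℝ) (f : S2 → E3) : ℝ :=
  helfrich c₀ f + lam * area f + p * algVolume f

/-- The region enclosed by `f(𝕊²)`: the union of the bounded connected components of the
complement of the image. -/
def enclosedRegion (f : S2 → E3) : Set E3 :=
  {x | x ∉ Set.range f ∧ Bornology.IsBounded (connectedComponentIn (Set.range f)ᶜ x)}

/-- Smoothly embedded spheres: smooth embeddings `f : 𝕊² → ℝ³` (smooth, with injective differentials,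
homeomorphic onto the image) whose unit normal `n_f` is the inner one, i.e. points into the
region enclosed by the image. -/
structure IsEmbeddedSphere (f : S2 → E3) : Prop where
  smooth : ContMDiff (𝓡 2) 𝓘(ℝ, E3) ∞ f
  immersion : ∀ p, Function.Injective (mfderiv (𝓡 2) 𝓘(ℝ, E3) f p)
  embedding : IsEmbedding f
  inner_normal : ∀ p, ∀ᶠ t in 𝓝[>] (0 : ℝ), f p + t • unitNormal f p ∈ enclosedRegion f

end HelfrichLiYau

end

noncomputable section

namespace HelfrichLiYau

section

/-! ### Radial test fields -/

/-! Part 1 is a Li–Yau inequality. Write `y = x - x₀`, `b = ⟨y, ⋆ξ⟩` and `H = a ⋆ξ`. Up to a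
harmless correction on the sphere `|y| = σ`, testing the first variation with the field `min (σ⁻²)
(|y|⁻²) y` gives σ⁻² μ(|y| < σ) + ∫_{|y| ≥ σ} (b²/|y|⁴ + ab/(2|y|²)) + (2σ²)⁻¹ ∫_{|y| < σ} ab = 0.
Outside the ball the integrand equals ((a - c₀)/4 + b/|y|²)² - (a - c₀)²/16 + c₀b/(2|y|²), and the
square is dropped. Inside, ab is bounded by the inequality of arithmetic and geometric means: one
part is absorbed by the first term, the other is an integral of |H|² over a shrinking punctured
ball. Letting σ → 0 along radii where the density is almost attained gives π ≤ ℋ/4 + (c₀/2) 𝒱_c, and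
the last term is negative. The steps are `truncated`, `density_pointwise`, `density_estimate` and
`frequently_density_le`.

In part 2 the upper bound comes from round spheres of radius r → 0. Since the infimum is at most 4π,
it is not attained as soon as every embedded sphere has energy above 4π. This is proved with the
Gauss map, independently of part 1. Let C be the set where the surface touches a supporting plane of
its convex hull. On C the second fundamental form with respect to the inner normal is positive
semidefinite, so the mean curvature S and the Gauss curvature K are nonnegative, and c₀ < 0 gives (S
- c₀)²/4 ≥ S²/4 + c₀²/4 ≥ K + c₀²/4. The Gauss map sends C onto the sphere
(`exists_mem_contactSet`), so K has integral at least 4π over C. In particular C has positive area,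
and the term c₀²/4 makes the inequality strict.

It remains that the penalty terms are nonnegative. The area is clear. For the volume, a smooth
cutoff χ of the enclosed region satisfies ∫ Dχ(y) y dy = -3 ∫ χ ≤ 0. In normal coordinates the left
side is an average, over parallel surfaces near the given one, of the integral of support function
times area element. By continuity the same sign holds on the surface itself (`algVolume_nonneg`).

All differential geometry is done on the extension `x ↦ f (x / |x|)`, by Euclidean calculus away
from the origin and with cofactor formulas that do not involve a frame. -/

lemma norm_coe_S2 (ξ : S2) : ‖(ξ : E3)‖ = 1 := by simp

lemma finrank_plane (ξ : OrientedPlane) : Module.finrank ℝ ξ.plane = 2 := by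
  have h1 := Submodule.finrank_add_finrank_orthogonal (ℝ ∙ (ξ : E3))
  have h0 : (ξ : E3) ≠ 0 := by
    intro h
    have := norm_coe_S2 ξ
    simp [h] at this
  rw [finrank_span_singleton h0] at h1
  simp only [finrank_euclideanSpace, Fintype.card_fin] at h1
  unfold OrientedPlane.plane
  omega

lemma sum_sq_inner_plane (ξ : OrientedPlane) (y : E3) :
    ∑ j, inner ℝ (stdOrthonormalBasis ℝ ξ.plane j : E3) y ^ 2
      = ‖y‖ ^ 2 - inner ℝ y (ξ : E3) ^ 2 := by
  have h1 := Submodule.norm_sq_eq_add_norm_sq_projection y (ℝ ∙ (ξ : E3))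
  have h2 : ‖(ℝ ∙ (ξ : E3)).orthogonalProjectionOnto y‖ ^ 2 = inner ℝ y (ξ : E3) ^ 2 := by
    have h3 := Submodule.starProjection_unit_singleton ℝ (norm_coe_S2 ξ) y
    rw [Submodule.starProjection_apply] at h3
    rw [Submodule.coe_norm, h3, norm_smul, norm_coe_S2, mul_one, real_inner_comm]
    simp
  have h4 := (stdOrthonormalBasis ℝ ξ.plane).sum_sq_norm_inner_right
    (ξ.plane.orthogonalProjectionOnto y)
  have h5 : ∀ j, inner ℝ (stdOrthonormalBasis ℝ ξ.plane j) (ξ.plane.orthogonalProjectionOnto y)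
      = inner ℝ (stdOrthonormalBasis ℝ ξ.plane j : E3) y := fun j =>
    Submodule.inner_orthogonalProjectionOnto_eq_of_mem_left _ _
  simp only [h5, Real.norm_eq_abs, sq_abs] at h4
  rw [h4, h1, h2]
  unfold OrientedPlane.plane
  ring

/-- The trace over the plane of the rank-one part `y ⊗ y` is the squared length of the projection of
`y`. Derivatives of radial fields always have this shape. -/
lemma divAlong_of_hasFDerivAt (ξ : OrientedPlane) {X : E3 → E3} {x y : E3} {a b : ℝ}
    (h : HasFDerivAt X (a • ContinuousLinearMap.id ℝ E3 + b • (innerSL ℝ y).smulRight y) x) :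
    divAlong ξ.plane X x = 2 * a + b * (‖y‖ ^ 2 - inner ℝ y (ξ : E3) ^ 2) := by
  unfold divAlong
  rw [h.fderiv, ← sum_sq_inner_plane, Finset.mul_sum]
  have h1 : ∀ j, inner ℝ (stdOrthonormalBasis ℝ ξ.plane j : E3)
      ((a • ContinuousLinearMap.id ℝ E3 + b • (innerSL ℝ y).smulRight y)
        (stdOrthonormalBasis ℝ ξ.plane j : E3))
      = a + b * inner ℝ (stdOrthonormalBasis ℝ ξ.plane j : E3) y ^ 2 := by
    intro j
    have h2 : inner ℝ (stdOrthonormalBasis ℝ ξ.plane j : E3)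
        (stdOrthonormalBasis ℝ ξ.plane j : E3) = (1 : ℝ) := by
      rw [real_inner_self_eq_norm_sq, ← Submodule.coe_norm,
        (stdOrthonormalBasis ℝ ξ.plane).norm_eq_one]
      norm_num
    simp only [add_apply, smul_apply,
      ContinuousLinearMap.id_apply, ContinuousLinearMap.smulRight_apply, innerSL_apply_apply,
      inner_add_right, inner_smul_right, h2]
    rw [real_inner_comm]
    ring
  rw [Finset.sum_congr rfl fun j _ => h1 j, Finset.sum_add_distrib]
  simp [finrank_plane]

lemma hasFDerivAt_radial {φ : ℝ → ℝ} {φ' : ℝ} (x₀ x : E3)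
    (h : HasDerivAt φ φ' (‖x - x₀‖ ^ 2)) :
    HasFDerivAt (fun x : E3 => φ (‖x - x₀‖ ^ 2) • (x - x₀))
      (φ (‖x - x₀‖ ^ 2) • ContinuousLinearMap.id ℝ E3 +
        (2 * φ') • (innerSL ℝ (x - x₀)).smulRight (x - x₀)) x := by
  have h1 : HasFDerivAt (fun x : E3 => x - x₀) (ContinuousLinearMap.id ℝ E3) x :=
    (hasFDerivAt_id x).sub_const x₀
  have h2 := h1.norm_sq
  have h3 := (h.comp_hasFDerivAt x h2).smul h1
  refine h3.congr_fderiv ?_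
  ext1 v
  simp [smul_smul, mul_assoc, mul_left_comm]

/-! ### Integration against a varifold with compact support -/

variable {V : OrientedVarifold} {H : E3 → E3}

lemma OrientedVarifold.ae_mem_support (V : OrientedVarifold) :
    ∀ᵐ z ∂V.measure, z.1 ∈ V.weight.support :=
  ae_of_ae_map measurable_fst.aemeasurable Measure.support_mem_ae

lemma OrientedVarifold.isFiniteMeasure (hc : IsCompact V.weight.support) :
    IsFiniteMeasure V.measure := by
  have := V.finite_on_compacts
  refine ⟨?_⟩
  have h1 : V.measure Set.univ ≤ V.measure (V.weight.support ×ˢ Set.univ) := by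
    apply measure_mono_ae
    filter_upwards [V.ae_mem_support] with z hz _
    exact ⟨hz, trivial⟩
  exact h1.trans_lt (hc.prod isCompact_univ).measure_lt_top

lemma OrientedVarifold.memLp_weight (hc : IsCompact V.weight.support)
    (hH : MemL2Loc H V.weight) : MemLp H 2 V.weight := by
  have h := hH _ hc
  rwa [Measure.restrict_eq_self_of_ae_mem] at h
  exact Measure.support_mem_ae

lemma OrientedVarifold.memLp_comp_fst (hc : IsCompact V.weight.support)
    (hH : MemL2Loc H V.weight) : MemLp (fun z : E3 × OrientedPlane => H z.1) 2 V.measure :=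
  (V.memLp_weight hc hH).comp_of_map measurable_fst.aemeasurable

/-- The first variation of a varifold with compact support along a radial vector field, which need
not have compact support. -/
lemma OrientedVarifold.HasMeanCurvature.radial (hV : V.HasMeanCurvature H)
    (hc : IsCompact V.weight.support) (hH : MemL2Loc H V.weight) (x₀ : E3) {φ φ' : ℝ → ℝ}
    (hφ : ∀ s, 0 ≤ s → HasDerivAt φ (φ' s) s)
    (hC : ContDiff ℝ 1 fun x : E3 => φ (‖x - x₀‖ ^ 2)) :
    ∫ z, (2 * φ (‖z.1 - x₀‖ ^ 2) + 2 * φ' (‖z.1 - x₀‖ ^ 2) *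
        (‖z.1 - x₀‖ ^ 2 - inner ℝ (z.1 - x₀) (z.2 : E3) ^ 2)) ∂V.measure
      = -∫ z, φ (‖z.1 - x₀‖ ^ 2) * inner ℝ (z.1 - x₀) (H z.1) ∂V.measure := by
  obtain ⟨R, hR0, hR⟩ := hc.isBounded.exists_pos_norm_lt
  -- The bump equals 1 near the support of the weight, so it changes neither the field nor its
  -- derivative there.
  let ζ : ContDiffBump (0 : E3) := ⟨R, R + 1, hR0, by linarith⟩
  set Y : E3 → E3 := fun x => φ (‖x - x₀‖ ^ 2) • (x - x₀) with hY
  set X : E3 → E3 := fun x => ζ x • Y x with hX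
  have hYC : ContDiff ℝ 1 Y := hC.smul (contDiff_id.sub contDiff_const)
  have hXC : ContDiff ℝ 1 X := ζ.contDiff.smul hYC
  have hXs : HasCompactSupport X := ζ.hasCompactSupport.smul_right
  have hXY : ∀ x ∈ V.weight.support, X =ᶠ[𝓝 x] Y := by
    intro x hx
    have : x ∈ ball (0 : E3) R := by simpa using hR x hx
    filter_upwards [ζ.eventuallyEq_one_of_mem_ball this] with y hy
    simp [hX, hy]
  have h := hV.firstVariation_eq X hXC hXs
  have h1 : V.firstVariation X = ∫ z, (2 * φ (‖z.1 - x₀‖ ^ 2) + 2 * φ' (‖z.1 - x₀‖ ^ 2) *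
        (‖z.1 - x₀‖ ^ 2 - inner ℝ (z.1 - x₀) (z.2 : E3) ^ 2)) ∂V.measure := by
    apply integral_congr_ae
    filter_upwards [V.ae_mem_support] with z hz
    apply divAlong_of_hasFDerivAt
    exact (hasFDerivAt_radial x₀ z.1 (hφ _ (by positivity))).congr_of_eventuallyEq (hXY _ hz)
  have h2 : ∫ x, inner ℝ (X x) (H x) ∂V.weight
      = ∫ z, φ (‖z.1 - x₀‖ ^ 2) * inner ℝ (z.1 - x₀) (H z.1) ∂V.measure := by
    have hm : AEStronglyMeasurable (fun x => inner ℝ (X x) (H x)) V.weight :=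
      (hXC.continuous.aestronglyMeasurable).inner (V.memLp_weight hc hH).1
    unfold OrientedVarifold.weight at hm ⊢
    rw [integral_map measurable_fst.aemeasurable hm]
    apply integral_congr_ae
    filter_upwards [V.ae_mem_support] with z hz
    rw [(hXY _ hz).eq_of_nhds, hY]
    simp [inner_smul_left]
  rw [← h1, h, h2]

/-! ### The truncated inverse square profile -/

/-- A smooth approximation, as `k → ∞`, of the profile `min 1 t⁻¹`. -/
def profile (k : ℕ) (t : ℝ) : ℝ := (1 + t ^ k) ^ (-(k : ℝ)⁻¹)

/-- The logarithmic derivative of `profile k`, up to the factor `-t⁻¹`. -/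
def profileSlope (k : ℕ) (t : ℝ) : ℝ := t ^ k / (1 + t ^ k)

/-- The limit of `profile k`. -/
def profileLim (t : ℝ) : ℝ := if t < 1 then 1 else t⁻¹

/-- The limit of `profileSlope k`. -/
def profileSlopeLim (t : ℝ) : ℝ := if t < 1 then 0 else if t = 1 then 1 / 2 else 1

lemma profile_nonneg (k : ℕ) {t : ℝ} (ht : 0 ≤ t) : 0 ≤ profile k t :=
  Real.rpow_nonneg (by positivity) _

lemma profile_le_one (k : ℕ) {t : ℝ} (ht : 0 ≤ t) : profile k t ≤ 1 :=
  Real.rpow_le_one_of_one_le_of_nonpos (by linarith [pow_nonneg ht k]) (by simp)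

lemma profileSlope_nonneg (k : ℕ) {t : ℝ} (ht : 0 ≤ t) : 0 ≤ profileSlope k t := by
  unfold profileSlope; positivity

lemma profileSlope_le_one (k : ℕ) {t : ℝ} (ht : 0 ≤ t) : profileSlope k t ≤ 1 := by
  unfold profileSlope
  rw [div_le_one (by positivity)]
  linarith

/-- The derivative is `-t⁻¹ * profileSlope (k + 1) t * profile (k + 1) t`, written so that it
remains valid at `t = 0`. The index `k + 1` keeps the exponent in `profile` nonzero. -/
lemma hasDerivAt_profile (k : ℕ) {t : ℝ} (ht : 0 ≤ t) :
    HasDerivAt (profile (k + 1)) (-(t ^ k / (1 + t ^ (k + 1)) * profile (k + 1) t)) t := by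
  have h0 : 0 < 1 + t ^ (k + 1) := by positivity
  have h1 : HasDerivAt (fun t : ℝ => 1 + t ^ (k + 1)) (((k + 1 : ℕ) : ℝ) * t ^ k) t := by
    simpa using (hasDerivAt_pow (k + 1) t).const_add 1
  have h2 := h1.rpow_const (p := -((k + 1 : ℕ) : ℝ)⁻¹) (Or.inl h0.ne')
  refine h2.congr_deriv ?_
  unfold profile
  rw [Real.rpow_sub h0, Real.rpow_one]
  have : ((k + 1 : ℕ) : ℝ) ≠ 0 := by positivity
  field_simp

lemma tendsto_neg_inv_natCast : Tendsto (fun k : ℕ => -((k + 1 : ℕ) : ℝ)⁻¹) atTop (𝓝 0) := by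
  have := (tendsto_inv_atTop_nhds_zero_nat (𝕜 := ℝ)).comp (tendsto_add_atTop_nat 1)
  simpa using this.neg

lemma tendsto_profile {t : ℝ} (ht : 0 ≤ t) :
    Tendsto (fun k : ℕ => profile (k + 1) t) atTop (𝓝 (profileLim t)) := by
  unfold profileLim
  have key : ∀ s : ℝ, 0 ≤ s → s ≤ 1 →
      Tendsto (fun k : ℕ => profile (k + 1) s) atTop (𝓝 1) := by
    intro s hs hs1
    rcases hs1.lt_or_eq with h | h
    · have h1 : Tendsto (fun k : ℕ => 1 + s ^ (k + 1)) atTop (𝓝 (1 + 0)) :=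
        ((tendsto_pow_atTop_nhds_zero_of_lt_one hs h).comp (tendsto_add_atTop_nat 1)).const_add 1
      have := h1.rpow tendsto_neg_inv_natCast (Or.inl (by norm_num))
      simpa [profile] using this
    · have h1 : Tendsto (fun k : ℕ => 1 + s ^ (k + 1)) atTop (𝓝 2) := by
        subst h
        norm_num
      have := h1.rpow tendsto_neg_inv_natCast (Or.inl (by norm_num))
      simpa [profile] using this
  split_ifs with h
  · exact key t ht h.le
  · push Not at h
    have ht0 : 0 < t := by linarith
    -- The symmetry `profile (k + 1) t = t⁻¹ * profile (k + 1) t⁻¹` reduces `t ≥ 1` to `t ≤ 1`.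
    have h2 := (key t⁻¹ (by positivity) (inv_le_one_of_one_le₀ h)).const_mul t⁻¹
    rw [mul_one] at h2
    refine h2.congr fun k => ?_
    unfold profile
    have h3 : 1 + t ^ (k + 1) = t ^ (k + 1) * (1 + t⁻¹ ^ (k + 1)) := by
      rw [mul_add, ← mul_pow, mul_inv_cancel₀ ht0.ne']
      ring
    rw [h3, Real.mul_rpow (by positivity) (by positivity), ← Real.rpow_natCast t,
      ← Real.rpow_mul ht0.le, mul_neg, mul_inv_cancel₀ (by positivity), Real.rpow_neg_one]

lemma tendsto_profileSlope {t : ℝ} (ht : 0 ≤ t) :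
    Tendsto (fun k : ℕ => profileSlope (k + 1) t) atTop (𝓝 (profileSlopeLim t)) := by
  unfold profileSlopeLim profileSlope
  split_ifs with h h'
  · have h1 := (tendsto_pow_atTop_nhds_zero_of_lt_one ht h).comp (tendsto_add_atTop_nat 1)
    have := h1.div (h1.const_add 1) (by norm_num)
    simpa [Pi.div_def] using this
  -- The sphere `‖x - x₀‖ = σ` may have positive weight, so the value at `t = 1` cannot be ignored;
  -- later only its lying in `[0, 1]` matters.
  · subst h'
    norm_num
  · have h1 : 1 < t := lt_of_le_of_ne (not_lt.1 h) (Ne.symm h')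
    have ht0 : 0 < t := by linarith
    have h2 := (tendsto_pow_atTop_nhds_zero_of_lt_one (inv_nonneg.2 ht)
      (inv_lt_one_of_one_lt₀ h1)).comp (tendsto_add_atTop_nat 1)
    have h3 := (h2.const_add 1).inv₀ (by norm_num)
    simp only [add_zero, inv_one] at h3
    refine h3.congr fun k => ?_
    simp only [Function.comp_apply, inv_pow]
    have : 0 < t ^ (k + 1) := by positivity
    field_simp
    ring

end

/-! ### The first variation along the truncated inverse square field -/

variable {V : OrientedVarifold} {H : E3 → E3}

lemma measurable_profile (k : ℕ) : Measurable (profile k) := by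
  unfold profile; fun_prop

lemma measurable_profileSlope (k : ℕ) : Measurable (profileSlope k) := by
  unfold profileSlope; fun_prop

lemma sq_inner_div_le_one (ξ : OrientedPlane) (y : E3) :
    inner ℝ y (ξ : E3) ^ 2 / ‖y‖ ^ 2 ≤ 1 := by
  apply div_le_one_of_le₀ _ (by positivity)
  have h := abs_real_inner_le_norm y (ξ : E3)
  rw [norm_coe_S2, mul_one] at h
  rw [← sq_abs]
  gcongr

lemma OrientedVarifold.exists_norm_sub_le (hc : IsCompact V.weight.support) (x₀ : E3) :
    ∃ R : ℝ, 0 < R ∧ ∀ᵐ z ∂V.measure, ‖z.1 - x₀‖ ≤ R := by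
  obtain ⟨R, hR0, hR⟩ := hc.isBounded.exists_pos_norm_lt
  refine ⟨R + ‖x₀‖, by positivity, ?_⟩
  filter_upwards [V.ae_mem_support] with z hz
  exact (norm_sub_le _ _).trans (by linarith [hR _ hz])

/-- The first variation along the field `min (σ⁻²) (|x - x₀|⁻²) (x - x₀)`. -/
lemma OrientedVarifold.HasMeanCurvature.truncated (hV : V.HasMeanCurvature H)
    (hc : IsCompact V.weight.support) (hH : MemL2Loc H V.weight) (x₀ : E3) {σ : ℝ} (hσ : 0 < σ) :
    ∫ z, 2 * profileLim (‖z.1 - x₀‖ ^ 2 / σ ^ 2) *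
        (1 - profileSlopeLim (‖z.1 - x₀‖ ^ 2 / σ ^ 2) *
          (1 - inner ℝ (z.1 - x₀) (z.2 : E3) ^ 2 / ‖z.1 - x₀‖ ^ 2)) ∂V.measure
      = -∫ z, profileLim (‖z.1 - x₀‖ ^ 2 / σ ^ 2) * inner ℝ (z.1 - x₀) (H z.1) ∂V.measure := by
  have := V.isFiniteMeasure hc
  have hL2 := V.memLp_comp_fst hc hH
  obtain ⟨R, hR0, hR⟩ := V.exists_norm_sub_le hc x₀
  -- The truncated field is not `C¹`, so the identity is established for the smooth profiles and
  -- passed to the limit by dominated convergence.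
  have hid : ∀ k : ℕ, ∫ z, 2 * profile (k + 1) (‖z.1 - x₀‖ ^ 2 / σ ^ 2) *
        (1 - profileSlope (k + 1) (‖z.1 - x₀‖ ^ 2 / σ ^ 2) *
          (1 - inner ℝ (z.1 - x₀) (z.2 : E3) ^ 2 / ‖z.1 - x₀‖ ^ 2)) ∂V.measure
      = -∫ z, profile (k + 1) (‖z.1 - x₀‖ ^ 2 / σ ^ 2) *
          inner ℝ (z.1 - x₀) (H z.1) ∂V.measure := by
    intro k
    rw [← hV.radial hc hH x₀ (φ := fun s => profile (k + 1) (s / σ ^ 2))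
      (φ' := fun s => -((s / σ ^ 2) ^ k / (1 + (s / σ ^ 2) ^ (k + 1)) *
        profile (k + 1) (s / σ ^ 2)) / σ ^ 2)]
    · congr 1
      ext z
      by_cases hy : z.1 - x₀ = 0
      · simp [hy, profileSlope]
      · have hs : 0 < ‖z.1 - x₀‖ ^ 2 := by positivity
        simp only [profileSlope]
        have hd : 0 < 1 + (‖z.1 - x₀‖ ^ 2 / σ ^ 2) ^ (k + 1) := by positivity
        set s := ‖z.1 - x₀‖ ^ 2
        set P := profile (k + 1) (s / σ ^ 2)
        have hs' : s = s / σ ^ 2 * σ ^ 2 := by field_simp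
        set t := s / σ ^ 2
        rw [hs'] at hs ⊢
        have ht : t ≠ 0 := by rintro h; simp [h] at hs
        field_simp
        ring
    · intro s hs
      have h1 := (hasDerivAt_profile k (t := s / σ ^ 2) (by positivity))
      have h2 := h1.comp s ((hasDerivAt_id s).div_const (σ ^ 2))
      exact h2.congr_deriv (by ring)
    · unfold profile
      apply ContDiff.rpow_const_of_ne
      · exact contDiff_const.add ((((contDiff_id.sub contDiff_const).norm_sq ℝ).div_const _).pow _)
      · intro x
        positivity
  have hleft : Tendsto (fun k : ℕ => ∫ z, 2 * profile (k + 1) (‖z.1 - x₀‖ ^ 2 / σ ^ 2) *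
        (1 - profileSlope (k + 1) (‖z.1 - x₀‖ ^ 2 / σ ^ 2) *
          (1 - inner ℝ (z.1 - x₀) (z.2 : E3) ^ 2 / ‖z.1 - x₀‖ ^ 2)) ∂V.measure) atTop
      (𝓝 (∫ z, 2 * profileLim (‖z.1 - x₀‖ ^ 2 / σ ^ 2) *
        (1 - profileSlopeLim (‖z.1 - x₀‖ ^ 2 / σ ^ 2) *
          (1 - inner ℝ (z.1 - x₀) (z.2 : E3) ^ 2 / ‖z.1 - x₀‖ ^ 2)) ∂V.measure)) := by
    apply tendsto_integral_of_dominated_convergence (fun _ => (2 : ℝ))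
    · intro k
      have := measurable_profile (k + 1)
      have := measurable_profileSlope (k + 1)
      have hi : Measurable fun z : E3 × OrientedPlane => (inner ℝ (z.1 - x₀) (z.2 : E3) : ℝ) := by
        apply Continuous.measurable; fun_prop
      exact Measurable.aestronglyMeasurable (by fun_prop)
    · exact integrable_const _
    · intro k
      refine Eventually.of_forall fun z => ?_
      have ht : 0 ≤ ‖z.1 - x₀‖ ^ 2 / σ ^ 2 := by positivity
      have h1 := profile_nonneg (k + 1) ht
      have h2 := profile_le_one (k + 1) ht
      have h3 := profileSlope_nonneg (k + 1) ht
      have h4 := profileSlope_le_one (k + 1) ht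
      have h5 := sq_inner_div_le_one z.2 (z.1 - x₀)
      have h6 : 0 ≤ inner ℝ (z.1 - x₀) (z.2 : E3) ^ 2 / ‖z.1 - x₀‖ ^ 2 := by positivity
      set P := profile (k + 1) (‖z.1 - x₀‖ ^ 2 / σ ^ 2)
      set τ := profileSlope (k + 1) (‖z.1 - x₀‖ ^ 2 / σ ^ 2)
      set q := inner ℝ (z.1 - x₀) (z.2 : E3) ^ 2 / ‖z.1 - x₀‖ ^ 2
      have h7 : 0 ≤ τ * (1 - q) := mul_nonneg h3 (by linarith)
      have h8 : τ * (1 - q) ≤ 1 := mul_le_one₀ h4 (by linarith) (by linarith)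
      have h9 : 0 ≤ P * (1 - τ * (1 - q)) := mul_nonneg h1 (by linarith)
      have h10 : P * (1 - τ * (1 - q)) ≤ 1 := mul_le_one₀ h2 (by linarith) (by linarith)
      rw [Real.norm_eq_abs, abs_le]
      constructor <;> linarith
    · refine Eventually.of_forall fun z => ?_
      have ht : 0 ≤ ‖z.1 - x₀‖ ^ 2 / σ ^ 2 := by positivity
      exact ((tendsto_profile ht).const_mul 2).mul
        (((tendsto_profileSlope ht).mul_const _).const_sub 1)
  have hright : Tendsto (fun k : ℕ => -∫ z, profile (k + 1) (‖z.1 - x₀‖ ^ 2 / σ ^ 2) *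
          inner ℝ (z.1 - x₀) (H z.1) ∂V.measure) atTop
      (𝓝 (-∫ z, profileLim (‖z.1 - x₀‖ ^ 2 / σ ^ 2) *
          inner ℝ (z.1 - x₀) (H z.1) ∂V.measure)) := by
    apply Tendsto.neg
    apply tendsto_integral_of_dominated_convergence (fun z => R * ‖H z.1‖)
    · intro k
      have := measurable_profile (k + 1)
      have h1 : AEStronglyMeasurable (fun z : E3 × OrientedPlane => z.1 - x₀) V.measure := by
        apply Continuous.aestronglyMeasurable; fun_prop
      exact (Measurable.aestronglyMeasurable (by fun_prop)).mul (h1.inner hL2.1)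
    · exact ((hL2.integrable (by norm_num)).norm).const_mul R
    · intro k
      filter_upwards [hR] with z hz
      have ht : 0 ≤ ‖z.1 - x₀‖ ^ 2 / σ ^ 2 := by positivity
      have h1 := profile_nonneg (k + 1) ht
      have h2 := profile_le_one (k + 1) ht
      rw [norm_mul, Real.norm_of_nonneg h1]
      calc _ ≤ 1 * (‖z.1 - x₀‖ * ‖H z.1‖) := by
            gcongr
            exact norm_inner_le_norm _ _
        _ ≤ _ := by rw [one_mul]; gcongr
    · refine Eventually.of_forall fun z => ?_
      have ht : 0 ≤ ‖z.1 - x₀‖ ^ 2 / σ ^ 2 := by positivity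
      exact (tendsto_profile ht).mul_const _
  exact tendsto_nhds_unique hleft (hright.congr fun k => (hid k).symm)

/-! ### The Li–Yau estimate for varifolds -/

variable {V : OrientedVarifold} {H : E3 → E3}

lemma measurable_profileLim : Measurable profileLim :=
  Measurable.ite measurableSet_Iio measurable_const measurable_inv

lemma measurable_profileSlopeLim : Measurable profileSlopeLim :=
  Measurable.ite measurableSet_Iio measurable_const
    (Measurable.ite (measurableSet_singleton 1) measurable_const measurable_const)

lemma profileLim_mem {t : ℝ} (ht : 0 ≤ t) : 0 ≤ profileLim t ∧ profileLim t ≤ 1 := by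
  unfold profileLim
  split_ifs with h
  · simp
  · exact ⟨by positivity, inv_le_one_of_one_le₀ (not_lt.1 h)⟩

lemma profileSlopeLim_mem (t : ℝ) : 0 ≤ profileSlopeLim t ∧ profileSlopeLim t ≤ 1 := by
  unfold profileSlopeLim
  split_ifs <;> norm_num

/-- The pointwise inequality behind the estimate of the density: completion of a square outside
the ball of radius `σ`, and the inequality of arithmetic and geometric means inside. -/
lemma density_pointwise (c₀ : ℝ) {σ η : ℝ} (hσ : 0 < σ) (hη : 0 < η) (y h : E3) (ξ : OrientedPlane)
    (hp : h ∈ (ℝ ∙ (ξ : E3))) :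
    Set.indicator {y : E3 | ‖y‖ < σ} (fun _ => (σ ^ 2)⁻¹ * (1 - η / 4)) y
      - 1 / 16 * ‖h - c₀ • (ξ : E3)‖ ^ 2
      + c₀ / 2 * Set.indicator {y : E3 | ‖y‖ < σ}ᶜ (fun y => inner ℝ y (ξ : E3) / ‖y‖ ^ 2) y
      - 1 / (4 * η) * Set.indicator {y : E3 | 0 < ‖y‖ ∧ ‖y‖ < σ} (fun _ => ‖h‖ ^ 2) y
    ≤ (2 * σ ^ 2)⁻¹ * (2 * profileLim (‖y‖ ^ 2 / σ ^ 2) *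
        (1 - profileSlopeLim (‖y‖ ^ 2 / σ ^ 2) * (1 - inner ℝ y (ξ : E3) ^ 2 / ‖y‖ ^ 2))
        + profileLim (‖y‖ ^ 2 / σ ^ 2) * inner ℝ y h) := by
  obtain ⟨a, rfl⟩ := Submodule.mem_span_singleton.1 hp
  have hn : ‖a • (ξ : E3) - c₀ • (ξ : E3)‖ ^ 2 = (a - c₀) ^ 2 := by
    rw [← sub_smul, norm_smul, norm_coe_S2, mul_one, Real.norm_eq_abs, sq_abs]
  have hn' : ‖a • (ξ : E3)‖ ^ 2 = a ^ 2 := by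
    rw [norm_smul, norm_coe_S2, mul_one, Real.norm_eq_abs, sq_abs]
  rw [hn, hn', inner_smul_right]
  have hb := abs_real_inner_le_norm y (ξ : E3)
  rw [norm_coe_S2, mul_one] at hb
  have hq1 := sq_inner_div_le_one ξ y
  set b : ℝ := inner ℝ y (ξ : E3) with hbdef
  by_cases h1 : ‖y‖ < σ
  · have ht : ‖y‖ ^ 2 / σ ^ 2 < 1 := by
      rw [div_lt_one (by positivity)]
      gcongr
    have e1 : profileLim (‖y‖ ^ 2 / σ ^ 2) = 1 := if_pos ht
    have e2 : profileSlopeLim (‖y‖ ^ 2 / σ ^ 2) = 0 := if_pos ht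
    rw [Set.indicator_of_mem (by exact h1), Set.indicator_of_notMem (by simpa using h1), e1, e2]
    have hsq := sq_nonneg (a - c₀)
    by_cases h0 : 0 < ‖y‖
    · rw [Set.indicator_of_mem (by exact ⟨h0, h1⟩)]
      have hbσ : b ^ 2 ≤ σ ^ 2 := by
        rw [← sq_abs b]
        exact pow_le_pow_left₀ (abs_nonneg b) (hb.trans h1.le) 2
      -- Since `|b| ≤ σ`, the product term is at most `|a| / (2σ)`, which splits as `η / (4σ²) + a²
      -- / (4η)`. Algebraically this is `(η + a b)² ≥ 0` together with `b² ≤ σ²`.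
      have key : 0 ≤ (2 * σ ^ 2)⁻¹ * (a * b) + (σ ^ 2)⁻¹ * (η / 4) + 1 / (4 * η) * a ^ 2 := by
        have : (2 * σ ^ 2)⁻¹ * (a * b) + (σ ^ 2)⁻¹ * (η / 4) + 1 / (4 * η) * a ^ 2
            = (4 * η * σ ^ 2)⁻¹ * (2 * η * a * b + η ^ 2 + a ^ 2 * σ ^ 2) := by
          field_simp
          ring
        rw [this]
        have h2 : a ^ 2 * b ^ 2 ≤ a ^ 2 * σ ^ 2 := by gcongr
        have h3 : 0 ≤ (η + a * b) ^ 2 := sq_nonneg _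
        apply mul_nonneg (by positivity)
        nlinarith
      have : (2 * σ ^ 2)⁻¹ * (2 * 1 * (1 - 0 * (1 - b ^ 2 / ‖y‖ ^ 2)) + 1 * (a * b))
          = (σ ^ 2)⁻¹ + (2 * σ ^ 2)⁻¹ * (a * b) := by
        field_simp
        ring
      rw [this]
      linarith
    · rw [Set.indicator_of_notMem (fun h => h0 h.1)]
      -- At the centre the curvature term vanishes, so no multiple of `‖h‖²` is spent there. The
      -- last indicator can therefore omit `y = 0`, where the weight might have an atom.
      have hb0 : b = 0 := by
        have : ‖y‖ = 0 := le_antisymm (not_lt.1 h0) (norm_nonneg _)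
        rw [this] at hb
        exact abs_nonpos_iff.1 hb
      rw [hb0]
      have : (2 * σ ^ 2)⁻¹ * (2 * 1 * (1 - 0 * (1 - (0 : ℝ) ^ 2 / ‖y‖ ^ 2)) + 1 * (a * 0))
          = (σ ^ 2)⁻¹ := by
        field_simp
        ring
      rw [this]
      have : 0 ≤ (σ ^ 2)⁻¹ * (η / 4) := by positivity
      linarith
  · have hyσ : σ ≤ ‖y‖ := not_lt.1 h1
    have hy : 0 < ‖y‖ := hσ.trans_le hyσ
    have ht : ¬ ‖y‖ ^ 2 / σ ^ 2 < 1 := by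
      rw [not_lt, one_le_div (by positivity)]
      gcongr
    have e1 : profileLim (‖y‖ ^ 2 / σ ^ 2) = (‖y‖ ^ 2 / σ ^ 2)⁻¹ := if_neg ht
    obtain ⟨e3, e4⟩ := profileSlopeLim_mem (‖y‖ ^ 2 / σ ^ 2)
    set τ := profileSlopeLim (‖y‖ ^ 2 / σ ^ 2)
    rw [Set.indicator_of_notMem (by exact h1), Set.indicator_of_mem (by exact h1),
      Set.indicator_of_notMem (fun h => h1 h.2), e1]
    -- Off the sphere `‖y‖ = σ` one has `τ = 1` and equality; on it `0 ≤ τ ≤ 1` suffices.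
    have h2 : b ^ 2 / ‖y‖ ^ 2 ≤ 1 - τ * (1 - b ^ 2 / ‖y‖ ^ 2) := by nlinarith
    have h3 : (2 * σ ^ 2)⁻¹ * (2 * (‖y‖ ^ 2 / σ ^ 2)⁻¹ * (1 - τ * (1 - b ^ 2 / ‖y‖ ^ 2))
        + (‖y‖ ^ 2 / σ ^ 2)⁻¹ * (a * b))
        = (‖y‖ ^ 2)⁻¹ * (1 - τ * (1 - b ^ 2 / ‖y‖ ^ 2)) + a * b / (2 * ‖y‖ ^ 2) := by
      field_simp
    rw [h3]
    have h4 : (‖y‖ ^ 2)⁻¹ * (b ^ 2 / ‖y‖ ^ 2) ≤ (‖y‖ ^ 2)⁻¹ * (1 - τ * (1 - b ^ 2 / ‖y‖ ^ 2)) := by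
      gcongr
    have h5 : (‖y‖ ^ 2)⁻¹ * (b ^ 2 / ‖y‖ ^ 2) = (b / ‖y‖ ^ 2) ^ 2 := by field_simp
    have h6 : a * b / (2 * ‖y‖ ^ 2) = a / 2 * (b / ‖y‖ ^ 2) := by field_simp
    -- This square is the only loss outside the ball, apart from the sphere. Its mixed term yields
    -- both `a b / (2‖y‖²)` and the `c₀` term of the concentrated volume.
    have h7 : 0 ≤ ((a - c₀) / 4 + b / ‖y‖ ^ 2) ^ 2 := sq_nonneg _
    rw [h6]
    nlinarith

lemma OrientedVarifold.integrable_normSq_sub (hc : IsCompact V.weight.support)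
    (hH : MemL2Loc H V.weight) (c₀ : ℝ) :
    Integrable (fun z : E3 × OrientedPlane => ‖H z.1 - c₀ • (z.2 : E3)‖ ^ 2) V.measure := by
  have := V.isFiniteMeasure hc
  have h1 : MemLp (fun z : E3 × OrientedPlane => c₀ • (z.2 : E3)) 2 V.measure := by
    refine MemLp.of_bound (C := |c₀|) (Continuous.aestronglyMeasurable (by fun_prop)) ?_
    refine Eventually.of_forall fun z => ?_
    simp [norm_smul]
  exact ((V.memLp_comp_fst hc hH).sub h1).integrable_norm_pow (by norm_num)

/-- The Li–Yau type estimate at scale `σ`. -/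
lemma OrientedVarifold.HasMeanCurvature.density_estimate (hV : V.HasMeanCurvature H)
    (hc : IsCompact V.weight.support) (hH : MemL2Loc H V.weight) (x₀ : E3) (c₀ : ℝ)
    (hG : Integrable (fun z : E3 × OrientedPlane =>
      inner ℝ (z.1 - x₀) (z.2 : E3) / ‖z.1 - x₀‖ ^ 2) V.measure)
    {σ η : ℝ} (hσ : 0 < σ) (hη : 0 < η) :
    (1 - η / 4) * ((σ ^ 2)⁻¹ * V.measure.real {z | ‖z.1 - x₀‖ < σ})
      ≤ 1 / 16 * ∫ z, ‖H z.1 - c₀ • (z.2 : E3)‖ ^ 2 ∂V.measure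
        - c₀ / 2 * ∫ z in {z | ‖z.1 - x₀‖ < σ}ᶜ,
            inner ℝ (z.1 - x₀) (z.2 : E3) / ‖z.1 - x₀‖ ^ 2 ∂V.measure
        + 1 / (4 * η) * ∫ z in {z | 0 < ‖z.1 - x₀‖ ∧ ‖z.1 - x₀‖ < σ}, ‖H z.1‖ ^ 2 ∂V.measure := by
  have := V.isFiniteMeasure hc
  have hL2 := V.memLp_comp_fst hc hH
  obtain ⟨R, hR0, hR⟩ := V.exists_norm_sub_le hc x₀
  have hid := hV.truncated hc hH x₀ hσ
  have hd := measurable_profileLim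
  have hd' := measurable_profileSlopeLim
  have hin : MeasurableSet {z : E3 × OrientedPlane | ‖z.1 - x₀‖ < σ} :=
    measurableSet_lt (by fun_prop) (by fun_prop)
  have hin' : MeasurableSet {z : E3 × OrientedPlane | 0 < ‖z.1 - x₀‖ ∧ ‖z.1 - x₀‖ < σ} :=
    (measurableSet_lt (f := fun _ => (0 : ℝ)) (g := fun z : E3 × OrientedPlane => ‖z.1 - x₀‖)
      (by fun_prop) (by fun_prop)).inter hin
  have iA : Integrable (fun z : E3 × OrientedPlane => 2 * profileLim (‖z.1 - x₀‖ ^ 2 / σ ^ 2) *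
        (1 - profileSlopeLim (‖z.1 - x₀‖ ^ 2 / σ ^ 2) *
          (1 - inner ℝ (z.1 - x₀) (z.2 : E3) ^ 2 / ‖z.1 - x₀‖ ^ 2))) V.measure := by
    have hi : Measurable fun z : E3 × OrientedPlane => (inner ℝ (z.1 - x₀) (z.2 : E3) : ℝ) := by
      apply Continuous.measurable; fun_prop
    refine Integrable.of_bound (C := 2) (Measurable.aestronglyMeasurable (by fun_prop)) ?_
    refine Eventually.of_forall fun z => ?_
    obtain ⟨h1, h2⟩ := profileLim_mem (t := ‖z.1 - x₀‖ ^ 2 / σ ^ 2) (by positivity)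
    obtain ⟨h3, h4⟩ := profileSlopeLim_mem (‖z.1 - x₀‖ ^ 2 / σ ^ 2)
    have h5 := sq_inner_div_le_one z.2 (z.1 - x₀)
    have h6 : 0 ≤ inner ℝ (z.1 - x₀) (z.2 : E3) ^ 2 / ‖z.1 - x₀‖ ^ 2 := by positivity
    set P := profileLim (‖z.1 - x₀‖ ^ 2 / σ ^ 2)
    set τ := profileSlopeLim (‖z.1 - x₀‖ ^ 2 / σ ^ 2)
    set q := inner ℝ (z.1 - x₀) (z.2 : E3) ^ 2 / ‖z.1 - x₀‖ ^ 2
    have h7 : 0 ≤ τ * (1 - q) := mul_nonneg h3 (by linarith)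
    have h8 : τ * (1 - q) ≤ 1 := mul_le_one₀ h4 (by linarith) (by linarith)
    have h9 : 0 ≤ P * (1 - τ * (1 - q)) := mul_nonneg h1 (by linarith)
    have h10 : P * (1 - τ * (1 - q)) ≤ 1 := mul_le_one₀ h2 (by linarith) (by linarith)
    rw [Real.norm_eq_abs, abs_le]
    constructor <;> linarith
  have iB : Integrable (fun z : E3 × OrientedPlane => profileLim (‖z.1 - x₀‖ ^ 2 / σ ^ 2) *
      inner ℝ (z.1 - x₀) (H z.1)) V.measure := by
    refine Integrable.mono' (((hL2.integrable (by norm_num)).norm).const_mul R) ?_ ?_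
    · have h1 : AEStronglyMeasurable (fun z : E3 × OrientedPlane => z.1 - x₀) V.measure := by
        apply Continuous.aestronglyMeasurable; fun_prop
      exact (Measurable.aestronglyMeasurable (by fun_prop)).mul (h1.inner hL2.1)
    · filter_upwards [hR] with z hz
      obtain ⟨h1, h2⟩ := profileLim_mem (t := ‖z.1 - x₀‖ ^ 2 / σ ^ 2) (by positivity)
      rw [norm_mul, Real.norm_of_nonneg h1]
      calc _ ≤ 1 * (‖z.1 - x₀‖ * ‖H z.1‖) := by
            gcongr
            exact norm_inner_le_norm _ _
        _ ≤ _ := by rw [one_mul]; gcongr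
  have iW := V.integrable_normSq_sub hc hH c₀
  have iH : Integrable (fun z : E3 × OrientedPlane => ‖H z.1‖ ^ 2) V.measure :=
    hL2.integrable_norm_pow (by norm_num)
  have i1 : Integrable (Set.indicator {z : E3 × OrientedPlane | ‖z.1 - x₀‖ < σ}
      fun _ => (σ ^ 2)⁻¹ * (1 - η / 4)) V.measure := (integrable_const _).indicator hin
  have i3 := (hG.indicator hin.compl).const_mul (c₀ / 2)
  have i4 := (iH.indicator hin').const_mul (1 / (4 * η))
  have hzero : ∫ z, (2 * σ ^ 2)⁻¹ * (2 * profileLim (‖z.1 - x₀‖ ^ 2 / σ ^ 2) *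
        (1 - profileSlopeLim (‖z.1 - x₀‖ ^ 2 / σ ^ 2) *
          (1 - inner ℝ (z.1 - x₀) (z.2 : E3) ^ 2 / ‖z.1 - x₀‖ ^ 2))
        + profileLim (‖z.1 - x₀‖ ^ 2 / σ ^ 2) * inner ℝ (z.1 - x₀) (H z.1)) ∂V.measure = 0 := by
    rw [integral_const_mul, integral_add iA iB, hid]
    ring
  have hmono := integral_mono_ae (((i1.sub (iW.const_mul (1 / 16))).add i3).sub i4)
    ((iA.add iB).const_mul (2 * σ ^ 2)⁻¹) (by
      filter_upwards [hV.perpendicular] with z hz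
      exact density_pointwise c₀ hσ hη (z.1 - x₀) (H z.1) z.2 hz)
  have e4 := hmono.trans_eq hzero
  rw [integral_sub' ((i1.sub (iW.const_mul (1 / 16))).add i3) i4,
    integral_add' (i1.sub (iW.const_mul (1 / 16))) i3, integral_sub' i1 (iW.const_mul (1 / 16)),
    integral_const_mul, integral_const_mul, integral_const_mul, integral_indicator hin,
    integral_indicator hin.compl, integral_indicator hin', setIntegral_const, smul_eq_mul] at e4
  linarith

lemma OrientedVarifold.frequently_density_le (V : OrientedVarifold) [IsFiniteMeasure V.measure]
    {x₀ : E3} (hd : 1 ≤ upperDensity V.weight x₀) {b : ℝ} (hb0 : 0 < b) (hb1 : b < 1) :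
    ∃ᶠ σ in 𝓝[>] (0 : ℝ), b * Real.pi ≤ (σ ^ 2)⁻¹ * V.measure.real {z | ‖z.1 - x₀‖ < σ} := by
  -- The density is defined with closed balls, the estimate uses open ones. Enlarging the radius by
  -- `κ = √(a / b) > 1` costs the factor `a / b`, which the choice `b < a < 1` affords.
  obtain ⟨a, hba, ha1⟩ := exists_between hb1
  have ha0 : 0 < a := hb0.trans hba
  set κ : ℝ := Real.sqrt (a / b) with hκ
  have hκ2 : κ ^ 2 = a / b := Real.sq_sqrt (by positivity)
  have hκ1 : 1 < κ := by
    rw [hκ, Real.lt_sqrt zero_le_one, one_pow, one_lt_div hb0]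
    exact hba
  have hlim : ENNReal.ofReal a < upperDensity V.weight x₀ := by
    refine lt_of_lt_of_le ?_ hd
    simpa using ha1
  have h1 := frequently_lt_of_lt_limsup (by isBoundedDefault) hlim
  have h2 : Tendsto (fun ρ : ℝ => κ * ρ) (𝓝[>] 0) (𝓝[>] 0) := by
    apply tendsto_nhdsWithin_of_tendsto_nhds_of_eventually_within
    · have : Tendsto (fun ρ : ℝ => κ * ρ) (𝓝 0) (𝓝 (κ * 0)) := tendsto_id.const_mul κ
      rw [mul_zero] at this
      exact this.mono_left nhdsWithin_le_nhds
    · filter_upwards [self_mem_nhdsWithin] with ρ hρ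
      exact mul_pos (zero_lt_one.trans hκ1) hρ
  apply h2.frequently
  refine (h1.and_eventually self_mem_nhdsWithin).mono ?_
  rintro ρ ⟨hρ, hρ0 : 0 < ρ⟩
  have h3 : ENNReal.ofReal (a * (Real.pi * ρ ^ 2)) ≤ V.weight (closedBall x₀ ρ) := by
    rw [ENNReal.ofReal_mul ha0.le]
    refine (ENNReal.le_div_iff_mul_le (Or.inl ?_) (Or.inl ENNReal.ofReal_ne_top)).1 hρ.le
    simp only [ne_eq, ENNReal.ofReal_eq_zero, not_le]
    positivity
  have h4 : V.weight (closedBall x₀ ρ) ≤ V.measure {z | ‖z.1 - x₀‖ < κ * ρ} := by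
    unfold OrientedVarifold.weight
    rw [Measure.map_apply measurable_fst isClosed_closedBall.measurableSet]
    apply measure_mono
    intro z hz
    have : ‖z.1 - x₀‖ ≤ ρ := by simpa [dist_eq_norm] using hz
    show ‖z.1 - x₀‖ < κ * ρ
    nlinarith
  have h5 : a * (Real.pi * ρ ^ 2) ≤ V.measure.real {z | ‖z.1 - x₀‖ < κ * ρ} :=
    (ENNReal.ofReal_le_iff_le_toReal (measure_ne_top _ _)).1 (h3.trans h4)
  have h6 : ((κ * ρ) ^ 2)⁻¹ * (a * (Real.pi * ρ ^ 2)) = b * Real.pi := by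
    rw [mul_pow, hκ2]
    field_simp
  rw [← h6]
  gcongr

/-- The Li–Yau inequality for the Helfrich energy of varifolds. -/
theorem OrientedVarifold.HasMeanCurvature.four_pi_lt_helfrich (hV : V.HasMeanCurvature H)
    (hc : IsCompact V.weight.support) (hH : MemL2Loc H V.weight) {x₀ : E3} {c₀ : ℝ}
    (hc₀ : c₀ < 0) (hd : 1 ≤ upperDensity V.weight x₀) (hvol : 0 < V.concentratedVolume x₀) :
    ENNReal.ofReal (4 * Real.pi) < V.helfrich H c₀ := by
  have := V.isFiniteMeasure hc
  have hL2 := V.memLp_comp_fst hc hH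
  have iH : Integrable (fun z : E3 × OrientedPlane => ‖H z.1‖ ^ 2) V.measure :=
    hL2.integrable_norm_pow (by norm_num)
  have hG : Integrable (fun z : E3 × OrientedPlane =>
      inner ℝ (z.1 - x₀) (z.2 : E3) / ‖z.1 - x₀‖ ^ 2) V.measure := by
    -- A nonexistent integral would have the value 0, contradicting positivity of the concentrated
    -- volume.
    by_contra h
    unfold OrientedVarifold.concentratedVolume at hvol
    rw [integral_undef h] at hvol
    simp at hvol
  set W := ∫ z, ‖H z.1 - c₀ • (z.2 : E3)‖ ^ 2 ∂V.measure with hW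
  have hin : ∀ σ : ℝ, MeasurableSet {z : E3 × OrientedPlane | ‖z.1 - x₀‖ < σ} := fun σ =>
    measurableSet_lt (by fun_prop) (by fun_prop)
  have hin' : ∀ σ : ℝ,
      MeasurableSet {z : E3 × OrientedPlane | 0 < ‖z.1 - x₀‖ ∧ ‖z.1 - x₀‖ < σ} := fun σ =>
    (measurableSet_lt (f := fun _ => (0 : ℝ)) (g := fun z : E3 × OrientedPlane => ‖z.1 - x₀‖)
      (by fun_prop) (by fun_prop)).inter (hin σ)
  have t1 : Tendsto (fun σ : ℝ => ∫ z in {z | ‖z.1 - x₀‖ < σ}ᶜ,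
      inner ℝ (z.1 - x₀) (z.2 : E3) / ‖z.1 - x₀‖ ^ 2 ∂V.measure) (𝓝[>] 0)
      (𝓝 (-V.concentratedVolume x₀)) := by
    unfold OrientedVarifold.concentratedVolume
    rw [neg_neg]
    simp_rw [fun σ : ℝ => (integral_indicator (μ := V.measure)
      (f := fun z : E3 × OrientedPlane => (inner ℝ (z.1 - x₀) (z.2 : E3) : ℝ) / ‖z.1 - x₀‖ ^ 2)
      (hin σ).compl).symm]
    refine tendsto_integral_filter_of_dominated_convergence _
      (Eventually.of_forall fun σ => (hG.indicator (hin σ).compl).1)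
      (Eventually.of_forall fun σ => Eventually.of_forall fun z => norm_indicator_le_norm_self _ _)
      hG.norm (Eventually.of_forall fun z => ?_)
    by_cases hz : z.1 - x₀ = 0
    -- At `z.1 = x₀` the integrand is `0 / 0 = 0`, so excluding the ball loses nothing at the
    -- centre.
    · refine tendsto_const_nhds.congr fun σ => ?_
      by_cases hm : z ∈ {z : E3 × OrientedPlane | ‖z.1 - x₀‖ < σ}ᶜ
      · rw [Set.indicator_of_mem hm]
      · rw [Set.indicator_of_notMem hm, hz]
        simp
    · have : 0 < ‖z.1 - x₀‖ := norm_pos_iff.2 hz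
      apply tendsto_const_nhds.congr'
      filter_upwards [nhdsWithin_le_nhds (Iio_mem_nhds this)] with σ hσ
      rw [Set.indicator_of_mem]
      simpa using le_of_lt hσ
  have t2 : Tendsto (fun σ : ℝ => ∫ z in {z | 0 < ‖z.1 - x₀‖ ∧ ‖z.1 - x₀‖ < σ}, ‖H z.1‖ ^ 2
      ∂V.measure) (𝓝[>] 0) (𝓝 0) := by
    simp_rw [fun σ : ℝ => (integral_indicator (μ := V.measure)
      (f := fun z : E3 × OrientedPlane => ‖H z.1‖ ^ 2) (hin' σ)).symm]
    have e0 : (0 : ℝ) = ∫ _z : E3 × OrientedPlane, (0 : ℝ) ∂V.measure := by simp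
    rw [congrArg 𝓝 e0]
    refine tendsto_integral_filter_of_dominated_convergence _
      (Eventually.of_forall fun σ => (iH.indicator (hin' σ)).1)
      (Eventually.of_forall fun σ => Eventually.of_forall fun z => norm_indicator_le_norm_self _ _)
      iH.norm (Eventually.of_forall fun z => ?_)
    apply tendsto_const_nhds.congr'
    by_cases hz : z.1 - x₀ = 0
    · refine Eventually.of_forall fun σ => ?_
      exact (Set.indicator_of_notMem (by simp [hz]) _).symm
    · have : 0 < ‖z.1 - x₀‖ := norm_pos_iff.2 hz
      filter_upwards [nhdsWithin_le_nhds (Iio_mem_nhds this)] with σ hσ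
      rw [Set.indicator_of_notMem]
      exact fun h => absurd h.2 (not_lt.2 (le_of_lt hσ))
  -- One factor `1 - ε` comes from the density, the other from the choice `η = 4ε`. The remaining
  -- terms converge as `σ → 0`, so good radii are needed only frequently, which is what an upper
  -- density provides.
  have key : ∀ ε : ℝ, 0 < ε → ε < 1 →
      (1 - ε) * ((1 - ε) * Real.pi) ≤ 1 / 16 * W + c₀ / 2 * V.concentratedVolume x₀ := by
    intro ε h0 h1
    have t3 := ((tendsto_const_nhds (x := 1 / 16 * W)).sub (t1.const_mul (c₀ / 2))).add
      (t2.const_mul (1 / (4 * (4 * ε))))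
    by_contra hcon
    push Not at hcon
    have h2 := t3.eventually_lt_const (u := (1 - ε) * ((1 - ε) * Real.pi)) (by linarith)
    obtain ⟨σ, hσ1, hσ2, hσ3⟩ := ((V.frequently_density_le hd (b := 1 - ε) (by linarith)
      (by linarith)).and_eventually (h2.and self_mem_nhdsWithin)).exists
    have h3 := hV.density_estimate hc hH x₀ c₀ hG (σ := σ) (η := 4 * ε) hσ3 (by linarith)
    have h4 : (1 - 4 * ε / 4) = 1 - ε := by ring
    rw [h4] at h3
    have h5 := mul_le_mul_of_nonneg_left hσ1 (by linarith : 0 ≤ 1 - ε)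
    linarith
  have hpi : Real.pi ≤ 1 / 16 * W + c₀ / 2 * V.concentratedVolume x₀ := by
    have t4 : Tendsto (fun ε : ℝ => (1 - ε) * ((1 - ε) * Real.pi)) (𝓝[>] 0)
        (𝓝 ((1 - 0) * ((1 - 0) * Real.pi))) :=
      (Continuous.tendsto (by fun_prop) 0).mono_left nhdsWithin_le_nhds
    simp only [sub_zero, one_mul] at t4
    refine le_of_tendsto t4 ?_
    filter_upwards [self_mem_nhdsWithin, nhdsWithin_le_nhds (Iio_mem_nhds zero_lt_one)] with ε h0 h1
    exact key ε h0 h1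
  have hneg : c₀ / 2 * V.concentratedVolume x₀ < 0 := mul_neg_of_neg_of_pos (by linarith) hvol
  have hhel : V.helfrich H c₀ = ENNReal.ofReal (1 / 4 * W) := by
    unfold OrientedVarifold.helfrich
    rw [hW, ENNReal.ofReal_mul (by norm_num),
      ofReal_integral_eq_lintegral_ofReal (V.integrable_normSq_sub hc hH c₀)
        (Eventually.of_forall fun z => by positivity)]
    congr 1
    · rw [one_div, ENNReal.ofReal_inv_of_pos (by norm_num)]
      norm_num
    · congr 1
      ext z
      rw [ENNReal.ofReal_pow (norm_nonneg _), ofReal_norm]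
  rw [hhel, ENNReal.ofReal_lt_ofReal_iff_of_nonneg (by positivity)]
  linarith

/-! ### Cross products and cofactors -/

lemma cross_zero (v w : E3) : cross v w 0 = v 1 * w 2 - v 2 * w 1 := by simp [cross, crossProduct]

lemma cross_one (v w : E3) : cross v w 1 = v 2 * w 0 - v 0 * w 2 := by simp [cross, crossProduct]

lemma cross_two (v w : E3) : cross v w 2 = v 0 * w 1 - v 1 * w 0 := by simp [cross, crossProduct]

lemma E3_ext {v w : E3} (h0 : v 0 = w 0) (h1 : v 1 = w 1) (h2 : v 2 = w 2) : v = w := by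
  ext i
  fin_cases i
  exacts [h0, h1, h2]

/-- The action of the cofactor matrix of `M` on a vector. -/
def cof (M : E3 →L[ℝ] E3) (v : E3) : E3 :=
  v 0 • cross (M (EuclideanSpace.single 1 1)) (M (EuclideanSpace.single 2 1)) +
  v 1 • cross (M (EuclideanSpace.single 2 1)) (M (EuclideanSpace.single 0 1)) +
  v 2 • cross (M (EuclideanSpace.single 0 1)) (M (EuclideanSpace.single 1 1))

lemma E3_eq_sum (v : E3) : v = v 0 • EuclideanSpace.single 0 1 + v 1 • EuclideanSpace.single 1 1 +
    v 2 • EuclideanSpace.single 2 1 := by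
  apply E3_ext <;> simp

lemma map_apply_coord (M : E3 →L[ℝ] E3) (v : E3) (i : Fin 3) :
    M v i = v 0 * M (EuclideanSpace.single 0 1) i + v 1 * M (EuclideanSpace.single 1 1) i +
      v 2 * M (EuclideanSpace.single 2 1) i := by
  conv_lhs => rw [E3_eq_sum v]
  simp

/-- This is what removes frames: `cross (frame p 0) (frame p 1)` is `-p`, so cross products of
images of the frame become `cof` evaluated at `-p`. -/
lemma cross_map (M : E3 →L[ℝ] E3) (u v : E3) : cross (M u) (M v) = cof M (cross u v) := by
  apply E3_ext <;>
  simp only [cof, cross_zero, cross_one, cross_two, PiLp.add_apply, PiLp.smul_apply, smul_eq_mul,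
    map_apply_coord M u, map_apply_coord M v] <;> ring

lemma det_eq_inner_cross (M : E3 →L[ℝ] E3) :
    M.det = inner ℝ (cross (M (EuclideanSpace.single 0 1)) (M (EuclideanSpace.single 1 1)))
      (M (EuclideanSpace.single 2 1)) := by
  have h : M.det = (LinearMap.toMatrix (EuclideanSpace.basisFun (Fin 3) ℝ).toBasis
      (EuclideanSpace.basisFun (Fin 3) ℝ).toBasis (M : E3 →ₗ[ℝ] E3)).det :=
    (LinearMap.det_toMatrix _ _).symm
  rw [h, Matrix.det_fin_three, inner_eq_sum]
  simp only [LinearMap.toMatrix_apply, cross_zero, cross_one, cross_two,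
    OrthonormalBasis.coe_toBasis, OrthonormalBasis.coe_toBasis_repr_apply,
    EuclideanSpace.basisFun_apply, EuclideanSpace.basisFun_repr, ContinuousLinearMap.coe_coe]
  ring

/-- The identity `(cof M)ᵀ M = det M`. It lets the determinants below be read off from a single
vector, usually the radial one. -/
lemma inner_cof_map (M : E3 →L[ℝ] E3) (u v : E3) :
    inner ℝ (cof M u) (M v) = M.det * inner ℝ u v := by
  rw [det_eq_inner_cross]
  simp only [inner_eq_sum, cof, cross_zero, cross_one, cross_two, PiLp.add_apply, PiLp.smul_apply,
    smul_eq_mul, map_apply_coord M v]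
  ring

lemma inner_cross_cross (a b c d : E3) : inner ℝ (cross a b) (cross c d)
    = inner ℝ a c * inner ℝ b d - inner ℝ a d * inner ℝ b c := by
  simp only [inner_eq_sum, cross_zero, cross_one, cross_two]
  ring

lemma inner_cross_self_left (a b : E3) : inner ℝ (cross a b) a = 0 := by
  simp only [inner_eq_sum, cross_zero, cross_one, cross_two]
  ring

lemma inner_cross_self_right (a b : E3) : inner ℝ (cross a b) b = 0 := by
  simp only [inner_eq_sum, cross_zero, cross_one, cross_two]
  ring

lemma cross_add_add (a b c d : E3) :
    cross (a + b) (c + d) = cross a c + cross b d + (cross a d + cross b c) := by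
  apply E3_ext <;> simp only [cross_zero, cross_one, cross_two, PiLp.add_apply] <;> ring

/-- A vector orthogonal to two vectors is a multiple of their cross product. -/
lemma norm_sq_cross_smul_eq {a b v : E3} (ha : inner ℝ v a = 0) (hb : inner ℝ v b = 0) :
    ‖cross a b‖ ^ 2 • v = inner ℝ (cross a b) v • cross a b := by
  rw [← real_inner_self_eq_norm_sq]
  simp only [inner_eq_sum] at ha hb ⊢
  apply E3_ext <;> simp only [cross_zero, cross_one, cross_two, PiLp.smul_apply, smul_eq_mul]
  · linear_combination
      ((a 0 * b 1 - a 1 * b 0) * b 1 - (a 2 * b 0 - a 0 * b 2) * b 2) * ha -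
      ((a 0 * b 1 - a 1 * b 0) * a 1 - (a 2 * b 0 - a 0 * b 2) * a 2) * hb
  · linear_combination
      ((a 1 * b 2 - a 2 * b 1) * b 2 - (a 0 * b 1 - a 1 * b 0) * b 0) * ha -
      ((a 1 * b 2 - a 2 * b 1) * a 2 - (a 0 * b 1 - a 1 * b 0) * a 0) * hb
  · linear_combination
      ((a 2 * b 0 - a 0 * b 2) * b 0 - (a 1 * b 2 - a 2 * b 1) * b 1) * ha -
      ((a 2 * b 0 - a 0 * b 2) * a 0 - (a 1 * b 2 - a 2 * b 1) * a 1) * hb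

lemma contDiffAt_cross {E : Type*} [NormedAddCommGroup E] [NormedSpace ℝ E] {n : WithTop ℕ∞}
    {u v : E → E3} {x : E} (hu : ContDiffAt ℝ n u x) (hv : ContDiffAt ℝ n v x) :
    ContDiffAt ℝ n (fun y => cross (u y) (v y)) x := by
  rw [contDiffAt_euclidean] at hu hv ⊢
  intro i
  fin_cases i
  · exact (((hu 1).mul (hv 2)).sub ((hu 2).mul (hv 1))).congr_of_eventuallyEq
      (Eventually.of_forall fun y => cross_zero _ _)
  · exact (((hu 2).mul (hv 0)).sub ((hu 0).mul (hv 2))).congr_of_eventuallyEq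
      (Eventually.of_forall fun y => cross_one _ _)
  · exact (((hu 0).mul (hv 1)).sub ((hu 1).mul (hv 0))).congr_of_eventuallyEq
      (Eventually.of_forall fun y => cross_two _ _)

lemma contDiffAt_cof {E : Type*} [NormedAddCommGroup E] [NormedSpace ℝ E] {n : WithTop ℕ∞}
    {M : E → E3 →L[ℝ] E3} {v : E → E3} {x : E} (hM : ContDiffAt ℝ n M x)
    (hv : ContDiffAt ℝ n v x) : ContDiffAt ℝ n (fun y => cof (M y) (v y)) x := by
  have hv' := contDiffAt_euclidean.1 hv
  have hM' : ∀ w : E3, ContDiffAt ℝ n (fun y => M y w) x := fun w => hM.clm_apply contDiffAt_const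
  exact (((hv' 0).smul (contDiffAt_cross (hM' _) (hM' _))).add
    ((hv' 1).smul (contDiffAt_cross (hM' _) (hM' _)))).add
    ((hv' 2).smul (contDiffAt_cross (hM' _) (hM' _)))

lemma cof_neg (M : E3 →L[ℝ] E3) (v : E3) : cof M (-v) = -cof M v := by
  simp only [cof, PiLp.neg_apply]
  module

lemma cof_smul (M : E3 →L[ℝ] E3) (r : ℝ) (v : E3) : cof M (r • v) = r • cof M v := by
  simp only [cof, PiLp.smul_apply, smul_eq_mul]
  module

lemma cross_smul_smul (r : ℝ) (u v : E3) : cross (r • u) (r • v) = r ^ 2 • cross u v := by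
  apply E3_ext <;> simp only [cross_zero, cross_one, cross_two, PiLp.smul_apply, smul_eq_mul] <;>
    ring

lemma cof_smul_left (M : E3 →L[ℝ] E3) (r : ℝ) (v : E3) : cof (r • M) v = r ^ 2 • cof M v := by
  simp only [cof, smul_apply, cross_smul_smul]
  module

/-- The discriminant inequality between mean and Gauss curvature. -/
lemma four_mul_det_le_sq {a b c x y z : ℝ} (ha : 0 < a) (hg : 0 ≤ a * c - b ^ 2) :
    4 * (a * c - b ^ 2) * (x * z - y ^ 2) ≤ (c * x - 2 * b * y + a * z) ^ 2 := by
  have key : a ^ 2 * ((c * x - 2 * b * y + a * z) ^ 2 - 4 * (a * c - b ^ 2) * (x * z - y ^ 2))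
      = (a * (a * z - c * x) - 2 * b * (a * y - b * x)) ^ 2 +
        4 * (a * c - b ^ 2) * (a * y - b * x) ^ 2 := by ring
  have h2 : 0 ≤ a ^ 2 * ((c * x - 2 * b * y + a * z) ^ 2 -
      4 * (a * c - b ^ 2) * (x * z - y ^ 2)) := by
    rw [key]; positivity
  have := nonneg_of_mul_nonneg_right h2 (by positivity)
  linarith

/-- Multiplication by `a` splits the trace into `(a c - b²) x` and the value of the semidefinite
form with entries `x, y, z` on the vector `(b, -a)`. -/
lemma trace_nonneg_of_nonneg {a b c x y z : ℝ} (ha : 0 < a) (hg : 0 ≤ a * c - b ^ 2) (hx : 0 ≤ x)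
    (hz : 0 ≤ z) (hh : 0 ≤ x * z - y ^ 2) : 0 ≤ c * x - 2 * b * y + a * z := by
  have h0 : a * (c * x - 2 * b * y + a * z) = (a * c - b ^ 2) * x + (b ^ 2 * x - 2 * a * b * y +
      a ^ 2 * z) := by ring
  have h1 : 0 ≤ b ^ 2 * x - 2 * a * b * y + a ^ 2 * z := by
    rcases hx.eq_or_lt with h | h
    · have hy : y = 0 := by
        rw [← h] at hh
        nlinarith [sq_nonneg y]
      rw [← h, hy]
      have : 0 ≤ a ^ 2 * z := by positivity
      linarith
    · have : x * (b ^ 2 * x - 2 * a * b * y + a ^ 2 * z) = (b * x - a * y) ^ 2 +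
          a ^ 2 * (x * z - y ^ 2) := by ring
      exact nonneg_of_mul_nonneg_right (this ▸ by positivity) h
  exact nonneg_of_mul_nonneg_right (h0 ▸ by positivity) ha

section

/-! ### Homogeneous maps and the radial extension -/

/-- Maps which are constant along open rays from the origin. -/
def IsRadial {F : Type*} (G : E3 → F) : Prop := ∀ r : ℝ, 0 < r → ∀ x, G (r • x) = G x

lemma IsRadial.fderiv_smul {G : E3 → E3} (hG : IsRadial G) {r : ℝ} (hr : 0 < r) (x : E3) :
    fderiv ℝ G (r • x) = r⁻¹ • fderiv ℝ G x := by
  have h := fderiv_comp_smul (𝕜 := ℝ) (f := G) (x := x) r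
  have h2 : (fun x => G (r • x)) = G := funext fun x => hG r hr x
  rw [h2] at h
  rw [h, smul_smul, inv_mul_cancel₀ hr.ne', one_smul]

lemma IsRadial.fderiv_self {G : E3 → E3} (hG : IsRadial G) {x : E3}
    (hd : DifferentiableAt ℝ G x) : fderiv ℝ G x x = 0 := by
  have h1 : HasDerivAt (fun t : ℝ => t • x) x 1 := by
    simpa using (hasDerivAt_id (1 : ℝ)).smul_const x
  have h2 : HasFDerivAt G (fderiv ℝ G x) ((1 : ℝ) • x) := by
    rw [one_smul]
    exact hd.hasFDerivAt
  have h3 := h2.comp_hasDerivAt (1 : ℝ) h1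
  have h4 : HasDerivAt (G ∘ fun t : ℝ => t • x) 0 1 := by
    refine (hasDerivAt_const (1 : ℝ) (G x)).congr_of_eventuallyEq ?_
    filter_upwards [Ioi_mem_nhds (zero_lt_one' ℝ)] with t ht
    exact hG t ht x
  exact h3.unique h4

lemma radialExtension_isRadial (f : S2 → E3) : IsRadial (radialExtension f) := by
  intro r hr x
  unfold radialExtension
  by_cases hx : x = 0
  · simp [hx]
  · have hrx : r • x ≠ 0 := smul_ne_zero hr.ne' hx
    rw [dif_neg hrx, dif_neg hx]
    congr 2
    rw [norm_smul, Real.norm_of_nonneg hr.le, smul_smul]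
    congr 1
    have := norm_ne_zero_iff.2 hx
    field_simp

lemma coe_S2_ne_zero (p : S2) : (p : E3) ≠ 0 := by
  rw [← norm_ne_zero_iff, norm_coe_S2]
  exact one_ne_zero

lemma radialExtension_coe (f : S2 → E3) (p : S2) : radialExtension f p = f p := by
  unfold radialExtension
  rw [dif_neg (coe_S2_ne_zero p)]
  congr 1
  ext1
  simp

lemma fact_finrank_E3 : Fact (Module.finrank ℝ E3 = 2 + 1) := ⟨by simp⟩

variable {f : S2 → E3}

/-- Away from the origin the extension is `f` composed with the smooth retraction to the sphere.
This is the passage from manifold smoothness to Euclidean calculus. -/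
lemma contDiffAt_radialExtension (hf : ContMDiff (𝓡 2) 𝓘(ℝ, E3) ∞ f) {x : E3} (hx : x ≠ 0) :
    ContDiffAt ℝ ∞ (radialExtension f) x := by
  have := fact_finrank_E3
  let U : TopologicalSpace.Opens E3 := ⟨{0}ᶜ, isOpen_compl_singleton⟩
  have hg : ContMDiff 𝓘(ℝ, E3) 𝓘(ℝ, E3) ∞ (fun y : U => ‖(y : E3)‖⁻¹ • (y : E3)) := by
    intro y
    apply (contMDiffAt_subtype_iff (f := fun y : E3 => ‖y‖⁻¹ • y)).2
    apply ContDiffAt.contMDiffAt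
    have hy : (y : E3) ≠ 0 := y.2
    exact ((contDiffAt_norm ℝ hy).inv (norm_ne_zero_iff.2 hy)).smul contDiffAt_id
  have hg' : ∀ y : U, ‖(y : E3)‖⁻¹ • (y : E3) ∈ sphere (0 : E3) 1 := by
    intro y
    have hy : (y : E3) ≠ 0 := y.2
    simp [norm_smul, inv_mul_cancel₀ (norm_ne_zero_iff.2 hy)]
  have h1 := hf.comp (hg.codRestrict_sphere hg')
  have h2 : (f ∘ Set.codRestrict (fun y : U => ‖(y : E3)‖⁻¹ • (y : E3)) _ hg')
      = fun y : U => radialExtension f y := by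
    ext1 y
    have hy : (y : E3) ≠ 0 := y.2
    unfold radialExtension
    rw [dif_neg hy]
    rfl
  rw [h2] at h1
  exact (contMDiffAt_subtype_iff.1 (h1 ⟨x, hx⟩)).contDiffAt

lemma differentiableAt_radialExtension (hf : ContMDiff (𝓡 2) 𝓘(ℝ, E3) ∞ f) {x : E3} (hx : x ≠ 0) :
    DifferentiableAt ℝ (radialExtension f) x :=
  (contDiffAt_radialExtension hf hx).differentiableAt (by simp)

lemma contDiffAt_fderiv_radialExtension (hf : ContMDiff (𝓡 2) 𝓘(ℝ, E3) ∞ f) {x : E3}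
    (hx : x ≠ 0) : ContDiffAt ℝ ∞ (fderiv ℝ (radialExtension f)) x :=
  (contDiffAt_radialExtension hf hx).fderiv_right (m := ∞) (by simp)

lemma mfderiv_eq_fderiv_comp (hf : ContMDiff (𝓡 2) 𝓘(ℝ, E3) ∞ f) (p : S2)
    (v : TangentSpace (𝓡 2) p) :
    mfderiv (𝓡 2) 𝓘(ℝ, E3) f p v = fderiv ℝ (radialExtension f) (p : E3)
      (mfderiv (𝓡 2) 𝓘(ℝ, E3) ((↑) : S2 → E3) p v) := by
  have := fact_finrank_E3
  have h1 : f = radialExtension f ∘ ((↑) : S2 → E3) := by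
    ext1 q
    exact (radialExtension_coe f q).symm
  have h2 : MDifferentiableAt 𝓘(ℝ, E3) 𝓘(ℝ, E3) (radialExtension f) (p : E3) :=
    (differentiableAt_radialExtension hf (coe_S2_ne_zero p)).mdifferentiableAt
  have h3 : MDifferentiableAt (𝓡 2) 𝓘(ℝ, E3) ((↑) : S2 → E3) p :=
    (contMDiff_coe_sphere (m := 1) p).mdifferentiableAt one_ne_zero
  have h4 := mfderiv_comp p h2 h3
  rw [← h1, mfderiv_eq_fderiv] at h4
  rw [h4]
  rfl

lemma eq_zero_of_fderiv_radialExtension (hf : ContMDiff (𝓡 2) 𝓘(ℝ, E3) ∞ f) (p : S2)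
    (hi : Function.Injective (mfderiv (𝓡 2) 𝓘(ℝ, E3) f p)) {v : E3}
    (hv : inner ℝ (p : E3) v = 0) (h0 : fderiv ℝ (radialExtension f) p v = 0) : v = 0 := by
  have := fact_finrank_E3
  have hv' : v ∈ (ℝ ∙ (p : E3))ᗮ := Submodule.mem_orthogonal_singleton_iff_inner_right.2 hv
  rw [← range_mvfderiv_subtypeVal (n := 2) p] at hv'
  obtain ⟨u, hu⟩ := hv'
  have hu' : mfderiv (𝓡 2) 𝓘(ℝ, E3) ((↑) : S2 → E3) p u = v := hu
  have h1 := mfderiv_eq_fderiv_comp hf p u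
  rw [hu', h0] at h1
  have h2 : u = 0 := hi (h1.trans (map_zero _).symm)
  rw [← hu', h2]
  exact map_zero _

/-! ### The frame -/

lemma frame_orthonormal (p : S2) : Orthonormal ℝ (frame p) := (exists_frame p).choose_spec.1

lemma cross_frame (p : S2) : cross (frame p 0) (frame p 1) = -(p : E3) :=
  (exists_frame p).choose_spec.2

lemma inner_coe_frame (p : S2) (i : Fin 2) : inner ℝ (p : E3) (frame p i) = 0 := by
  have h : (p : E3) = -cross (frame p 0) (frame p 1) := by rw [cross_frame, neg_neg]
  rw [h, inner_neg_left]
  fin_cases i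
  · simp [inner_cross_self_left]
  · simp [inner_cross_self_right]

/-! ### Normal field and area element of the radial extension -/

/-- The vector `∂₀f × ∂₁f` for positive orthonormal frames, extended along rays. -/
def areaVec (f : S2 → E3) (x : E3) : E3 := -cof (fderiv ℝ (radialExtension f) x) x

/-- The unit normal field of `f`, extended along rays. -/
def normalExt (f : S2 → E3) (x : E3) : E3 := ‖areaVec f x‖⁻¹ • areaVec f x

/-- The frame is chosen pointwise and need not be continuous. `areaVec` gives the same vector
without it, and is therefore smooth. -/
lemma cross_fderiv_frame (f : S2 → E3) (p : S2) :
    cross (fderiv ℝ (radialExtension f) p (frame p 0)) (fderiv ℝ (radialExtension f) p (frame p 1))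
      = areaVec f p := by
  rw [cross_map, cross_frame, cof_neg, areaVec]

lemma areaVec_smul (f : S2 → E3) {r : ℝ} (hr : 0 < r) (x : E3) :
    areaVec f (r • x) = r⁻¹ • areaVec f x := by
  unfold areaVec
  rw [(radialExtension_isRadial f).fderiv_smul hr, cof_smul_left, cof_smul, smul_smul, smul_neg]
  congr 2
  field_simp

lemma normalExt_isRadial (f : S2 → E3) : IsRadial (normalExt f) := by
  intro r hr x
  unfold normalExt
  rw [areaVec_smul f hr, norm_smul, smul_smul, Real.norm_of_nonneg (inv_nonneg.2 hr.le)]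
  congr 1
  by_cases h : ‖areaVec f x‖ = 0
  · simp [h]
  · field_simp

/-- Smooth immersions of the sphere. -/
structure IsSmoothImmersion (f : S2 → E3) : Prop where
  smooth : ContMDiff (𝓡 2) 𝓘(ℝ, E3) ∞ f
  immersion : ∀ p, Function.Injective (mfderiv (𝓡 2) 𝓘(ℝ, E3) f p)

lemma exists_pos_smul_coe {x : E3} (hx : x ≠ 0) : ∃ r : ℝ, 0 < r ∧ ∃ p : S2, x = r • (p : E3) := by
  have h := norm_ne_zero_iff.2 hx
  refine ⟨‖x‖, norm_pos_iff.2 hx, ⟨‖x‖⁻¹ • x, by simp [norm_smul, inv_mul_cancel₀ h]⟩, ?_⟩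
  simp [smul_smul, mul_inv_cancel₀ h]

namespace IsSmoothImmersion

variable (hf : IsSmoothImmersion f)

include hf

lemma areaVec_coe_ne_zero (p : S2) : areaVec f p ≠ 0 := by
  intro h
  rw [← cross_fderiv_frame] at h
  set A := fderiv ℝ (radialExtension f) (p : E3)
  set a := A (frame p 0) with ha
  set b := A (frame p 1) with hb
  have ho := frame_orthonormal p
  have hlin : ∀ s t : ℝ, s • a + t • b = 0 → s = 0 ∧ t = 0 := by
    intro s t hst
    have h1 : s • frame p 0 + t • frame p 1 = 0 := by
      apply eq_zero_of_fderiv_radialExtension hf.smooth p (hf.immersion p)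
      · rw [inner_add_right, inner_smul_right, inner_smul_right, inner_coe_frame, inner_coe_frame]
        ring
      · rw [map_add, map_smul, map_smul]
        exact hst
    have h2 := congrArg (fun v => inner ℝ (frame p 0) v) h1
    have h3 := congrArg (fun v => inner ℝ (frame p 1) v) h1
    simp only [inner_add_right, inner_smul_right, inner_zero_right, orthonormal_iff_ite.1 ho] at h2 h3
    simp at h2 h3
    exact ⟨h2, h3⟩
  have hn : ‖cross a b‖ ^ 2 = 0 := by rw [h]; simp
  rw [← real_inner_self_eq_norm_sq, inner_cross_cross] at hn
  -- If the Gram determinant vanishes, the combination `|b|² a - ⟨a, b⟩ b` has length 0. Linear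
  -- independence of `a` and `b` then forces `b = 0`, which is itself a dependence.
  have h4 : inner ℝ (inner ℝ b b • a + (-inner ℝ a b) • b) (inner ℝ b b • a + (-inner ℝ a b) • b)
      = inner ℝ b b * (inner ℝ a a * inner ℝ b b - inner ℝ a b * inner ℝ b a : ℝ) := by
    simp only [inner_add_left, inner_add_right, inner_smul_left, inner_smul_right,
      real_inner_comm a b, map_neg, RCLike.conj_to_real]
    ring
  rw [hn, mul_zero] at h4
  obtain ⟨h5, -⟩ := hlin _ _ (inner_self_eq_zero.1 h4)
  have h6 : b = 0 := inner_self_eq_zero.1 h5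
  have := (hlin 0 1 (by simp [h6])).2
  exact one_ne_zero this

lemma areaVec_ne_zero {x : E3} (hx : x ≠ 0) : areaVec f x ≠ 0 := by
  obtain ⟨r, hr, p, rfl⟩ := exists_pos_smul_coe hx
  rw [areaVec_smul f hr]
  exact smul_ne_zero (inv_ne_zero hr.ne') (hf.areaVec_coe_ne_zero p)

lemma contDiffAt_areaVec {x : E3} (hx : x ≠ 0) : ContDiffAt ℝ ∞ (areaVec f) x :=
  (contDiffAt_cof (contDiffAt_fderiv_radialExtension hf.smooth hx) contDiffAt_id).neg

lemma contDiffAt_normalExt {x : E3} (hx : x ≠ 0) : ContDiffAt ℝ ∞ (normalExt f) x :=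
  (((hf.contDiffAt_areaVec hx).norm ℝ (hf.areaVec_ne_zero hx)).inv
    (norm_ne_zero_iff.2 (hf.areaVec_ne_zero hx))).smul (hf.contDiffAt_areaVec hx)

lemma differentiableAt_normalExt {x : E3} (hx : x ≠ 0) : DifferentiableAt ℝ (normalExt f) x :=
  (hf.contDiffAt_normalExt hx).differentiableAt (by simp)

lemma norm_normalExt {x : E3} (hx : x ≠ 0) : ‖normalExt f x‖ = 1 := by
  unfold normalExt
  rw [norm_smul, norm_inv, norm_norm, inv_mul_cancel₀ (norm_ne_zero_iff.2 (hf.areaVec_ne_zero hx))]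

lemma areaVec_eq_smul {x : E3} (hx : x ≠ 0) : areaVec f x = ‖areaVec f x‖ • normalExt f x := by
  unfold normalExt
  rw [smul_smul, mul_inv_cancel₀ (norm_ne_zero_iff.2 (hf.areaVec_ne_zero hx)), one_smul]

lemma fderiv_radialExtension_self {x : E3} (hx : x ≠ 0) :
    fderiv ℝ (radialExtension f) x x = 0 :=
  (radialExtension_isRadial f).fderiv_self (differentiableAt_radialExtension hf.smooth hx)

lemma inner_normalExt_fderiv {x : E3} (hx : x ≠ 0) (v : E3) :
    inner ℝ (normalExt f x) (fderiv ℝ (radialExtension f) x v) = 0 := by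
  unfold normalExt areaVec
  -- The extension is constant along rays, so `x` lies in the kernel of the derivative.
  have h0 : (fderiv ℝ (radialExtension f) x).det = 0 := by
    by_contra hd
    have h1 := inner_cof_map (fderiv ℝ (radialExtension f) x) x x
    rw [hf.fderiv_radialExtension_self hx, inner_zero_right, real_inner_self_eq_norm_sq] at h1
    have := mul_ne_zero hd (pow_ne_zero 2 (norm_ne_zero_iff.2 hx))
    exact this h1.symm
  rw [inner_smul_left, inner_neg_left, inner_cof_map, h0]
  simp

/-- The Weingarten equation. -/
lemma inner_fderiv_normalExt {x : E3} (hx : x ≠ 0) (u v : E3) :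
    inner ℝ (fderiv ℝ (normalExt f) x u) (fderiv ℝ (radialExtension f) x v)
      = -inner ℝ (normalExt f x) (fderiv ℝ (fun y => fderiv ℝ (radialExtension f) y v) x u) := by
  have hN := (hf.differentiableAt_normalExt hx)
  have hF : DifferentiableAt ℝ (fun y => fderiv ℝ (radialExtension f) y v) x :=
    ((contDiffAt_fderiv_radialExtension hf.smooth hx).differentiableAt (by simp)).clm_apply
      (differentiableAt_const v)
  have h1 := fderiv_inner_apply ℝ hN hF u
  have h2 : (fun y => inner ℝ (normalExt f y) (fderiv ℝ (radialExtension f) y v))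
      =ᶠ[𝓝 x] fun _ => (0 : ℝ) := by
    filter_upwards [isOpen_compl_singleton.mem_nhds hx] with y hy
    exact hf.inner_normalExt_fderiv hy v
  rw [h2.fderiv_eq] at h1
  simp only [fderiv_fun_const, Pi.zero_apply, zero_apply] at h1
  linarith

lemma fderiv_normalExt_self {x : E3} (hx : x ≠ 0) : fderiv ℝ (normalExt f) x x = 0 :=
  (normalExt_isRadial f).fderiv_self (hf.differentiableAt_normalExt hx)

end IsSmoothImmersion

end

section

/-! ### Fundamental forms in the central chart -/

variable {f : S2 → E3}

/-- The inverse of central projection onto the affine tangent plane at `p`. -/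
def tangentChart (p : S2) (s : E2) : E3 := (p : E3) + s 0 • frame p 0 + s 1 • frame p 1

lemma tangentChart_zero (p : S2) : tangentChart p 0 = p := by simp [tangentChart]

lemma tangentChart_ne_zero (p : S2) (s : E2) : tangentChart p s ≠ 0 := by
  intro h
  have h1 := congrArg (fun v => inner ℝ (p : E3) v) h
  simp only [tangentChart, inner_add_right, inner_smul_right, inner_coe_frame, inner_zero_right,
    real_inner_self_eq_norm_sq, norm_coe_S2] at h1
  norm_num at h1

lemma fderiv_comp_tangentChart {F : Type*} [NormedAddCommGroup F] [NormedSpace ℝ F] {G : E3 → F}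
    (p : S2) (s : E2) (hG : DifferentiableAt ℝ G (tangentChart p s)) (v : E2) :
    fderiv ℝ (fun s => G (tangentChart p s)) s v
      = fderiv ℝ G (tangentChart p s) (v 0 • frame p 0 + v 1 • frame p 1) := by
  have h0 : ∀ i : Fin 2, HasFDerivAt (fun s : E2 => s i) (EuclideanSpace.proj i : E2 →L[ℝ] ℝ) s :=
    fun i => (EuclideanSpace.proj i : E2 →L[ℝ] ℝ).hasFDerivAt
  have h1 := (((h0 0).smul_const (frame p 0)).const_add (p : E3)).add
    ((h0 1).smul_const (frame p 1))
  have h2 := hG.hasFDerivAt.comp s h1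
  have h3 : fderiv ℝ (fun s => G (tangentChart p s)) s = _ := h2.fderiv
  rw [h3]
  simp

/-- The first fundamental form in the positive orthonormal frame at `p`. -/
def gForm (f : S2 → E3) (p : S2) (i j : Fin 2) : ℝ :=
  inner ℝ (fderiv ℝ (radialExtension f) p (frame p i)) (fderiv ℝ (radialExtension f) p (frame p j))

/-- The scalar second fundamental form in the positive orthonormal frame at `p`. -/
def hForm (f : S2 → E3) (p : S2) (i j : Fin 2) : ℝ :=
  inner ℝ (normalExt f p)
    (fderiv ℝ (fun y => fderiv ℝ (radialExtension f) y (frame p j)) p (frame p i))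

/-- The scalar mean curvature, extended along rays. -/
def scalarMean (f : S2 → E3) (x : E3) : ℝ :=
  inner ℝ (cof (fderiv ℝ (radialExtension f) x + fderiv ℝ (normalExt f) x) x
    - cof (fderiv ℝ (radialExtension f) x) x - cof (fderiv ℝ (normalExt f) x) x) (areaVec f x)
    / ‖areaVec f x‖ ^ 2

lemma gForm_comm (f : S2 → E3) (p : S2) (i j : Fin 2) : gForm f p i j = gForm f p j i :=
  real_inner_comm _ _

lemma norm_areaVec_sq (f : S2 → E3) (p : S2) :
    ‖areaVec f p‖ ^ 2 = gForm f p 0 0 * gForm f p 1 1 - gForm f p 0 1 ^ 2 := by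
  rw [← real_inner_self_eq_norm_sq, ← cross_fderiv_frame, inner_cross_cross, sq]
  simp only [gForm]
  rw [real_inner_comm (fderiv ℝ (radialExtension f) p (frame p 0))
    (fderiv ℝ (radialExtension f) p (frame p 1))]

lemma partialDeriv_tangentChart {F : Type*} [NormedAddCommGroup F] [NormedSpace ℝ F] {G : E3 → F}
    (p : S2) (s : E2) (hG : DifferentiableAt ℝ G (tangentChart p s)) (i : Fin 2) :
    partialDeriv i (fun s => G (tangentChart p s)) s
      = fderiv ℝ G (tangentChart p s) (frame p i) := by
  unfold partialDeriv
  rw [fderiv_comp_tangentChart p s hG]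
  fin_cases i <;> simp

lemma continuous_coe_of_contDiffAt {F : Type*} [NormedAddCommGroup F] [NormedSpace ℝ F]
    {G : E3 → F} (hG : ∀ x : E3, x ≠ 0 → ContDiffAt ℝ ∞ G x) : Continuous fun p : S2 => G p :=
  continuous_iff_continuousAt.2 fun p =>
    (hG p (coe_S2_ne_zero p)).continuousAt.comp continuous_subtype_val.continuousAt

namespace IsSmoothImmersion

variable (hf : IsSmoothImmersion f)

include hf

lemma partialDeriv_localParam (p : S2) (i : Fin 2) :
    partialDeriv i (localParam f p)
      = fun s => fderiv ℝ (radialExtension f) (tangentChart p s) (frame p i) := by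
  ext1 s
  exact partialDeriv_tangentChart p s
    (differentiableAt_radialExtension hf.smooth (tangentChart_ne_zero p s)) i

lemma partialDeriv_localParam_zero (p : S2) (i : Fin 2) :
    partialDeriv i (localParam f p) 0 = fderiv ℝ (radialExtension f) p (frame p i) := by
  rw [hf.partialDeriv_localParam]
  simp only [tangentChart_zero]

lemma differentiableAt_fderiv_apply {x : E3} (hx : x ≠ 0) (v : E3) :
    DifferentiableAt ℝ (fun y => fderiv ℝ (radialExtension f) y v) x :=
  ((contDiffAt_fderiv_radialExtension hf.smooth hx).differentiableAt (by simp)).clm_apply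
      (differentiableAt_const v)

lemma partialDeriv_partialDeriv_localParam (p : S2) (i j : Fin 2) :
    partialDeriv i (partialDeriv j (localParam f p)) 0
      = fderiv ℝ (fun y => fderiv ℝ (radialExtension f) y (frame p j)) p (frame p i) := by
  rw [hf.partialDeriv_localParam, partialDeriv_tangentChart
    (G := fun y => fderiv ℝ (radialExtension f) y (frame p j)) p 0
    (hf.differentiableAt_fderiv_apply (tangentChart_ne_zero p 0) _), tangentChart_zero]

lemma paramNormal_localParam (p : S2) : paramNormal (localParam f p) 0 = normalExt f p := by
  unfold paramNormal normalExt
  rw [hf.partialDeriv_localParam_zero, hf.partialDeriv_localParam_zero, cross_fderiv_frame]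

lemma unitNormal_eq (p : S2) : unitNormal f p = normalExt f p := hf.paramNormal_localParam p

lemma metricMatrix_apply (p : S2) (i j : Fin 2) :
    metricMatrix (localParam f p) 0 i j = gForm f p i j := by
  simp only [metricMatrix, Matrix.of_apply, hf.partialDeriv_localParam_zero, gForm]

lemma det_metricMatrix (p : S2) : (metricMatrix (localParam f p) 0).det = ‖areaVec f p‖ ^ 2 := by
  rw [Matrix.det_fin_two, norm_areaVec_sq]
  simp only [hf.metricMatrix_apply]
  rw [gForm_comm f p 1 0]
  ring

lemma sqrt_det_metricMatrix (p : S2) :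
    Real.sqrt (metricMatrix (localParam f p) 0).det = ‖areaVec f p‖ := by
  rw [hf.det_metricMatrix, Real.sqrt_sq (norm_nonneg _)]

lemma areaMeasure_eq : areaMeasure f = (volume : Measure E3).toSphere.withDensity
    fun p => ENNReal.ofReal ‖areaVec f p‖ := by
  unfold areaMeasure
  simp only [hf.sqrt_det_metricMatrix]

lemma secondFundamentalForm_apply (p : S2) (i j : Fin 2) :
    secondFundamentalForm (localParam f p) 0 i j = hForm f p i j := by
  simp only [secondFundamentalForm, Matrix.of_apply, hf.partialDeriv_partialDeriv_localParam,
    hf.paramNormal_localParam, hForm]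
  rw [real_inner_comm]

lemma hForm_comm (p : S2) (i j : Fin 2) : hForm f p i j = hForm f p j i := by
  unfold hForm
  have hx := coe_S2_ne_zero p
  have hs : IsSymmSndFDerivAt ℝ (radialExtension f) (p : E3) :=
    (contDiffAt_radialExtension hf.smooth hx).isSymmSndFDerivAt (by
      rw [minSmoothness_of_isRCLikeNormedField]
      exact WithTop.coe_le_coe.2 (le_top : (2 : ℕ∞) ≤ ⊤))
  have hd : DifferentiableAt ℝ (fderiv ℝ (radialExtension f)) (p : E3) :=
    (contDiffAt_fderiv_radialExtension hf.smooth hx).differentiableAt (by simp)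
  have h1 : ∀ u v : E3, fderiv ℝ (fun y => fderiv ℝ (radialExtension f) y v) p u
      = fderiv ℝ (fderiv ℝ (radialExtension f)) p u v := by
    intro u v
    rw [fderiv_clm_apply hd (differentiableAt_const v)]
    simp
  rw [h1, h1, hs.eq]

lemma inner_fderiv_frame (p : S2) (i j : Fin 2) :
    inner ℝ (fderiv ℝ (normalExt f) p (frame p i)) (fderiv ℝ (radialExtension f) p (frame p j))
      = -hForm f p i j :=
  hf.inner_fderiv_normalExt (coe_S2_ne_zero p) _ _

/-- The difference of cofactors in `scalarMean` is the polarization of `A ↦ A e₀ × A e₁`, taken at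
the derivatives of `f` and of its normal. Pairing it with `areaVec` and using the Weingarten
equation gives the trace of `h` with respect to `g`, times `det g`. The frame-free form makes the
mean curvature smooth. -/
lemma scalarMean_mul (p : S2) : scalarMean f p * ‖areaVec f p‖ ^ 2
    = gForm f p 1 1 * hForm f p 0 0 - 2 * gForm f p 0 1 * hForm f p 0 1
      + gForm f p 0 0 * hForm f p 1 1 := by
  have hw : ‖areaVec f p‖ ^ 2 ≠ 0 := pow_ne_zero 2 (norm_ne_zero_iff.2 (hf.areaVec_coe_ne_zero p))
  unfold scalarMean
  rw [div_mul_cancel₀ _ hw]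
  set A := fderiv ℝ (radialExtension f) (p : E3) with hA
  set L := fderiv ℝ (normalExt f) (p : E3) with hL
  have h1 : cof (A + L) p - cof A p - cof L p
      = -(cross (A (frame p 0)) (L (frame p 1)) + cross (L (frame p 0)) (A (frame p 1))) := by
    have h2 := cross_map (A + L) (frame p 0) (frame p 1)
    rw [add_apply, add_apply, cross_add_add, cross_map A, cross_map L, cross_frame, cof_neg,
      cof_neg, cof_neg] at h2
    have h3 : cof (A + L) (p : E3) = -(-cof (A + L) (p : E3)) := (neg_neg _).symm
    rw [h3, ← h2]
    abel
  rw [h1, ← cross_fderiv_frame, ← hA, inner_neg_left, inner_add_left, inner_cross_cross,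
    inner_cross_cross]
  have e := hf.inner_fderiv_frame p
  simp only [← hA, ← hL] at e
  simp only [e, gForm, ← hA]
  rw [hf.hForm_comm p 1 0, real_inner_comm (A (frame p 0)) (A (frame p 1))]
  ring

lemma meanCurvature_eq (p : S2) : meanCurvature f p = scalarMean f p • normalExt f p := by
  unfold meanCurvature paramMeanCurvature
  rw [hf.paramNormal_localParam]
  congr 1
  have hw : ‖areaVec f p‖ ^ 2 ≠ 0 := pow_ne_zero 2 (norm_ne_zero_iff.2 (hf.areaVec_coe_ne_zero p))
  rw [← mul_left_inj' hw, hf.scalarMean_mul]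
  have hdet := hf.det_metricMatrix p
  simp only [Matrix.inv_def, Matrix.adjugate_fin_two, hdet, Ring.inverse_eq_inv',
    Matrix.smul_apply, Fin.sum_univ_two, hf.secondFundamentalForm_apply, hf.metricMatrix_apply,
    Matrix.of_apply, Matrix.cons_val', Matrix.cons_val_zero, Matrix.cons_val_one, smul_eq_mul,
    Matrix.cons_val_fin_one]
  rw [hf.hForm_comm p 1 0, gForm_comm f p 1 0]
  have hw' : ‖areaVec f p‖ ≠ 0 := norm_ne_zero_iff.2 (hf.areaVec_coe_ne_zero p)
  field_simp
  ring

lemma contDiffAt_fderiv_normalExt {x : E3} (hx : x ≠ 0) :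
    ContDiffAt ℝ ∞ (fderiv ℝ (normalExt f)) x :=
  (hf.contDiffAt_normalExt hx).fderiv_right (m := ∞) (by simp)

lemma contDiffAt_scalarMean {x : E3} (hx : x ≠ 0) : ContDiffAt ℝ ∞ (scalarMean f) x := by
  have hA := contDiffAt_fderiv_radialExtension hf.smooth hx
  have hL := hf.contDiffAt_fderiv_normalExt hx
  have hw := hf.contDiffAt_areaVec hx
  have hw0 := hf.areaVec_ne_zero hx
  unfold scalarMean
  exact ((((contDiffAt_cof (hA.add hL) contDiffAt_id).sub (contDiffAt_cof hA contDiffAt_id)).sub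
    (contDiffAt_cof hL contDiffAt_id)).inner ℝ hw).div ((hw.norm ℝ hw0).pow 2)
    (pow_ne_zero 2 (norm_ne_zero_iff.2 hw0))

lemma continuous_scalarMean : Continuous fun p : S2 => scalarMean f p :=
  continuous_coe_of_contDiffAt fun _ hx => hf.contDiffAt_scalarMean hx

lemma continuous_areaVec : Continuous fun p : S2 => areaVec f p :=
  continuous_coe_of_contDiffAt fun _ hx => hf.contDiffAt_areaVec hx

lemma continuous_normalExt : Continuous fun p : S2 => normalExt f p :=
  continuous_coe_of_contDiffAt fun _ hx => hf.contDiffAt_normalExt hx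

/-- Integrals with respect to the area measure in terms of the area element. -/
lemma integral_areaMeasure (φ : S2 → ℝ) : ∫ p, φ p ∂areaMeasure f
    = ∫ p, ‖areaVec f p‖ * φ p ∂(volume : Measure E3).toSphere := by
  rw [hf.areaMeasure_eq, integral_withDensity_eq_integral_toReal_smul]
  · simp
  · exact (hf.continuous_areaVec.norm).measurable.ennreal_ofReal
  · simp

lemma helfrich_eq (c₀ : ℝ) : helfrich c₀ f = 1 / 4 *
    ∫ p : S2, ‖areaVec f p‖ * (scalarMean f p - c₀) ^ 2 ∂(volume : Measure E3).toSphere := by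
  unfold helfrich
  rw [hf.integral_areaMeasure]
  congr 2
  ext p
  rw [hf.meanCurvature_eq, hf.unitNormal_eq, ← sub_smul, norm_smul,
    hf.norm_normalExt (coe_S2_ne_zero p), mul_one, Real.norm_eq_abs, sq_abs]

lemma area_eq : area f = ∫ p : S2, ‖areaVec f p‖ ∂(volume : Measure E3).toSphere := by
  unfold area
  rw [hf.integral_areaMeasure]
  simp

lemma algVolume_eq : algVolume f = -(1 / 3) *
    ∫ p : S2, inner ℝ (f p) (areaVec f p) ∂(volume : Measure E3).toSphere := by
  unfold algVolume
  rw [hf.integral_areaMeasure]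
  congr 2
  ext p
  rw [hf.unitNormal_eq, hf.areaVec_eq_smul (coe_S2_ne_zero p), inner_smul_right,
    ← hf.areaVec_eq_smul (coe_S2_ne_zero p)]

end IsSmoothImmersion

end

section

/-! ### Polar coordinates -/

lemma lintegral_eq_lintegral_prod (g : E3 → ℝ≥0∞) :
    ∫⁻ x, g x = ∫⁻ z : S2 × Set.Ioi (0 : ℝ), g ((z.2 : ℝ) • (z.1 : E3))
      ∂((volume : Measure E3).toSphere.prod (Measure.volumeIoiPow 2)) := by
  have h := (volume : Measure E3).measurePreserving_homeomorphUnitSphereProd.lintegral_comp_emb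
    (Homeomorph.measurableEmbedding _)
    (fun z : S2 × Set.Ioi (0 : ℝ) => g ((z.2 : ℝ) • (z.1 : E3)))
  have h2 : Module.finrank ℝ E3 - 1 = 2 := by simp
  rw [h2] at h
  rw [← h]
  have h3 : ∀ x : ({0}ᶜ : Set E3), ((homeomorphUnitSphereProd E3 x).2 : ℝ) •
      ((homeomorphUnitSphereProd E3 x).1 : E3) = x := by
    intro x
    rw [← homeomorphUnitSphereProd_symm_apply_coe, Homeomorph.symm_apply_apply]
  simp only [h3]
  rw [lintegral_subtype_comap (measurableSet_singleton (0 : E3)).compl g,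
    restrict_compl_singleton]

lemma integral_eq_integral_prod (g : E3 → ℝ) :
    ∫ x, g x = ∫ z : S2 × Set.Ioi (0 : ℝ), g ((z.2 : ℝ) • (z.1 : E3))
      ∂((volume : Measure E3).toSphere.prod (Measure.volumeIoiPow 2)) := by
  have h := (volume : Measure E3).measurePreserving_homeomorphUnitSphereProd.integral_comp
    (Homeomorph.measurableEmbedding _)
    (fun z : S2 × Set.Ioi (0 : ℝ) => g ((z.2 : ℝ) • (z.1 : E3)))
  have h2 : Module.finrank ℝ E3 - 1 = 2 := by simp
  rw [h2] at h
  rw [← h]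
  have h3 : ∀ x : ({0}ᶜ : Set E3), ((homeomorphUnitSphereProd E3 x).2 : ℝ) •
      ((homeomorphUnitSphereProd E3 x).1 : E3) = x := by
    intro x
    rw [← homeomorphUnitSphereProd_symm_apply_coe, Homeomorph.symm_apply_apply]
  simp only [h3]
  rw [integral_subtype_comap (measurableSet_singleton (0 : E3)).compl g,
    restrict_compl_singleton]

/-- The integral over the unit ball of a function which is constant along rays. -/
lemma lintegral_ball_of_radial {g : E3 → ℝ≥0∞} {J : S2 → ℝ≥0∞} (hJ : Measurable J)
    (hg : ∀ r : ℝ, 0 < r → r < 1 → ∀ p : S2, g (r • (p : E3)) = J p) :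
    ∫⁻ x in ball 0 1, g x = 3⁻¹ * ∫⁻ p, J p ∂(volume : Measure E3).toSphere := by
  rw [← lintegral_indicator measurableSet_ball, lintegral_eq_lintegral_prod]
  have h1 : ∀ z : S2 × Set.Ioi (0 : ℝ), (ball (0 : E3) 1).indicator g ((z.2 : ℝ) • (z.1 : E3))
      = J z.1 * (Set.Iio (⟨1, Set.mem_Ioi.2 zero_lt_one⟩ : Set.Ioi (0 : ℝ))).indicator 1 z.2 := by
    rintro ⟨p, r, hr⟩
    have hr' : (0 : ℝ) < r := hr
    have hn : ‖r • (p : E3)‖ = r := by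
      rw [norm_smul, norm_coe_S2, mul_one, Real.norm_of_nonneg hr'.le]
    by_cases h : r < 1
    · rw [Set.indicator_of_mem (by simpa [hn] using h), Set.indicator_of_mem (by exact h), hg r hr h]
      simp
    · rw [Set.indicator_of_notMem (by simpa [hn] using h), Set.indicator_of_notMem (by exact h),
        mul_zero]
  simp only [h1]
  -- The factor `3⁻¹` is the integral of `r²` over `(0, 1)`.
  rw [lintegral_prod_mul hJ.aemeasurable
    ((measurable_one.indicator measurableSet_Iio).aemeasurable),
    lintegral_indicator_one measurableSet_Iio, Measure.volumeIoiPow_apply_Iio, mul_comm]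
  congr 1
  norm_num
  rw [ENNReal.ofReal_div_of_pos (by norm_num)]
  norm_num

/-! ### The set of contact with the convex hull -/

variable {f : S2 → E3}

lemma IsEmbeddedSphere.isSmoothImmersion (hf : IsEmbeddedSphere f) : IsSmoothImmersion f :=
  ⟨hf.smooth, hf.immersion⟩

/-- No point of an open half space that misses the surface is enclosed. -/
lemma notMem_enclosedRegion {ν x : E3} (hν : ν ≠ 0) {m : ℝ} (hm : ∀ q, m ≤ inner ℝ (f q) ν)
    (hx : inner ℝ x ν < m) : x ∉ enclosedRegion f := by
  rintro ⟨-, hb⟩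
  set S : Set E3 := {y | inner ℝ y ν < m} with hS
  have hconv : Convex ℝ S := by
    have := convex_halfSpace_lt (f := fun y : E3 => inner ℝ y ν)
      ⟨fun a b => inner_add_left _ _ _, fun c a => real_inner_smul_left _ _ _⟩ m
    exact this
  have hsub : S ⊆ (Set.range f)ᶜ := by
    rintro y hy ⟨q, rfl⟩
    exact absurd (hm q) (not_le.2 hy)
  have h1 := hconv.isPreconnected.subset_connectedComponentIn hx hsub
  obtain ⟨R, hR⟩ := (hb.subset h1).exists_norm_le
  have hν' : 0 < ‖ν‖ := norm_pos_iff.2 hν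
  -- With this `t` one has `‖t • ν‖ = R + 1 + ‖x‖`, so `x - t • ν` leaves the ball of radius `R`
  -- although it stays in the half space.
  set t : ℝ := (R + 1 + ‖x‖) / ‖ν‖ with ht
  have hR0 : 0 ≤ R := (norm_nonneg x).trans (hR x hx)
  have ht0 : 0 ≤ t := by positivity
  have h2 : x - t • ν ∈ S := by
    show inner ℝ (x - t • ν) ν < m
    rw [inner_sub_left, inner_smul_left, real_inner_self_eq_norm_sq]
    have : 0 ≤ t * ‖ν‖ ^ 2 := by positivity
    simp
    linarith
  have h3 := hR _ h2
  have h4 : ‖t • ν‖ ≤ ‖x‖ + ‖x - t • ν‖ := by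
    have := norm_sub_le x (x - t • ν)
    simpa using this
  rw [norm_smul, Real.norm_of_nonneg ht0, ht, div_mul_cancel₀ _ hν'.ne'] at h4
  linarith

/-- The points of the sphere where the surface touches a supporting plane of its convex hull. -/
def contactSet (f : S2 → E3) : Set S2 :=
  {p | ∀ q, inner ℝ (f p) (normalExt f p) ≤ inner ℝ (f q) (normalExt f p)}

/-- Minimize the height `⟨f, ν⟩`. At a minimum the normal is `±ν`. It cannot be `-ν`: the inner
normal would then point into a half space below the whole surface, which contains no enclosed
points. -/
lemma exists_mem_contactSet (hf : IsEmbeddedSphere f) (ν : S2) :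
    ∃ p ∈ contactSet f, normalExt f p = ν := by
  have hI := hf.isSmoothImmersion
  have hcont : Continuous fun q : S2 => inner ℝ (f q) (ν : E3) :=
    (hf.smooth.continuous).inner continuous_const
  obtain ⟨p, hp⟩ := hcont.exists_forall_le' (x₀ := ν) (by simp)
  have hx := coe_S2_ne_zero p
  have hmin : IsLocalMin (fun x : E3 => inner ℝ (radialExtension f x) (ν : E3)) (p : E3) := by
    filter_upwards [isOpen_compl_singleton.mem_nhds hx] with y hy
    obtain ⟨r, hr, q, rfl⟩ := exists_pos_smul_coe hy
    rw [radialExtension_isRadial f r hr, radialExtension_coe, radialExtension_coe]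
    exact hp q
  have hcrit : ∀ v : E3, inner ℝ (ν : E3) (fderiv ℝ (radialExtension f) p v) = 0 := by
    intro v
    have h1 := fderiv_inner_apply ℝ (differentiableAt_radialExtension hf.smooth hx)
      (differentiableAt_const (ν : E3)) v
    rw [hmin.fderiv_eq_zero] at h1
    simp only [fderiv_fun_const, Pi.zero_apply, zero_apply, inner_zero_right, zero_add] at h1
    rw [real_inner_comm]
    exact h1.symm
  have h2 := norm_sq_cross_smul_eq (hcrit (frame p 0)) (hcrit (frame p 1))
  rw [cross_fderiv_frame] at h2
  have hw : ‖areaVec f p‖ ≠ 0 := norm_ne_zero_iff.2 (hI.areaVec_coe_ne_zero p)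
  have h3 : (ν : E3) = inner ℝ (normalExt f p) (ν : E3) • normalExt f p := by
    have h4 : (ν : E3) = (‖areaVec f p‖ ^ 2)⁻¹ • (‖areaVec f p‖ ^ 2 • (ν : E3)) := by
      rw [smul_smul, inv_mul_cancel₀ (pow_ne_zero 2 hw), one_smul]
    rw [h2] at h4
    conv_lhs => rw [h4]
    unfold normalExt
    rw [inner_smul_left, smul_smul, smul_smul]
    congr 1
    simp
    field_simp
  set a := inner ℝ (normalExt f p) (ν : E3) with ha
  have hn := hI.norm_normalExt hx
  have ha1 : |a| = 1 := by
    have := congrArg norm h3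
    rw [norm_coe_S2, norm_smul, hn, mul_one] at this
    exact this.symm
  have hν : normalExt f p = ν := by
    rcases (abs_eq zero_le_one).1 ha1 with h | h
    · rw [h, one_smul] at h3
      exact h3.symm
    · exfalso
      rw [h, neg_one_smul] at h3
      obtain ⟨t, ht, ht0⟩ := ((hf.inner_normal p).and self_mem_nhdsWithin).exists
      refine notMem_enclosedRegion (coe_S2_ne_zero ν) hp ?_ ht
      have ht0' : 0 < t := ht0
      have h5 : normalExt f p = -(ν : E3) := by rw [h3, neg_neg]
      rw [hI.unitNormal_eq, inner_add_left, inner_smul_left, h5, inner_neg_left,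
        real_inner_self_eq_norm_sq, norm_coe_S2]
      simp
      exact ht0'
  refine ⟨p, ?_, hν⟩
  intro q
  rw [hν]
  exact hp q

/-- A negative second derivative would make the point a local maximum too; the function would be
locally constant, with second derivative 0. -/
lemma deriv_deriv_nonneg_of_isLocalMin {φ : ℝ → ℝ} {x : ℝ} (h : IsLocalMin φ x)
    (hc : ContinuousAt φ x) : 0 ≤ deriv (deriv φ) x := by
  by_contra hneg
  push Not at hneg
  have hmax := isLocalMax_of_deriv_deriv_neg hneg h.deriv_eq_zero hc
  have h1 : φ =ᶠ[𝓝 x] fun _ => φ x := by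
    filter_upwards [h, hmax] with y h1 h2
    exact le_antisymm h2 h1
  have h2 : deriv φ =ᶠ[𝓝 x] fun _ => 0 := by
    filter_upwards [h1.eventually_nhds] with y hy
    rw [Filter.EventuallyEq.deriv_eq hy]
    simp
  rw [h2.deriv_eq] at hneg
  simp at hneg

namespace IsSmoothImmersion

variable (hf : IsSmoothImmersion f)

include hf

lemma isClosed_contactSet : IsClosed (contactSet f) := by
  have hN := hf.continuous_normalExt
  have hc := hf.smooth.continuous
  have : contactSet f = ⋂ q, {p | inner ℝ (f p) (normalExt f p) ≤ inner ℝ (f q) (normalExt f p)} := by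
    ext p
    simp [contactSet]
  rw [this]
  exact isClosed_iInter fun q => isClosed_le (hc.inner hN) (continuous_const.inner hN)

/-- At a contact point the height in the direction of the normal is minimal. The straight line `p +
t u` may be used as test curve because the extension has the same values as `f` along rays. -/
lemma second_variation_nonneg {p : S2} (hp : p ∈ contactSet f) (u : E3) :
    0 ≤ inner ℝ (normalExt f p) (fderiv ℝ (fun y => fderiv ℝ (radialExtension f) y u) p u) := by
  have hx := coe_S2_ne_zero p
  set N := normalExt f p with hN
  set γ : ℝ → E3 := fun t => (p : E3) + t • u with hγ
  have hγd : ∀ t, HasDerivAt γ u t := fun t => by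
    have h := ((hasDerivAt_id t).smul_const u).const_add (p : E3)
    rw [one_smul] at h
    exact h
  have hγ0 : γ 0 = p := by simp [hγ]
  have hγne : ∀ᶠ t in 𝓝 (0 : ℝ), γ t ≠ 0 := by
    have : ContinuousAt γ 0 := (hγd 0).continuousAt
    apply this.eventually_ne
    rw [hγ0]
    exact hx
  set φ : ℝ → ℝ := fun t => inner ℝ N (radialExtension f (γ t)) with hφ
  have hd1 : ∀ t, γ t ≠ 0 → HasDerivAt φ (inner ℝ N (fderiv ℝ (radialExtension f) (γ t) u)) t := by
    intro t ht
    have h1 := (differentiableAt_radialExtension hf.smooth ht).hasFDerivAt.comp_hasDerivAt t (hγd t)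
    simpa using (hasDerivAt_const t N).inner ℝ h1
  have hmin : IsLocalMin φ 0 := by
    filter_upwards [hγne] with t ht
    simp only [hφ, hγ0, radialExtension_coe]
    obtain ⟨r, hr, q, hq⟩ := exists_pos_smul_coe ht
    rw [hq, radialExtension_isRadial f r hr, radialExtension_coe, real_inner_comm,
      real_inner_comm _ N]
    exact hp q
  have h2 := deriv_deriv_nonneg_of_isLocalMin hmin (hd1 0 (by rw [hγ0]; exact hx)).continuousAt
  have h3 : deriv φ =ᶠ[𝓝 0] fun t => inner ℝ N (fderiv ℝ (radialExtension f) (γ t) u) := by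
    filter_upwards [hγne] with t ht
    exact (hd1 t ht).deriv
  rw [h3.deriv_eq] at h2
  have h4 : HasDerivAt (fun t => fderiv ℝ (radialExtension f) (γ t) u)
      (fderiv ℝ (fun y => fderiv ℝ (radialExtension f) y u) (γ 0) u) 0 :=
    (hf.differentiableAt_fderiv_apply (by rw [hγ0]; exact hx) u).hasFDerivAt.comp_hasDerivAt 0
      (hγd 0)
  have h5 : HasDerivAt (fun t => inner ℝ N (fderiv ℝ (radialExtension f) (γ t) u))
      (inner ℝ N (fderiv ℝ (fun y => fderiv ℝ (radialExtension f) y u) (γ 0) u)) 0 := by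
    simpa using (hasDerivAt_const (0 : ℝ) N).inner ℝ h4
  rw [h5.deriv, hγ0] at h2
  exact h2

lemma fderiv_fderiv_apply {x : E3} (hx : x ≠ 0) (u v : E3) :
    fderiv ℝ (fun y => fderiv ℝ (radialExtension f) y v) x u
      = fderiv ℝ (fderiv ℝ (radialExtension f)) x u v := by
  have hd : DifferentiableAt ℝ (fderiv ℝ (radialExtension f)) x :=
    (contDiffAt_fderiv_radialExtension hf.smooth hx).differentiableAt (by simp)
  rw [fderiv_clm_apply hd (differentiableAt_const v)]
  simp

lemma hForm_nonneg {p : S2} (hp : p ∈ contactSet f) :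
    0 ≤ hForm f p 0 0 ∧ 0 ≤ hForm f p 1 1 ∧
      0 ≤ hForm f p 0 0 * hForm f p 1 1 - hForm f p 0 1 ^ 2 := by
  refine ⟨hf.second_variation_nonneg hp _, hf.second_variation_nonneg hp _, ?_⟩
  have hx := coe_S2_ne_zero p
  -- The second variation in the direction `t e₀ + e₁` is a nonnegative quadratic in `t`; its
  -- discriminant gives the determinant inequality.
  have h1 : ∀ t : ℝ, 0 ≤ hForm f p 0 0 * (t * t) + 2 * hForm f p 0 1 * t + hForm f p 1 1 := by
    intro t
    have h2 := hf.second_variation_nonneg hp (t • frame p 0 + frame p 1)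
    have h3 := hf.hForm_comm p 1 0
    unfold hForm at h3 ⊢
    rw [hf.fderiv_fderiv_apply hx] at h2
    simp only [hf.fderiv_fderiv_apply hx] at h3 ⊢
    simp only [map_add, map_smul, add_apply, smul_apply, inner_add_right, inner_smul_right] at h2
    rw [h3] at h2
    linarith
  have h4 := discrim_le_zero h1
  unfold discrim at h4
  nlinarith

end IsSmoothImmersion

end

section

/-! ### The Gauss map and the lower bound for the Helfrich energy -/

variable {f : S2 → E3}

/-- The point of the sphere on the ray through `x`, with a default value at `0`. -/
def direction (x : E3) : S2 :=
  if h : x = 0 then ⟨EuclideanSpace.single 0 1, by simp⟩ else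
    ⟨‖x‖⁻¹ • x, by simp [norm_smul, inv_mul_cancel₀ (norm_ne_zero_iff.2 h)]⟩

lemma coe_direction {x : E3} (hx : x ≠ 0) : (direction x : E3) = ‖x‖⁻¹ • x := by
  unfold direction
  rw [dif_neg hx]

lemma direction_smul {r : ℝ} (hr : 0 < r) (p : S2) : direction (r • (p : E3)) = p := by
  have hne : r • (p : E3) ≠ 0 := smul_ne_zero hr.ne' (coe_S2_ne_zero p)
  ext1
  rw [coe_direction hne, norm_smul, norm_coe_S2, mul_one, Real.norm_of_nonneg hr.le, smul_smul,
    inv_mul_cancel₀ hr.ne', one_smul]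

lemma measurable_direction : Measurable direction := by
  have h : Measurable fun x : E3 => (direction x : E3) := by
    have h1 : (fun x : E3 => (direction x : E3))
        = fun x => if x = 0 then EuclideanSpace.single 0 1 else ‖x‖⁻¹ • x := by
      ext1 x
      by_cases hx : x = 0
      · simp [direction, hx]
      · rw [coe_direction hx, if_neg hx]
    rw [h1]
    exact Measurable.ite (measurableSet_singleton 0) measurable_const (by fun_prop)
  exact h.subtype_mk

/-- The homogeneous extension of degree one of the Gauss map. -/
def gaussCone (f : S2 → E3) (x : E3) : E3 := ‖x‖ • normalExt f x

/-- The derivative of `gaussCone f` along the ray through `p`. -/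
def gaussDeriv (f : S2 → E3) (p : S2) : E3 →L[ℝ] E3 :=
  (innerSL ℝ (p : E3)).smulRight (normalExt f p) + fderiv ℝ (normalExt f) p

lemma hasFDerivAt_norm_coe {r : ℝ} (hr : 0 < r) (p : S2) :
    HasFDerivAt (fun x : E3 => ‖x‖) (innerSL ℝ (p : E3)) (r • (p : E3)) := by
  have hn : ‖r • (p : E3)‖ = r := by
    rw [norm_smul, norm_coe_S2, mul_one, Real.norm_of_nonneg hr.le]
  have h2 := (hasFDerivAt_id (𝕜 := ℝ) (r • (p : E3))).norm_sq
  have h3 := h2.sqrt (by rw [id, hn]; positivity)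
  have h4 : (fun x : E3 => Real.sqrt (‖id x‖ ^ 2)) = fun x => ‖x‖ := by
    ext x
    simp
  rw [h4] at h3
  refine h3.congr_fderiv ?_
  ext v
  simp only [id, hn, Real.sqrt_sq hr.le, ContinuousLinearMap.comp_id, smul_apply,
    innerSL_apply_apply, map_smul, smul_eq_mul, nsmul_eq_mul]
  simp
  field_simp

lemma hasFDerivAt_norm_smul {G : E3 → E3} {r : ℝ} (hr : 0 < r) (p : S2)
    (hG : DifferentiableAt ℝ G (r • (p : E3))) :
    HasFDerivAt (fun x => ‖x‖ • G x) (r • fderiv ℝ G (r • (p : E3)) +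
      (innerSL ℝ (p : E3)).smulRight (G (r • (p : E3)))) (r • (p : E3)) := by
  have hn : ‖r • (p : E3)‖ = r := by
    rw [norm_smul, norm_coe_S2, mul_one, Real.norm_of_nonneg hr.le]
  have h5 := (hasFDerivAt_norm_coe hr p).smul hG.hasFDerivAt
  rw [hn] at h5
  exact h5

namespace IsSmoothImmersion

variable (hf : IsSmoothImmersion f)

include hf

lemma hasFDerivAt_gaussCone {r : ℝ} (hr : 0 < r) (p : S2) :
    HasFDerivAt (gaussCone f) (gaussDeriv f p) (r • (p : E3)) := by
  have hne : r • (p : E3) ≠ 0 := smul_ne_zero hr.ne' (coe_S2_ne_zero p)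
  have h := hasFDerivAt_norm_smul hr p (hf.differentiableAt_normalExt hne)
  rw [(normalExt_isRadial f).fderiv_smul hr, normalExt_isRadial f r hr, smul_smul,
    mul_inv_cancel₀ hr.ne', one_smul, add_comm] at h
  exact h

lemma continuous_gaussDeriv : Continuous (gaussDeriv f) := by
  have h1 := hf.continuous_normalExt
  have h2 : Continuous fun p : S2 => fderiv ℝ (normalExt f) (p : E3) :=
    continuous_coe_of_contDiffAt fun _ hx => hf.contDiffAt_fderiv_normalExt hx
  have h3 : Continuous fun p : S2 => (innerSL ℝ (p : E3)).smulRight (normalExt f p) := by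
    have h4 : Continuous fun p : S2 => innerSL ℝ (p : E3) := by fun_prop
    exact (ContinuousLinearMap.smulRightL ℝ E3 E3).continuous₂.comp (h4.prodMk h1)
  exact h3.add h2

/-- `gaussDeriv` sends `p` to the unit normal and the frame to the derivatives of the normal. Hence
its determinant is, up to sign, the Gauss curvature times the area element. -/
lemma det_gaussDeriv_mul (p : S2) : (gaussDeriv f p).det * ‖areaVec f p‖
    = -(hForm f p 0 0 * hForm f p 1 1 - hForm f p 0 1 ^ 2) := by
  have hx := coe_S2_ne_zero p
  have hp : inner ℝ (p : E3) (p : E3) = (1 : ℝ) := by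
    rw [real_inner_self_eq_norm_sq, norm_coe_S2]; norm_num
  have h1 := inner_cof_map (gaussDeriv f p) p p
  have h2 : gaussDeriv f p p = normalExt f p := by
    simp only [gaussDeriv, add_apply, ContinuousLinearMap.smulRight_apply, innerSL_apply_apply, hp,
      one_smul, hf.fderiv_normalExt_self hx, add_zero]
  have h3 : ∀ i, gaussDeriv f p (frame p i) = fderiv ℝ (normalExt f) p (frame p i) := by
    intro i
    simp only [gaussDeriv, add_apply, ContinuousLinearMap.smulRight_apply, innerSL_apply_apply,
      inner_coe_frame, zero_smul, zero_add]
  have h4 := cross_map (gaussDeriv f p) (frame p 0) (frame p 1)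
  rw [h3, h3, cross_frame, cof_neg] at h4
  rw [hp, mul_one, h2] at h1
  rw [← h1, mul_comm, ← real_inner_smul_right,
    ← hf.areaVec_eq_smul hx, ← cross_fderiv_frame, ← neg_neg (cof (gaussDeriv f p) p), ← h4,
    inner_neg_left, inner_cross_cross, hf.inner_fderiv_frame, hf.inner_fderiv_frame,
    hf.inner_fderiv_frame, hf.inner_fderiv_frame, hf.hForm_comm p 1 0]
  ring

/-- On the contact set the mean curvature `S` is nonnegative, so `(S - c₀)² ≥ S² + c₀²`, and `S²` is
at least four times the Gauss curvature. The summand with `c₀²` is what makes the final inequality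
strict. -/
lemma contact_pointwise {p : S2} (hp : p ∈ contactSet f) {c₀ : ℝ} (hc₀ : c₀ < 0) :
    |(gaussDeriv f p).det| + c₀ ^ 2 / 4 * ‖areaVec f p‖
      ≤ 1 / 4 * (‖areaVec f p‖ * (scalarMean f p - c₀) ^ 2) := by
  obtain ⟨h00, h11, hD⟩ := hf.hForm_nonneg hp
  have hdet := hf.det_gaussDeriv_mul p
  have hT := hf.scalarMean_mul p
  have hg := norm_areaVec_sq f p
  have hw : 0 < ‖areaVec f p‖ := norm_pos_iff.2 (hf.areaVec_coe_ne_zero p)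
  have hg0 : 0 < gForm f p 0 0 := by
    have : 0 ≤ gForm f p 0 0 := real_inner_self_nonneg
    rcases this.eq_or_lt with h | h
    · rw [← h] at hg
      nlinarith [sq_nonneg (gForm f p 0 1)]
    · exact h
  have hg' : 0 ≤ gForm f p 0 0 * gForm f p 1 1 - gForm f p 0 1 ^ 2 := by
    rw [← hg]; positivity
  have hineq := four_mul_det_le_sq (x := hForm f p 0 0) (y := hForm f p 0 1) (z := hForm f p 1 1)
    hg0 hg'
  have hpos := trace_nonneg_of_nonneg hg0 hg' h00 h11 hD
  rw [← hT] at hineq hpos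
  rw [← hg] at hineq
  set w := ‖areaVec f p‖
  set S := scalarMean f p
  set D := hForm f p 0 0 * hForm f p 1 1 - hForm f p 0 1 ^ 2
  have hS : 0 ≤ S := nonneg_of_mul_nonneg_left hpos (by positivity)
  have habs : |(gaussDeriv f p).det| * w = D := by
    rw [show |(gaussDeriv f p).det| * w = |(gaussDeriv f p).det * w| by rw [abs_mul, abs_of_pos hw],
      hdet, abs_neg, abs_of_nonneg hD]
  have h1 : |(gaussDeriv f p).det| ≤ 1 / 4 * (w * S ^ 2) := by
    have h2 : 4 * D ≤ w ^ 2 * S ^ 2 := by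
      have : w ^ 2 * (4 * D) ≤ w ^ 2 * (w ^ 2 * S ^ 2) := by nlinarith
      exact le_of_mul_le_mul_left this (by positivity)
    rw [← habs] at h2
    have : w * (4 * |(gaussDeriv f p).det|) ≤ w * (w * S ^ 2) := by nlinarith
    have := le_of_mul_le_mul_left this hw
    linarith
  have h3 : 0 ≤ w * (-c₀ * S) := by
    have : 0 ≤ -c₀ := by linarith
    positivity
  nlinarith

end IsSmoothImmersion

/-- The Gauss map sends the contact set onto the sphere. -/
lemma IsEmbeddedSphere.four_pi_le_lintegral_contactSet (hf : IsEmbeddedSphere f) :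
    ENNReal.ofReal (4 * Real.pi) ≤ ∫⁻ p in contactSet f,
      ENNReal.ofReal |(gaussDeriv f p).det| ∂(volume : Measure E3).toSphere := by
  have hI := hf.isSmoothImmersion
  set s : Set E3 := (ball 0 1 \ {0}) ∩ direction ⁻¹' contactSet f with hs
  have hsm : MeasurableSet s :=
    (measurableSet_ball.diff (measurableSet_singleton _)).inter
      (measurable_direction hI.isClosed_contactSet.measurableSet)
  have himg : ball (0 : E3) 1 \ {0} ⊆ gaussCone f '' s := by
    rintro y ⟨hy1, hy0⟩
    obtain ⟨r, hr, ν, rfl⟩ := exists_pos_smul_coe hy0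
    obtain ⟨p, hp, hpν⟩ := exists_mem_contactSet hf ν
    have hn : ∀ q : S2, ‖r • (q : E3)‖ = r := fun q => by
      rw [norm_smul, norm_coe_S2, mul_one, Real.norm_of_nonneg hr.le]
    refine ⟨r • (p : E3), ⟨⟨?_, smul_ne_zero hr.ne' (coe_S2_ne_zero p)⟩, ?_⟩, ?_⟩
    · rw [mem_ball_zero_iff, hn] at hy1 ⊢
      exact hy1
    · rw [Set.mem_preimage, direction_smul hr]
      exact hp
    · unfold gaussCone
      rw [normalExt_isRadial f r hr, hn, hpν]
  have hder : ∀ x ∈ s, HasFDerivWithinAt (gaussCone f) (gaussDeriv f (direction x)) s x := by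
    rintro x ⟨⟨-, hx0⟩, -⟩
    obtain ⟨r, hr, p, rfl⟩ := exists_pos_smul_coe hx0
    rw [direction_smul hr]
    exact (hI.hasFDerivAt_gaussCone hr p).hasFDerivWithinAt
  -- The cone over the contact set is mapped onto the punctured unit ball, so its total Jacobian is
  -- at least `4π / 3`; injectivity is not needed.
  have h1 := addHaar_image_le_lintegral_abs_det_fderiv volume hsm hder
  have hJm : Measurable ((contactSet f).indicator fun p => ENNReal.ofReal |(gaussDeriv f p).det|) :=
    ((ContinuousLinearMap.continuous_det.comp hI.continuous_gaussDeriv).abs.measurable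
      |>.ennreal_ofReal).indicator hI.isClosed_contactSet.measurableSet
  have h2 : ∫⁻ x in s, ENNReal.ofReal |(gaussDeriv f (direction x)).det|
      ≤ 3⁻¹ * ∫⁻ p in contactSet f, ENNReal.ofReal |(gaussDeriv f p).det|
        ∂(volume : Measure E3).toSphere := by
    rw [← lintegral_indicator hI.isClosed_contactSet.measurableSet,
      ← lintegral_ball_of_radial (g := fun x => (contactSet f).indicator
        (fun p => ENNReal.ofReal |(gaussDeriv f p).det|) (direction x)) hJm
        (fun r hr _ p => by rw [direction_smul hr]), ← lintegral_indicator hsm,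
      ← lintegral_indicator measurableSet_ball]
    apply lintegral_mono
    intro x
    by_cases hx : x ∈ s
    · rw [Set.indicator_of_mem hx, Set.indicator_of_mem hx.1.1,
        Set.indicator_of_mem (show direction x ∈ contactSet f from hx.2)]
    · rw [Set.indicator_of_notMem hx]
      exact zero_le
  have h3 : volume (ball (0 : E3) 1 \ {0}) = ENNReal.ofReal (Real.pi * 4 / 3) := by
    rw [measure_sdiff_null (measure_singleton _), EuclideanSpace.volume_ball_fin_three]
    simp
  have h4 := ((measure_mono himg).trans h1).trans h2
  rw [h3] at h4
  have h5 : ENNReal.ofReal (4 * Real.pi) = 3 * ENNReal.ofReal (Real.pi * 4 / 3) := by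
    rw [← ENNReal.ofReal_ofNat, ← ENNReal.ofReal_mul (by norm_num)]
    congr 1
    ring
  rw [h5]
  calc _ ≤ 3 * (3⁻¹ * ∫⁻ p in contactSet f, ENNReal.ofReal |(gaussDeriv f p).det|
        ∂(volume : Measure E3).toSphere) := by gcongr
    _ = _ := by
      rw [← mul_assoc, ENNReal.mul_inv_cancel (by norm_num) (by norm_num), one_mul]

/-- The Helfrich energy of an embedded sphere with negative spontaneous curvature. -/
theorem IsEmbeddedSphere.four_pi_lt_helfrich (hf : IsEmbeddedSphere f) {c₀ : ℝ} (hc₀ : c₀ < 0) :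
    4 * Real.pi < helfrich c₀ f := by
  have hI := hf.isSmoothImmersion
  have h1 := hf.four_pi_le_lintegral_contactSet
  set C := contactSet f
  have hC : MeasurableSet C := hI.isClosed_contactSet.measurableSet
  set σ := (volume : Measure E3).toSphere
  have hint : ∀ φ : S2 → ℝ, Continuous φ → Integrable φ σ := fun φ hφ =>
    hφ.integrable_of_hasCompactSupport (HasCompactSupport.of_compactSpace φ)
  have hdc : Continuous fun p => |(gaussDeriv f p).det| :=
    (ContinuousLinearMap.continuous_det.comp hI.continuous_gaussDeriv).abs
  have hwc : Continuous fun p : S2 => ‖areaVec f p‖ := hI.continuous_areaVec.norm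
  have hEc : Continuous fun p : S2 => 1 / 4 * (‖areaVec f p‖ * (scalarMean f p - c₀) ^ 2) :=
    continuous_const.mul (hwc.mul ((hI.continuous_scalarMean.sub continuous_const).pow 2))
  have h2 : 4 * Real.pi ≤ ∫ p in C, |(gaussDeriv f p).det| ∂σ := by
    rw [← ofReal_integral_eq_lintegral_ofReal (hint _ hdc).integrableOn
      (Eventually.of_forall fun p => abs_nonneg _)] at h1
    exact (ENNReal.ofReal_le_ofReal_iff (integral_nonneg fun p => abs_nonneg _)).1 h1
  -- A null contact set could not carry an integral of at least `4π`.
  have hσC : 0 < σ C := by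
    rw [pos_iff_ne_zero]
    intro h0
    rw [setIntegral_measure_zero _ h0] at h2
    linarith [Real.pi_pos]
  have h3 : 0 < ∫ p in C, ‖areaVec f p‖ ∂σ := by
    rw [setIntegral_pos_iff_support_of_nonneg_ae (Eventually.of_forall fun p => norm_nonneg _)
      (hint _ hwc).integrableOn]
    convert hσC using 2
    rw [Set.inter_eq_right]
    intro p _
    exact norm_ne_zero_iff.2 (hI.areaVec_coe_ne_zero p)
  have h4 : helfrich c₀ f = ∫ p : S2, 1 / 4 * (‖areaVec f p‖ * (scalarMean f p - c₀) ^ 2) ∂σ := by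
    rw [hI.helfrich_eq, integral_const_mul]
  have h5 : ∫ p in C, (|(gaussDeriv f p).det| + c₀ ^ 2 / 4 * ‖areaVec f p‖) ∂σ
      ≤ ∫ p in C, 1 / 4 * (‖areaVec f p‖ * (scalarMean f p - c₀) ^ 2) ∂σ :=
    setIntegral_mono_on (hint _ (hdc.add (continuous_const.mul hwc))).integrableOn
      (hint _ hEc).integrableOn hC fun p hp => hI.contact_pointwise hp hc₀
  have h6 : ∫ p in C, 1 / 4 * (‖areaVec f p‖ * (scalarMean f p - c₀) ^ 2) ∂σ
      ≤ ∫ p : S2, 1 / 4 * (‖areaVec f p‖ * (scalarMean f p - c₀) ^ 2) ∂σ :=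
    setIntegral_le_integral (hint _ hEc) (Eventually.of_forall fun p => by positivity)
  rw [integral_add (hint _ hdc).integrableOn ((hint _ hwc).integrableOn.const_mul _),
    integral_const_mul] at h5
  rw [h4]
  have h7 : 0 < c₀ ^ 2 / 4 * ∫ p in C, ‖areaVec f p‖ ∂σ := by
    have : 0 < c₀ ^ 2 := by nlinarith
    positivity
  linarith

end

/-! ### Round spheres -/

/-- The round sphere of radius `r`. -/
def roundSphere (r : ℝ) (p : S2) : E3 := r • (p : E3)

lemma radialExtension_roundSphere (r : ℝ) {x : E3} (hx : x ≠ 0) :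
    radialExtension (roundSphere r) x = r • ‖x‖⁻¹ • x := by
  unfold radialExtension
  rw [dif_neg hx]
  rfl

lemma hasFDerivAt_inv_norm_smul (p : S2) : HasFDerivAt (fun x : E3 => ‖x‖⁻¹ • x)
    (ContinuousLinearMap.id ℝ E3 - (innerSL ℝ (p : E3)).smulRight (p : E3)) (p : E3) := by
  have hn := hasFDerivAt_norm_coe zero_lt_one p
  rw [one_smul] at hn
  have h0 : ‖(p : E3)‖ ≠ 0 := by simp
  have h4 := ((hasDerivAt_inv h0).comp_hasFDerivAt (p : E3) hn).smul (hasFDerivAt_id (p : E3))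
  refine h4.congr_fderiv ?_
  ext1 v
  simp
  abel

lemma hasFDerivAt_roundSphere (r : ℝ) (p : S2) : HasFDerivAt (radialExtension (roundSphere r))
    (r • (ContinuousLinearMap.id ℝ E3 - (innerSL ℝ (p : E3)).smulRight (p : E3))) (p : E3) := by
  refine ((hasFDerivAt_inv_norm_smul p).const_smul r).congr_of_eventuallyEq ?_
  filter_upwards [isOpen_compl_singleton.mem_nhds (coe_S2_ne_zero p)] with x hx
  exact radialExtension_roundSphere r hx

lemma fderiv_roundSphere_apply (r : ℝ) (p : S2) {v : E3} (hv : inner ℝ (p : E3) v = 0) :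
    fderiv ℝ (radialExtension (roundSphere r)) p v = r • v := by
  rw [(hasFDerivAt_roundSphere r p).fderiv]
  simp [hv]

lemma isSmoothImmersion_roundSphere {r : ℝ} (hr : 0 < r) : IsSmoothImmersion (roundSphere r) := by
  have := fact_finrank_E3
  have hs : ContMDiff (𝓡 2) 𝓘(ℝ, E3) ∞ (roundSphere r) := by
    have h1 : ContMDiff 𝓘(ℝ, E3) 𝓘(ℝ, E3) ∞ fun x : E3 => r • x :=
      (contDiff_const_smul r).contMDiff
    exact h1.comp contMDiff_coe_sphere
  refine ⟨hs, fun p u v huv => ?_⟩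
  rw [mfderiv_eq_fderiv_comp hs, mfderiv_eq_fderiv_comp hs] at huv
  have hinj : Function.Injective (mfderiv (𝓡 2) 𝓘(ℝ, E3) ((↑) : S2 → E3) p) :=
    injective_mvfderiv_subtypeVal_sphere (n := 2) p
  have hperp : ∀ w : TangentSpace (𝓡 2) p,
      inner ℝ (p : E3) (mfderiv (𝓡 2) 𝓘(ℝ, E3) ((↑) : S2 → E3) p w) = 0 := by
    intro w
    apply Submodule.mem_orthogonal_singleton_iff_inner_right.1
    rw [← range_mvfderiv_subtypeVal (n := 2) p]
    exact ⟨w, rfl⟩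
  rw [fderiv_roundSphere_apply r p (hperp u), fderiv_roundSphere_apply r p (hperp v)] at huv
  exact hinj (smul_right_injective _ hr.ne' huv)

lemma areaVec_roundSphere (r : ℝ) (p : S2) : areaVec (roundSphere r) p = -(r ^ 2 • (p : E3)) := by
  rw [← cross_fderiv_frame, fderiv_roundSphere_apply r p (inner_coe_frame p 0),
    fderiv_roundSphere_apply r p (inner_coe_frame p 1), cross_smul_smul, cross_frame, smul_neg]

lemma norm_areaVec_roundSphere (r : ℝ) (p : S2) : ‖areaVec (roundSphere r) p‖ = r ^ 2 := by
  rw [areaVec_roundSphere, norm_neg, norm_smul, norm_coe_S2, mul_one, Real.norm_of_nonneg]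
  positivity

lemma normalExt_roundSphere {r : ℝ} (hr : 0 < r) (p : S2) :
    normalExt (roundSphere r) p = -(p : E3) := by
  unfold normalExt
  rw [norm_areaVec_roundSphere, areaVec_roundSphere, smul_neg, smul_smul,
    inv_mul_cancel₀ (by positivity), one_smul]

lemma fderiv_normalExt_roundSphere {r : ℝ} (hr : 0 < r) (p : S2) :
    fderiv ℝ (normalExt (roundSphere r)) p
      = (-r⁻¹) • fderiv ℝ (radialExtension (roundSphere r)) p := by
  have h : normalExt (roundSphere r) =ᶠ[𝓝 (p : E3)] fun x =>
      (-r⁻¹) • radialExtension (roundSphere r) x := by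
    filter_upwards [isOpen_compl_singleton.mem_nhds (coe_S2_ne_zero p)] with x hx
    obtain ⟨s, hs, q, rfl⟩ := exists_pos_smul_coe hx
    rw [normalExt_isRadial _ s hs, radialExtension_isRadial _ s hs, normalExt_roundSphere hr,
      radialExtension_coe, roundSphere, smul_smul, neg_mul, inv_mul_cancel₀ hr.ne', neg_one_smul]
  rw [h.fderiv_eq, fderiv_fun_const_smul]
  exact (hasFDerivAt_roundSphere r p).differentiableAt

lemma scalarMean_roundSphere {r : ℝ} (hr : 0 < r) (p : S2) :
    scalarMean (roundSphere r) p = 2 / r := by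
  have hw := norm_areaVec_roundSphere r p
  unfold scalarMean
  rw [fderiv_normalExt_roundSphere hr]
  set A := fderiv ℝ (radialExtension (roundSphere r)) (p : E3) with hA
  -- For a round sphere the derivative of the normal is `-r⁻¹` times that of the map, and `cof` is
  -- quadratic. The polarization has the coefficient `(1 - r⁻¹)² - 1 - r⁻² = -2 / r`.
  have h1 : A + (-r⁻¹) • A = (1 - r⁻¹) • A := by
    ext1 v
    simp only [add_apply, smul_apply]
    module
  have h2 : cof A p = -areaVec (roundSphere r) p := by rw [areaVec, neg_neg]
  rw [h1, cof_smul_left, cof_smul_left, h2]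
  simp only [inner_sub_left, inner_smul_left, inner_neg_left, real_inner_self_eq_norm_sq, hw,
    RCLike.conj_to_real]
  field_simp
  ring

lemma isEmbeddedSphere_roundSphere {r : ℝ} (hr : 0 < r) : IsEmbeddedSphere (roundSphere r) := by
  have hI := isSmoothImmersion_roundSphere hr
  refine ⟨hI.smooth, hI.immersion, ?_, fun p => ?_⟩
  · refine (Continuous.isClosedEmbedding hI.smooth.continuous fun p q hpq => ?_).isEmbedding
    exact Subtype.ext (smul_right_injective _ hr.ne' hpq)
  · filter_upwards [self_mem_nhdsWithin, nhdsWithin_le_nhds (Iio_mem_nhds hr)] with t ht0 ht1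
    have ht0' : 0 < t := ht0
    have ht1' : t < r := ht1
    have hx : roundSphere r p + t • unitNormal (roundSphere r) p = (r - t) • (p : E3) := by
      rw [hI.unitNormal_eq, normalExt_roundSphere hr, roundSphere, smul_neg, sub_smul,
        sub_eq_add_neg]
    rw [hx]
    have hn : ‖(r - t) • (p : E3)‖ = r - t := by
      rw [norm_smul, norm_coe_S2, mul_one, Real.norm_of_nonneg (by linarith)]
    have hrange : ∀ y ∈ (Set.range (roundSphere r))ᶜ, ‖y‖ ≠ r := by
      intro y hy hyr
      apply hy
      refine ⟨⟨r⁻¹ • y, ?_⟩, ?_⟩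
      · simp [norm_smul, hyr, abs_of_pos hr, hr.ne']
      · simp [roundSphere, smul_smul, hr.ne']
    have hmem : (r - t) • (p : E3) ∉ Set.range (roundSphere r) := by
      rintro ⟨q, hq⟩
      have := congrArg norm hq
      rw [hn, roundSphere, norm_smul, norm_coe_S2, Real.norm_of_nonneg hr.le] at this
      linarith
    refine ⟨hmem, (isBounded_ball (x := (0 : E3)) (r := r)).subset ?_⟩
    intro y hy
    by_contra hyr
    have hyr' : r ≤ ‖y‖ := by simpa using hyr
    have hpre := (isPreconnected_connectedComponentIn
      (x := (r - t) • (p : E3)) (F := (Set.range (roundSphere r))ᶜ))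
    -- A connected set avoiding the sphere of radius `r` cannot contain points with norms on both
    -- sides of `r`.
    have hIcc := hpre.intermediate_value (mem_connectedComponentIn hmem) hy
      (f := fun z : E3 => ‖z‖) continuous_norm.continuousOn
    obtain ⟨z, hz, hzr⟩ := hIcc ⟨by rw [hn]; linarith, hyr'⟩
    exact hrange z (connectedComponentIn_subset _ _ hz) hzr

lemma toSphere_real_univ : (volume : Measure E3).toSphere.real Set.univ = 4 * Real.pi := by
  rw [Measure.toSphere_real_apply_univ, Measure.real, EuclideanSpace.volume_ball_fin_three]
  simp
  rw [ENNReal.toReal_ofReal (by positivity)]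
  ring

lemma penalizedEnergy_roundSphere (c₀ lam p : ℝ) {r : ℝ} (hr : 0 < r) :
    penalizedEnergy c₀ lam p (roundSphere r)
      = 4 * Real.pi * (1 / 4 * (2 - c₀ * r) ^ 2 + lam * r ^ 2 + p * r ^ 3 / 3) := by
  have hI := isSmoothImmersion_roundSphere hr
  unfold penalizedEnergy
  rw [hI.helfrich_eq, hI.area_eq, hI.algVolume_eq]
  have h1 : ∀ q : S2, inner ℝ (roundSphere r q) (areaVec (roundSphere r) q) = -r ^ 3 := by
    intro q
    rw [areaVec_roundSphere, roundSphere, inner_neg_right, inner_smul_left, inner_smul_right,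
      real_inner_self_eq_norm_sq, norm_coe_S2]
    simp
    ring
  simp only [norm_areaVec_roundSphere, scalarMean_roundSphere hr, h1, integral_const,
    toSphere_real_univ, smul_eq_mul]
  field_simp

/-- The Willmore part of the energy of a round sphere is `4π` for every radius; all other terms tend
to 0 with the radius. -/
theorem iInf_penalizedEnergy_le (c₀ lam p : ℝ) :
    (⨅ f : {f // IsEmbeddedSphere f}, (penalizedEnergy c₀ lam p f : EReal))
      ≤ ((4 * Real.pi : ℝ) : EReal) := by
  have h1 : Tendsto (fun r : ℝ =>
      4 * Real.pi * (1 / 4 * (2 - c₀ * r) ^ 2 + lam * r ^ 2 + p * r ^ 3 / 3)) (𝓝[>] 0)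
      (𝓝 (4 * Real.pi)) := by
    have h2 : Continuous fun r : ℝ =>
        4 * Real.pi * (1 / 4 * (2 - c₀ * r) ^ 2 + lam * r ^ 2 + p * r ^ 3 / 3) := by fun_prop
    have h3 := h2.tendsto 0
    norm_num at h3
    exact h3.mono_left nhdsWithin_le_nhds
  refine ge_of_tendsto ((continuous_coe_real_ereal.tendsto _).comp h1) ?_
  filter_upwards [self_mem_nhdsWithin] with r hr
  have h4 := iInf_le (fun f : {f // IsEmbeddedSphere f} => (penalizedEnergy c₀ lam p f : EReal))
    ⟨roundSphere r, isEmbeddedSphere_roundSphere hr⟩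
  rw [Function.comp_apply, ← penalizedEnergy_roundSphere c₀ lam p hr]
  exact h4

section

/-! ### Tubular neighbourhoods -/

variable {f : S2 → E3}

lemma exists_contDiffAt_local_inverse {Φ : E3 → E3} {x : E3} (hΦ : ContDiffAt ℝ ∞ Φ x)
    (hd : (fderiv ℝ Φ x).det ≠ 0) :
    ∃ g : E3 → E3, ContDiffAt ℝ ∞ g (Φ x) ∧ g (Φ x) = x ∧ (∀ᶠ y in 𝓝 (Φ x), Φ (g y) = y) ∧
      ∀ᶠ z in 𝓝 x, g (Φ z) = z := by
  have h1 : HasFDerivAt Φ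
      (((fderiv ℝ Φ x).toContinuousLinearEquivOfDetNeZero hd : E3 ≃L[ℝ] E3) : E3 →L[ℝ] E3) x := by
    rw [ContinuousLinearMap.coe_toContinuousLinearEquivOfDetNeZero]
    exact (hΦ.differentiableAt (by simp)).hasFDerivAt
  have hs := hΦ.hasStrictFDerivAt' h1 (by simp)
  exact ⟨hΦ.localInverse h1 (by simp), hΦ.to_localInverse h1 (by simp),
    hs.localInverse_apply_image, hs.eventually_right_inverse, hs.eventually_left_inverse⟩

/-- The normal exponential map of `f`, in which `‖x‖ - 1` is the signed distance. -/
def tube (f : S2 → E3) (x : E3) : E3 := radialExtension f x + (‖x‖ - 1) • normalExt f x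

/-- The derivative along the sphere of the parallel surface at distance `t`. -/
def parallelDeriv (f : S2 → E3) (t : ℝ) (p : S2) : E3 →L[ℝ] E3 :=
  fderiv ℝ (radialExtension f) p + t • fderiv ℝ (normalExt f) p

/-- The derivative of `tube f` at `r • p`. -/
def tubeDeriv (f : S2 → E3) (r : ℝ) (p : S2) : E3 →L[ℝ] E3 :=
  (innerSL ℝ (p : E3)).smulRight (normalExt f p) + r⁻¹ • parallelDeriv f (r - 1) p

lemma norm_smul_coe {r : ℝ} (hr : 0 < r) (p : S2) : ‖r • (p : E3)‖ = r := by
  rw [norm_smul, norm_coe_S2, mul_one, Real.norm_of_nonneg hr.le]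

lemma tube_smul {r : ℝ} (hr : 0 < r) (p : S2) :
    tube f (r • (p : E3)) = f p + (r - 1) • normalExt f p := by
  unfold tube
  rw [radialExtension_isRadial f r hr, normalExt_isRadial f r hr, norm_smul_coe hr,
    radialExtension_coe]

lemma tube_coe (p : S2) : tube f p = f p := by
  have h := tube_smul (f := f) one_pos p
  rwa [one_smul, sub_self, zero_smul, add_zero] at h

namespace IsSmoothImmersion

variable (hf : IsSmoothImmersion f)

include hf

lemma contDiffAt_tube {x : E3} (hx : x ≠ 0) : ContDiffAt ℝ ∞ (tube f) x :=
  (contDiffAt_radialExtension hf.smooth hx).add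
    (((contDiffAt_norm ℝ hx).sub contDiffAt_const).smul (hf.contDiffAt_normalExt hx))

lemma hasFDerivAt_tube {r : ℝ} (hr : 0 < r) (p : S2) :
    HasFDerivAt (tube f) (tubeDeriv f r p) (r • (p : E3)) := by
  have hne : r • (p : E3) ≠ 0 := smul_ne_zero hr.ne' (coe_S2_ne_zero p)
  have h1 := (differentiableAt_radialExtension hf.smooth hne).hasFDerivAt
  have h2 := (hasFDerivAt_norm_coe hr p).sub_const 1
  have h3 := h1.add (h2.smul (hf.differentiableAt_normalExt hne).hasFDerivAt)
  rw [(radialExtension_isRadial f).fderiv_smul hr, (normalExt_isRadial f).fderiv_smul hr,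
    normalExt_isRadial f r hr, norm_smul_coe hr] at h3
  refine h3.congr_fderiv ?_
  ext1 v
  simp only [tubeDeriv, parallelDeriv, add_apply, smul_apply, ContinuousLinearMap.smulRight_apply,
    innerSL_apply_apply, smul_add]
  rw [smul_comm (r - 1) r⁻¹]
  abel

lemma parallelDeriv_self (t : ℝ) (p : S2) : parallelDeriv f t p p = 0 := by
  have hx := coe_S2_ne_zero p
  simp [parallelDeriv, hf.fderiv_radialExtension_self hx, hf.fderiv_normalExt_self hx]

lemma tubeDeriv_self (r : ℝ) (p : S2) : tubeDeriv f r p p = normalExt f p := by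
  simp [tubeDeriv, hf.parallelDeriv_self]

omit hf in
lemma cof_tubeDeriv_self (r : ℝ) (p : S2) :
    cof (tubeDeriv f r p) p = (r ^ 2)⁻¹ • cof (parallelDeriv f (r - 1) p) p := by
  have h : ∀ i, tubeDeriv f r p (frame p i) = r⁻¹ • parallelDeriv f (r - 1) p (frame p i) := by
    intro i
    simp only [tubeDeriv, add_apply, ContinuousLinearMap.smulRight_apply, innerSL_apply_apply,
      inner_coe_frame, zero_smul, zero_add, smul_apply]
  have h1 := cross_map (tubeDeriv f r p) (frame p 0) (frame p 1)
  have h2 := cross_map (parallelDeriv f (r - 1) p) (frame p 0) (frame p 1)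
  rw [h, h, cross_smul_smul, h2, cross_frame, cof_neg, cof_neg, smul_neg, neg_inj, inv_pow] at h1
  exact h1.symm

lemma det_tubeDeriv (r : ℝ) (p : S2) :
    (tubeDeriv f r p).det = inner ℝ (cof (tubeDeriv f r p) p) (normalExt f p) := by
  have h := inner_cof_map (tubeDeriv f r p) p p
  rw [real_inner_self_eq_norm_sq, norm_coe_S2, hf.tubeDeriv_self] at h
  rw [h]
  ring

omit hf in
lemma cof_parallelDeriv_zero (p : S2) : cof (parallelDeriv f 0 p) p = -areaVec f p := by
  have h : parallelDeriv f 0 p = fderiv ℝ (radialExtension f) p := by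
    ext1 v
    simp [parallelDeriv]
  rw [h, areaVec, neg_neg]

/-- The determinant equals `-‖areaVec f p‖`. The sign reflects that the outward direction `p` is
sent to the normal `n_f`, whereas the positive frame satisfies `e₀ × e₁ = -p`. -/
lemma det_tubeDeriv_one_neg (p : S2) : (tubeDeriv f 1 p).det < 0 := by
  have hw := hf.areaVec_coe_ne_zero p
  have hx := coe_S2_ne_zero p
  rw [hf.det_tubeDeriv, cof_tubeDeriv_self, sub_self, cof_parallelDeriv_zero,
    hf.areaVec_eq_smul hx]
  rw [smul_neg, inner_neg_left, inner_smul_left, inner_smul_left, real_inner_self_eq_norm_sq,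
    hf.norm_normalExt hx]
  simpa using hw

lemma fderiv_tube {r : ℝ} (hr : 0 < r) (p : S2) :
    fderiv ℝ (tube f) (r • (p : E3)) = tubeDeriv f r p := (hf.hasFDerivAt_tube hr p).fderiv

lemma fderiv_tube_coe (p : S2) : fderiv ℝ (tube f) p = tubeDeriv f 1 p := by
  have h := hf.fderiv_tube one_pos p
  rwa [one_smul] at h

end IsSmoothImmersion

/-- The open annulus of half width `ε` around the unit sphere. -/
def annulus (ε : ℝ) : Set E3 := {x | |‖x‖ - 1| < ε}

lemma mem_annulus_iff {ε : ℝ} {x : E3} : x ∈ annulus ε ↔ 1 - ε < ‖x‖ ∧ ‖x‖ < 1 + ε := by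
  show |‖x‖ - 1| < ε ↔ _
  rw [abs_lt, neg_lt_sub_iff_lt_add, sub_lt_iff_lt_add, sub_lt_iff_lt_add, add_comm ε 1,
    add_comm ε ‖x‖]

lemma isOpen_annulus (ε : ℝ) : IsOpen (annulus ε) :=
  isOpen_lt (by fun_prop) continuous_const

lemma pos_of_mem_annulus {ε : ℝ} (hε : ε < 1) {x : E3} (hx : x ∈ annulus ε) : 0 < ‖x‖ := by
  have h : |‖x‖ - 1| < ε := hx
  linarith [(abs_lt.1 h).1]

lemma IsEmbeddedSphere.exists_tube (hf : IsEmbeddedSphere f) : ∃ ε : ℝ, 0 < ε ∧ ε < 1 ∧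
    Set.InjOn (tube f) (annulus ε) ∧ ∀ x ∈ annulus ε, (fderiv ℝ (tube f) x).det < 0 := by
  have hI := hf.isSmoothImmersion
  have hne : ∀ x ∈ sphere (0 : E3) 1, x ≠ 0 := fun x hx => coe_S2_ne_zero ⟨x, hx⟩
  have hdet : ∀ x ∈ sphere (0 : E3) 1, (fderiv ℝ (tube f) x).det < 0 := fun x hx => by
    have := hI.det_tubeDeriv_one_neg ⟨x, hx⟩
    rwa [← hI.fderiv_tube_coe] at this
  have hcpt : IsCompact (sphere (0 : E3) 1) := isCompact_sphere _ _
  have hinj : Set.InjOn (tube f) (sphere (0 : E3) 1) := by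
    intro x hx y hy hxy
    have h1 : f ⟨x, hx⟩ = f ⟨y, hy⟩ := by
      rw [← tube_coe (f := f), ← tube_coe (f := f)]
      exact hxy
    exact congrArg Subtype.val (hf.embedding.injective h1)
  -- A map that is injective on a compact set and locally injective at each of its points is
  -- injective on a neighbourhood.
  obtain ⟨U, hUo, hU, hUi⟩ := hinj.exists_isOpen_superset hcpt
    (fun x hx => (hI.contDiffAt_tube (hne x hx)).continuousAt) (fun x hx => by
      obtain ⟨g, -, -, -, hg⟩ := exists_contDiffAt_local_inverse (hI.contDiffAt_tube (hne x hx))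
        (hdet x hx).ne
      refine ⟨_, hg, ?_⟩
      intro a ha b hb hab
      rw [← show g (tube f a) = a from ha, hab]
      exact hb)
  have hdU : ∀ᶠ x in 𝓝ˢ (sphere (0 : E3) 1), (fderiv ℝ (tube f) x).det < 0 := by
    rw [Filter.Eventually, mem_nhdsSet_iff_forall]
    intro x hx
    have hc : ContinuousAt (fun x => (fderiv ℝ (tube f) x).det) x :=
      ContinuousLinearMap.continuous_det.continuousAt.comp
        ((hI.contDiffAt_tube (hne x hx)).fderiv_right (m := 0) (by simp)).continuousAt
    exact hc.eventually_lt continuousAt_const (hdet x hx)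
  obtain ⟨W, hWo, hW, hWd⟩ := mem_nhdsSet_iff_exists.1 hdU
  obtain ⟨ε, hε, hεU⟩ := hcpt.exists_thickening_subset_open (hUo.inter hWo)
    (Set.subset_inter hU hW)
  have hsub : annulus (min ε (1 / 2)) ⊆ U ∩ W := by
    intro x hx
    have hpos := pos_of_mem_annulus (lt_of_le_of_lt (min_le_right _ _) (by norm_num)) hx
    obtain ⟨r, hr, p, rfl⟩ := exists_pos_smul_coe (norm_pos_iff.1 hpos)
    apply hεU
    refine mem_thickening_iff.2 ⟨p, p.2, ?_⟩
    have h2 : |‖r • (p : E3)‖ - 1| < min ε (1 / 2) := hx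
    rw [norm_smul_coe hr] at h2
    have h3 : r • (p : E3) - p = (r - 1) • (p : E3) := by rw [sub_smul, one_smul]
    rw [dist_eq_norm, h3, norm_smul, norm_coe_S2, mul_one, Real.norm_eq_abs]
    exact h2.trans_le (min_le_left _ _)
  exact ⟨min ε (1 / 2), by positivity, lt_of_le_of_lt (min_le_right _ _) (by norm_num),
    hUi.mono (hsub.trans Set.inter_subset_left), fun x hx => hWd (hsub hx).2⟩

/-! ### The enclosed region near the surface -/

lemma isOpen_compl_range (hf : IsEmbeddedSphere f) : IsOpen (Set.range f)ᶜ :=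
  (isCompact_range hf.smooth.continuous).isClosed.isOpen_compl

lemma mem_enclosedRegion_of_isPreconnected {s : Set E3} (hs : IsPreconnected s)
    (hsf : s ⊆ (Set.range f)ᶜ) {x y : E3} (hx : x ∈ s) (hy : y ∈ s)
    (hxΩ : x ∈ enclosedRegion f) : y ∈ enclosedRegion f := by
  refine ⟨hsf hy, ?_⟩
  rw [← connectedComponentIn_eq (hs.subset_connectedComponentIn hx hsf hy)]
  exact hxΩ.2

/-- Membership in the enclosed region is locally constant off the surface. -/
lemma eventually_mem_enclosedRegion_iff (hf : IsEmbeddedSphere f) {x : E3}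
    (hx : x ∉ Set.range f) : ∀ᶠ y in 𝓝 x, (y ∈ enclosedRegion f ↔ x ∈ enclosedRegion f) := by
  have hmem : x ∈ (Set.range f)ᶜ := hx
  obtain ⟨ε, hε, hb⟩ := Metric.isOpen_iff.1 (isOpen_compl_range hf) x hmem
  filter_upwards [ball_mem_nhds x hε] with y hy
  have hc := (convex_ball x ε).isPreconnected
  exact ⟨mem_enclosedRegion_of_isPreconnected hc hb hy (mem_ball_self hε),
    mem_enclosedRegion_of_isPreconnected hc hb (mem_ball_self hε) hy⟩

/-- If the surface lies in the ball of radius `R`, a point `y` with `‖y‖ > R` is separated from it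
by a plane orthogonal to `y`. -/
lemma isBounded_enclosedRegion (hf : IsEmbeddedSphere f) :
    Bornology.IsBounded (enclosedRegion f) := by
  obtain ⟨R, hR⟩ := (isCompact_range hf.smooth.continuous).isBounded.exists_norm_le
  refine (isBounded_iff_forall_norm_le).2 ⟨R, fun y hy => ?_⟩
  by_contra hlt
  push Not at hlt
  have hR0 : 0 ≤ R := (norm_nonneg _).trans
    (hR (f (direction 0)) (Set.mem_range_self _))
  have hy0 : 0 < ‖y‖ := hR0.trans_lt hlt
  refine notMem_enclosedRegion (f := f) (ν := -y) (m := -(R * ‖y‖))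
    (neg_ne_zero.2 (norm_pos_iff.1 hy0)) (fun q => ?_) ?_ hy
  · rw [inner_neg_right, neg_le_neg_iff]
    exact (real_inner_le_norm _ _).trans
      (mul_le_mul_of_nonneg_right (hR _ (Set.mem_range_self q)) hy0.le)
  · rw [inner_neg_right, real_inner_self_eq_norm_sq]
    nlinarith

lemma isPreconnected_tube_image (hI : IsSmoothImmersion f) {a b : ℝ} (ha : 0 ≤ a) :
    IsPreconnected (tube f '' {x | a < ‖x‖ ∧ ‖x‖ < b}) := by
  have h1 : IsPreconnected (Set.univ : Set S2) := by
    have h := isPreconnected_sphere (E := E3)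
      (by rw [← Module.finrank_eq_rank]; simp) 0 1
    exact (Subtype.preconnectedSpace h).isPreconnected_univ
  have h2 : {x : E3 | a < ‖x‖ ∧ ‖x‖ < b}
      = (fun z : ℝ × S2 => z.1 • (z.2 : E3)) '' (Set.Ioo a b ×ˢ Set.univ) := by
    ext x
    constructor
    · rintro ⟨h1, h2⟩
      obtain ⟨r, hr, p, rfl⟩ := exists_pos_smul_coe (norm_pos_iff.1 (ha.trans_lt h1))
      rw [norm_smul_coe hr] at h1 h2
      exact ⟨(r, p), ⟨⟨h1, h2⟩, trivial⟩, rfl⟩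
    · rintro ⟨⟨r, p⟩, ⟨⟨h1, h2⟩, -⟩, rfl⟩
      have hr : 0 < r := ha.trans_lt h1
      simp only [Set.mem_ofPred_eq, norm_smul_coe hr]
      exact ⟨h1, h2⟩
  have h3 : IsPreconnected {x : E3 | a < ‖x‖ ∧ ‖x‖ < b} := by
    rw [h2]
    exact (isPreconnected_Ioo.prod h1).image _ (by fun_prop)
  refine h3.image _ fun x hx => ?_
  exact (hI.contDiffAt_tube (norm_pos_iff.1 (ha.trans_lt hx.1))).continuousAt.continuousWithinAt

section Sides

variable {ε : ℝ} (hf : IsEmbeddedSphere f) (hε : ε < 1) (hinj : Set.InjOn (tube f) (annulus ε))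

include hf hε hinj

omit hf hε in
lemma tube_notMem_range (hε0 : 0 < ε) {x : E3} (hx : x ∈ annulus ε) (hx1 : ‖x‖ ≠ 1) :
    tube f x ∉ Set.range f := by
  rintro ⟨q, hq⟩
  rw [← tube_coe (f := f)] at hq
  have hqa : (q : E3) ∈ annulus ε := by simpa [annulus] using hε0
  rw [← hinj hqa hx hq] at hx1
  exact hx1 (norm_coe_S2 q)

/-- The image of the shell `1 < ‖x‖ < 1 + ε` is connected and misses the surface. One of its points
is enclosed by the inner normal condition, hence all are. -/
lemma tube_mem_enclosedRegion {x : E3} (h1 : 1 < ‖x‖) (h2 : ‖x‖ < 1 + ε) :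
    tube f x ∈ enclosedRegion f := by
  have hI := hf.isSmoothImmersion
  have hε0 : 0 < ε := by linarith
  set p : S2 := direction 0
  have h3 := hf.inner_normal p
  rw [hI.unitNormal_eq] at h3
  obtain ⟨t, ht, ht1⟩ := (h3.and (Ioo_mem_nhdsGT hε0)).exists
  have ht0 : 0 < 1 + t := by linarith [ht1.1]
  have h4 : f p + t • normalExt f p = tube f ((1 + t) • (p : E3)) := by
    rw [tube_smul ht0]
    congr 2
    ring
  rw [h4] at ht
  refine mem_enclosedRegion_of_isPreconnected
    (isPreconnected_tube_image hI (a := 1) (b := 1 + ε) zero_le_one) ?_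
    (Set.mem_image_of_mem _ ?_) (Set.mem_image_of_mem _ ⟨h1, h2⟩) ht
  · rintro _ ⟨y, ⟨ha, hb⟩, rfl⟩
    exact tube_notMem_range hinj hε0 (mem_annulus_iff.2 ⟨by linarith, by linarith⟩) ha.ne'
  · rw [Set.mem_ofPred_eq, norm_smul_coe ht0]
    exact ⟨by linarith [ht1.1], by linarith [ht1.2]⟩

/-- The shell on the other side is connected as well. It contains points reached from a contact
point against the normal, and these lie in a half space free of the surface. -/
lemma tube_notMem_enclosedRegion {x : E3} (h1 : 1 - ε < ‖x‖) (h2 : ‖x‖ < 1) :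
    tube f x ∉ enclosedRegion f := by
  have hI := hf.isSmoothImmersion
  have hε0 : 0 < ε := by linarith
  obtain ⟨p, hp, -⟩ := exists_mem_contactSet hf (direction 0)
  have hx := coe_S2_ne_zero p
  have ht0 : 0 < 1 - ε / 2 := by linarith
  intro hmem
  have h3 : tube f ((1 - ε / 2) • (p : E3)) ∈ enclosedRegion f := by
    refine mem_enclosedRegion_of_isPreconnected
      (isPreconnected_tube_image hI (a := 1 - ε) (b := 1) (by linarith)) ?_
      (Set.mem_image_of_mem _ ⟨h1, h2⟩) (Set.mem_image_of_mem _ ?_) hmem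
    · rintro _ ⟨y, ⟨ha, hb⟩, rfl⟩
      exact tube_notMem_range hinj hε0 (mem_annulus_iff.2 ⟨by linarith, by linarith⟩) hb.ne
    · rw [Set.mem_ofPred_eq, norm_smul_coe ht0]
      exact ⟨by linarith, by linarith⟩
  refine notMem_enclosedRegion (f := f) (ν := normalExt f p) (m := inner ℝ (f p) (normalExt f p))
    ?_ hp ?_ h3
  · rw [← norm_ne_zero_iff, hI.norm_normalExt hx]
    exact one_ne_zero
  · rw [tube_smul ht0, inner_add_left, real_inner_smul_left, real_inner_self_eq_norm_sq,
      hI.norm_normalExt hx]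
    linarith

end Sides

end

section

/-! ### Smooth approximation of the indicator function of the enclosed region -/

variable {f : S2 → E3} {ε δ : ℝ}

/-- A smooth monotone function that increases from `0` to `1` on `[1, 1 + δ]`. -/
def transition (δ t : ℝ) : ℝ := Real.smoothTransition ((t - 1) / δ)

lemma contDiff_transition (δ : ℝ) : ContDiff ℝ 1 (transition δ) :=
  (Real.smoothTransition.contDiff (n := 1)).comp ((contDiff_id.sub contDiff_const).div_const δ)

lemma transition_nonneg (δ t : ℝ) : 0 ≤ transition δ t := Real.smoothTransition.nonneg _

lemma transition_of_le (hδ : 0 < δ) {t : ℝ} (ht : t ≤ 1) : transition δ t = 0 :=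
  Real.smoothTransition.zero_of_nonpos (div_nonpos_of_nonpos_of_nonneg (by linarith) hδ.le)

lemma transition_of_ge (hδ : 0 < δ) {t : ℝ} (ht : 1 + δ ≤ t) : transition δ t = 1 :=
  Real.smoothTransition.one_of_one_le ((one_le_div hδ).2 (by linarith))

lemma monotone_transition (hδ : 0 < δ) : Monotone (transition δ) := fun a b hab =>
  Real.smoothTransition.monotone (by gcongr)

/-- `ε` is a radius for which the normal exponential map is an orientation reversing
diffeomorphism onto its image. -/
structure IsTubeRadius (f : S2 → E3) (ε : ℝ) : Prop where
  pos : 0 < ε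
  lt_one : ε < 1
  injOn : Set.InjOn (tube f) (annulus ε)
  det_neg : ∀ x ∈ annulus ε, (fderiv ℝ (tube f) x).det < 0

/-- The inverse of the normal exponential map. -/
def tubeInv (f : S2 → E3) (ε : ℝ) : E3 → E3 := Function.invFunOn (tube f) (annulus ε)

open Classical in
/-- A smooth function that agrees with the indicator function of the enclosed region away from a
one-sided neighbourhood of the surface. -/
def cutoff (f : S2 → E3) (ε δ : ℝ) (y : E3) : ℝ :=
  if y ∈ tube f '' annulus ε then transition δ ‖tubeInv f ε y‖
    else (enclosedRegion f).indicator 1 y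

/-- The neighbourhood of the surface where the cutoff is not locally constant. -/
def collar (f : S2 → E3) (δ : ℝ) : Set E3 := tube f '' {x | 1 ≤ ‖x‖ ∧ ‖x‖ ≤ 1 + δ}

lemma cutoff_nonneg (y : E3) : 0 ≤ cutoff f ε δ y := by
  unfold cutoff
  split_ifs
  · exact transition_nonneg _ _
  · exact Set.indicator_nonneg (fun _ _ => zero_le_one) _

lemma IsSmoothImmersion.isCompact_collar (hI : IsSmoothImmersion f) (δ : ℝ) :
    IsCompact (collar f δ) := by
  have h : IsCompact {x : E3 | 1 ≤ ‖x‖ ∧ ‖x‖ ≤ 1 + δ} := by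
    refine (isCompact_closedBall (0 : E3) (1 + δ)).of_isClosed_subset
      ((isClosed_le continuous_const continuous_norm).inter
        (isClosed_le continuous_norm continuous_const)) ?_
    rintro x ⟨-, hx⟩
    exact mem_closedBall_zero_iff.2 hx
  refine h.image_of_continuousOn ?_
  rintro x ⟨hx, -⟩
  exact (hI.contDiffAt_tube (norm_pos_iff.1 (by linarith))).continuousAt.continuousWithinAt

lemma range_subset_collar (hδ : 0 < δ) : Set.range f ⊆ collar f δ := by
  rintro _ ⟨p, rfl⟩
  exact ⟨p, ⟨by simp, by simpa using hδ.le⟩, tube_coe p⟩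

lemma collar_subset_image (hδε : δ < ε) : collar f δ ⊆ tube f '' annulus ε := by
  apply Set.image_mono
  rintro x ⟨h1, h2⟩
  exact mem_annulus_iff.2 ⟨by linarith, by linarith⟩

namespace IsTubeRadius

variable (hε : IsTubeRadius f ε)

include hε

lemma ne_zero {x : E3} (hx : x ∈ annulus ε) : x ≠ 0 :=
  norm_pos_iff.1 (pos_of_mem_annulus hε.lt_one hx)

lemma tubeInv_tube {x : E3} (hx : x ∈ annulus ε) : tubeInv f ε (tube f x) = x :=
  hε.injOn.leftInvOn_invFunOn hx

lemma cutoff_tube {x : E3} (hx : x ∈ annulus ε) : cutoff f ε δ (tube f x) = transition δ ‖x‖ := by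
  unfold cutoff
  rw [if_pos (Set.mem_image_of_mem _ hx), hε.tubeInv_tube hx]

lemma contDiffAt_tubeInv (hI : IsSmoothImmersion f) {x : E3} (hx : x ∈ annulus ε) :
    ContDiffAt ℝ ∞ (tubeInv f ε) (tube f x) ∧ tube f '' annulus ε ∈ 𝓝 (tube f x) := by
  obtain ⟨g, hg, hgx, hr, -⟩ := exists_contDiffAt_local_inverse
    (hI.contDiffAt_tube (hε.ne_zero hx)) (hε.det_neg x hx).ne
  have hmem : ∀ᶠ y in 𝓝 (tube f x), g y ∈ annulus ε :=
    hg.continuousAt.eventually_mem (by rw [hgx]; exact (isOpen_annulus ε).mem_nhds hx)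
  constructor
  · refine hg.congr_of_eventuallyEq ?_
    filter_upwards [hr, hmem] with y hy hya
    have h := hε.tubeInv_tube hya
    rwa [hy] at h
  · filter_upwards [hr, hmem] with y hy hya
    exact ⟨g y, hya, hy⟩

lemma contDiffAt_cutoff_tube (hI : IsSmoothImmersion f) {x : E3} (hx : x ∈ annulus ε) :
    ContDiffAt ℝ 1 (cutoff f ε δ) (tube f x) := by
  obtain ⟨h1, h2⟩ := hε.contDiffAt_tubeInv hI hx
  have h3 : ContDiffAt ℝ 1 (tubeInv f ε) (tube f x) := h1.of_le (by simp)
  have h4 : ContDiffAt ℝ 1 (fun y => transition δ ‖tubeInv f ε y‖) (tube f x) :=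
    (contDiff_transition δ).contDiffAt.comp _
      (h3.norm ℝ (by rw [hε.tubeInv_tube hx]; exact hε.ne_zero hx))
  refine h4.congr_of_eventuallyEq ?_
  filter_upwards [h2] with y hy
  unfold cutoff
  rw [if_pos hy]

/-- The differential of the cutoff in terms of the distance to the surface. -/
lemma fderiv_cutoff_tubeDeriv (hI : IsSmoothImmersion f) {r : ℝ} (hr : 0 < r) {p : S2}
    (hx : r • (p : E3) ∈ annulus ε) (v : E3) :
    fderiv ℝ (cutoff f ε δ) (tube f (r • (p : E3))) (tubeDeriv f r p v)
      = deriv (transition δ) r * inner ℝ (p : E3) v := by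
  have h1 := ((hε.contDiffAt_cutoff_tube (δ := δ) hI hx).differentiableAt
    one_ne_zero).hasFDerivAt.comp _ (hI.hasFDerivAt_tube hr p)
  have h2 : HasDerivAt (transition δ) (deriv (transition δ) r) ‖r • (p : E3)‖ := by
    rw [norm_smul_coe hr]
    exact ((contDiff_transition δ).differentiable one_ne_zero r).hasDerivAt
  have h3 := h2.comp_hasFDerivAt _ (hasFDerivAt_norm_coe hr p)
  have h4 : (cutoff f ε δ ∘ tube f) =ᶠ[𝓝 (r • (p : E3))] (transition δ ∘ fun x => ‖x‖) := by
    filter_upwards [(isOpen_annulus ε).mem_nhds hx] with x hx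
    exact hε.cutoff_tube hx
  have h5 := (h1.congr_of_eventuallyEq h4.symm).unique h3
  have h6 := congrArg (fun T : E3 →L[ℝ] ℝ => T v) h5
  simpa using h6

variable (hf : IsEmbeddedSphere f) (hδ : 0 < δ)

include hf hδ

lemma cutoff_eq_indicator {y : E3} (hy : y ∉ collar f δ) :
    cutoff f ε δ y = (enclosedRegion f).indicator 1 y := by
  by_cases h : y ∈ tube f '' annulus ε
  · obtain ⟨x, hx, rfl⟩ := h
    rw [hε.cutoff_tube hx]
    obtain ⟨h1, h2⟩ := mem_annulus_iff.1 hx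
    by_cases hx1 : ‖x‖ < 1
    · rw [transition_of_le hδ hx1.le, Set.indicator_of_notMem
        (tube_notMem_enclosedRegion hf hε.lt_one hε.injOn h1 hx1)]
    · push Not at hx1
      have hx2 : 1 + δ < ‖x‖ := by
        by_contra hc
        exact hy ⟨x, ⟨hx1, not_lt.1 hc⟩, rfl⟩
      rw [transition_of_ge hδ hx2.le, Set.indicator_of_mem
        (tube_mem_enclosedRegion hf hε.lt_one hε.injOn (by linarith) h2), Pi.one_apply]
  · unfold cutoff
    rw [if_neg h]

lemma eventually_cutoff_eq {y : E3} (hy : y ∉ collar f δ) :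
    cutoff f ε δ =ᶠ[𝓝 y] fun _ => (enclosedRegion f).indicator 1 y := by
  have hfy : y ∉ Set.range f := fun h => hy (range_subset_collar hδ h)
  filter_upwards [(hf.isSmoothImmersion.isCompact_collar δ).isClosed.isOpen_compl.mem_nhds hy,
    eventually_mem_enclosedRegion_iff hf hfy] with z hz hiff
  rw [hε.cutoff_eq_indicator hf hδ hz]
  by_cases h : y ∈ enclosedRegion f
  · rw [Set.indicator_of_mem h, Set.indicator_of_mem (hiff.2 h)]
    rfl
  · rw [Set.indicator_of_notMem h, Set.indicator_of_notMem (fun hc => h (hiff.1 hc))]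

lemma fderiv_cutoff_eq_zero {y : E3} (hy : y ∉ collar f δ) : fderiv ℝ (cutoff f ε δ) y = 0 := by
  rw [(hε.eventually_cutoff_eq hf hδ hy).fderiv_eq]
  simp

lemma contDiff_cutoff (hδε : δ < ε) : ContDiff ℝ 1 (cutoff f ε δ) := by
  rw [contDiff_iff_contDiffAt]
  intro y
  by_cases hy : y ∈ collar f δ
  · obtain ⟨x, hx, rfl⟩ := collar_subset_image hδε hy
    exact hε.contDiffAt_cutoff_tube hf.isSmoothImmersion hx
  · exact contDiffAt_const.congr_of_eventuallyEq (hε.eventually_cutoff_eq hf hδ hy)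

lemma hasCompactSupport_cutoff : HasCompactSupport (cutoff f ε δ) := by
  have hb : Bornology.IsBounded (collar f δ ∪ enclosedRegion f) :=
    (hf.isSmoothImmersion.isCompact_collar δ).isBounded.union (isBounded_enclosedRegion hf)
  refine HasCompactSupport.intro hb.isCompact_closure fun y hy => ?_
  have hy' := fun h => hy (subset_closure h)
  rw [hε.cutoff_eq_indicator hf hδ fun h => hy' (Or.inl h),
    Set.indicator_of_notMem fun h => hy' (Or.inr h)]

end IsTubeRadius

end

section

/-! ### The volume of embedded spheres -/

variable {f : S2 → E3} {ε δ : ℝ}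

/-- The divergence theorem for the vector field `y ↦ χ(y) y`. -/
lemma integral_fderiv_self {χ : E3 → ℝ} (hχ : ContDiff ℝ 1 χ) (hc : HasCompactSupport χ) :
    ∫ y, fderiv ℝ χ y y = -3 * ∫ y, χ y := by
  have hd : Continuous (fderiv ℝ χ) := hχ.continuous_fderiv one_ne_zero
  have hcd : HasCompactSupport (fderiv ℝ χ) := hc.fderiv ℝ
  have hint : ∀ i : Fin 3, Integrable
      fun y : E3 => fderiv ℝ χ y (EuclideanSpace.single i 1) * y i := by
    intro i
    refine Continuous.integrable_of_hasCompactSupport (by fun_prop) ?_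
    refine hcd.mono' ?_
    intro y hy
    refine subset_closure fun h => hy ?_
    simp [h]
  -- Integration by parts against the coordinate `yᵢ`, whose derivative in the direction `eᵢ` is 1.
  have hcoord : ∀ i : Fin 3, ∫ y, fderiv ℝ χ y (EuclideanSpace.single i 1) * y i = -∫ y, χ y := by
    intro i
    have hder : ∀ y : E3, fderiv ℝ (fun y : E3 => y i) y (EuclideanSpace.single i 1) = 1 := by
      intro y
      have h : HasFDerivAt (fun y : E3 => y i) (EuclideanSpace.proj i : E3 →L[ℝ] ℝ) y :=
        (EuclideanSpace.proj i : E3 →L[ℝ] ℝ).hasFDerivAt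
      rw [h.fderiv]
      simp
    have h := integral_mul_fderiv_eq_neg_fderiv_mul_of_integrable (μ := (volume : Measure E3))
      (f := χ) (g := fun y : E3 => y i) (v := EuclideanSpace.single i 1) (hint i)
      (by simpa only [hder, mul_one] using hχ.continuous.integrable_of_hasCompactSupport hc)
      ((hχ.continuous.mul (by fun_prop)).integrable_of_hasCompactSupport hc.mul_right)
      (fun y _ => hχ.differentiable one_ne_zero y)
      (fun y _ => (EuclideanSpace.proj i : E3 →L[ℝ] ℝ).differentiableAt)
    simp only [hder, mul_one] at h
    rw [h, neg_neg]
  have hsum : ∀ y : E3, fderiv ℝ χ y y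
      = ∑ i, fderiv ℝ χ y (EuclideanSpace.single i 1) * y i := by
    intro y
    have h := congrArg (fderiv ℝ χ y) (E3_eq_sum y)
    rw [map_add, map_add, map_smul, map_smul, map_smul] at h
    rw [h, Fin.sum_univ_three]
    simp only [smul_eq_mul, mul_comm]
  simp only [hsum]
  rw [integral_finsetSum _ fun i _ => hint i]
  simp only [hcoord, Finset.sum_const, Finset.card_univ, Fintype.card_fin, nsmul_eq_mul]
  push_cast
  ring

lemma continuous_cof : Continuous fun z : (E3 →L[ℝ] E3) × E3 => cof z.1 z.2 := by
  rw [← contDiff_zero (𝕜 := ℝ), contDiff_iff_contDiffAt]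
  exact fun z => contDiffAt_cof contDiffAt_fst contDiffAt_snd

/-- The support function of the parallel surface at distance `r - 1` times its area element. -/
def parallelSupport (f : S2 → E3) (r : ℝ) (p : S2) : ℝ :=
  -inner ℝ (cof (parallelDeriv f (r - 1) p) p) (f p + (r - 1) • normalExt f p)

lemma parallelSupport_one (p : S2) : parallelSupport f 1 p = inner ℝ (f p) (areaVec f p) := by
  unfold parallelSupport
  rw [sub_self, IsSmoothImmersion.cof_parallelDeriv_zero, inner_neg_left, neg_neg, zero_smul,
    add_zero, real_inner_comm]

lemma IsSmoothImmersion.continuous_parallelSupport (hI : IsSmoothImmersion f) :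
    Continuous (Function.uncurry (parallelSupport f)) := by
  have hF : Continuous fun p : S2 => fderiv ℝ (radialExtension f) (p : E3) :=
    continuous_coe_of_contDiffAt fun _ hx => contDiffAt_fderiv_radialExtension hI.smooth hx
  have hL : Continuous fun p : S2 => fderiv ℝ (normalExt f) (p : E3) :=
    continuous_coe_of_contDiffAt fun _ hx => hI.contDiffAt_fderiv_normalExt hx
  have hN := hI.continuous_normalExt
  have hf := hI.smooth.continuous
  have hP : Continuous fun z : ℝ × S2 => parallelDeriv f (z.1 - 1) z.2 := by
    unfold parallelDeriv
    exact (hF.comp continuous_snd).add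
      ((continuous_fst.sub continuous_const).smul (hL.comp continuous_snd))
  have hC : Continuous fun z : ℝ × S2 => cof (parallelDeriv f (z.1 - 1) z.2) (z.2 : E3) :=
    continuous_cof.comp (hP.prodMk (continuous_subtype_val.comp continuous_snd))
  exact (hC.inner ((hf.comp continuous_snd).add
    ((continuous_fst.sub continuous_const).smul (hN.comp continuous_snd)))).neg

lemma deriv_transition_eq_zero (hδ : 0 < δ) {r : ℝ} (hr : r < 1 ∨ 1 + δ < r) :
    deriv (transition δ) r = 0 := by
  rcases hr with hr | hr
  · have h : transition δ =ᶠ[𝓝 r] fun _ => 0 := by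
      filter_upwards [Iio_mem_nhds hr] with t ht
      exact transition_of_le hδ (le_of_lt ht)
    rw [h.deriv_eq, deriv_const]
  · have h : transition δ =ᶠ[𝓝 r] fun _ => 1 := by
      filter_upwards [Ioi_mem_nhds hr] with t ht
      exact transition_of_ge hδ (le_of_lt ht)
    rw [h.deriv_eq, deriv_const]

lemma continuous_deriv_transition : Continuous (deriv (transition δ)) :=
  (contDiff_transition δ).continuous_deriv le_rfl

lemma hasCompactSupport_deriv_transition (hδ : 0 < δ) :
    HasCompactSupport (deriv (transition δ)) := by
  refine HasCompactSupport.intro (isCompact_Icc (a := 1) (b := 1 + δ)) fun r hr => ?_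
  apply deriv_transition_eq_zero hδ
  by_contra h
  push Not at h
  exact hr ⟨h.1, h.2⟩

lemma integral_deriv_transition (hδ : 0 < δ) : ∫ r in Set.Ioi 0, deriv (transition δ) r = 1 := by
  have hi : Integrable (deriv (transition δ)) :=
    continuous_deriv_transition.integrable_of_hasCompactSupport
      (hasCompactSupport_deriv_transition hδ)
  have h := integral_Ioi_of_hasDerivAt_of_tendsto (f := transition δ) (a := 0) (m := 1)
    (contDiff_transition δ).continuous.continuousWithinAt
    (fun r _ => ((contDiff_transition δ).differentiable one_ne_zero r).hasDerivAt)
    hi.integrableOn (tendsto_const_nhds.congr' (by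
      filter_upwards [eventually_ge_atTop (1 + δ)] with t ht
      exact (transition_of_ge hδ ht).symm))
  rw [h, transition_of_le hδ zero_le_one, sub_zero]

lemma integrable_prod_of_integrable {g : E3 → ℝ} (hg : Integrable g) :
    Integrable (fun z : S2 × Set.Ioi (0 : ℝ) => g ((z.2 : ℝ) • (z.1 : E3)))
      ((volume : Measure E3).toSphere.prod (Measure.volumeIoiPow 2)) := by
  have h := (volume : Measure E3).measurePreserving_homeomorphUnitSphereProd.integrable_comp_emb
    (Homeomorph.measurableEmbedding _)
    (g := fun z : S2 × Set.Ioi (0 : ℝ) => g ((z.2 : ℝ) • (z.1 : E3)))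
  have h2 : Module.finrank ℝ E3 - 1 = 2 := by simp
  rw [h2] at h
  rw [← h]
  have h3 : ((fun z : S2 × Set.Ioi (0 : ℝ) => g ((z.2 : ℝ) • (z.1 : E3))) ∘
      homeomorphUnitSphereProd E3) = g ∘ (↑) := by
    ext1 x
    simp only [Function.comp_apply]
    rw [← homeomorphUnitSphereProd_symm_apply_coe, Homeomorph.symm_apply_apply]
  rw [h3, ← integrableOn_iff_comap_subtypeVal (measurableSet_singleton (0 : E3)).compl]
  exact hg.integrableOn

lemma integral_volumeIoiPow_two (g : ℝ → ℝ) :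
    ∫ r : Set.Ioi (0 : ℝ), g r ∂(Measure.volumeIoiPow 2) = ∫ r in Set.Ioi 0, r ^ 2 * g r := by
  unfold Measure.volumeIoiPow
  rw [integral_withDensity_eq_integral_toReal_smul (by fun_prop) (by simp),
    ← integral_subtype_comap measurableSet_Ioi]
  refine integral_congr_ae (Eventually.of_forall fun r => ?_)
  simp only [smul_eq_mul]
  rw [ENNReal.toReal_ofReal (by positivity)]

namespace IsTubeRadius

variable (hε : IsTubeRadius f ε) (hf : IsEmbeddedSphere f) (hδ : 0 < δ)

include hε hf

lemma abs_det_mul_fderiv_cutoff {r : ℝ} (hr : 0 < r) {p : S2} (hx : r • (p : E3) ∈ annulus ε) :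
    |(fderiv ℝ (tube f) (r • (p : E3))).det| *
        fderiv ℝ (cutoff f ε δ) (tube f (r • (p : E3))) (tube f (r • (p : E3)))
      = (r ^ 2)⁻¹ * (deriv (transition δ) r * parallelSupport f r p) := by
  have hI := hf.isSmoothImmersion
  have hd := hε.det_neg _ hx
  rw [hI.fderiv_tube hr] at hd ⊢
  rw [abs_of_neg hd]
  -- With `v` the preimage of the position vector, the chain rule gives `Dχ(y) y = θ'(r) ⟨p, v⟩`,
  -- where `θ = transition δ`. The cofactor identity turns `det * ⟨p, v⟩` into a pairing with `y`
  -- itself, so `v` disappears.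
  obtain ⟨v, hv⟩ : ∃ v, tubeDeriv f r p v = tube f (r • (p : E3)) := by
    refine ⟨((tubeDeriv f r p).toContinuousLinearEquivOfDetNeZero hd.ne).symm
      (tube f (r • (p : E3))), ?_⟩
    have h := ((tubeDeriv f r p).toContinuousLinearEquivOfDetNeZero hd.ne).apply_symm_apply
      (tube f (r • (p : E3)))
    exact h
  have h1 := hε.fderiv_cutoff_tubeDeriv (δ := δ) hI hr hx v
  have h2 := inner_cof_map (tubeDeriv f r p) p v
  rw [hv] at h1 h2
  rw [h1]
  rw [IsSmoothImmersion.cof_tubeDeriv_self, real_inner_smul_left, tube_smul hr] at h2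
  unfold parallelSupport
  linear_combination deriv (transition δ) r * h2

include hδ

/-- The left side is `∫ Dχ(y) y dy = -3 ∫ χ` for the cutoff `χ`. Only the collar contributes, and
there the integral is rewritten by the normal exponential map and polar coordinates. -/
lemma integral_parallelSupport_le (hδε : δ < ε) :
    ∫ r in Set.Ioi 0, deriv (transition δ) r *
      ∫ p, parallelSupport f r p ∂(volume : Measure E3).toSphere ≤ 0 := by
  have hI := hf.isSmoothImmersion
  set σ := (volume : Measure E3).toSphere
  set χ := cutoff f ε δ with hχdef
  have hχ : ContDiff ℝ 1 χ := hε.contDiff_cutoff hf hδ hδε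
  have hχc : HasCompactSupport χ := hε.hasCompactSupport_cutoff hf hδ
  have hle : ∫ y, fderiv ℝ χ y y ≤ 0 := by
    rw [integral_fderiv_self hχ hχc]
    have : 0 ≤ ∫ y, χ y := integral_nonneg fun y => cutoff_nonneg y
    linarith
  have hint : Integrable fun y => fderiv ℝ χ y y := by
    refine Continuous.integrable_of_hasCompactSupport
      ((hχ.continuous_fderiv one_ne_zero).clm_apply continuous_id) ?_
    refine (hχc.fderiv ℝ).mono' fun y hy => subset_closure fun h => hy ?_
    simp [h]
  have hder : ∀ x ∈ annulus ε, HasFDerivWithinAt (tube f) (fderiv ℝ (tube f) x) (annulus ε) x :=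
    fun x hx => ((hI.contDiffAt_tube (hε.ne_zero hx)).differentiableAt
      (by simp)).hasFDerivAt.hasFDerivWithinAt
  have hm := (isOpen_annulus ε).measurableSet
  have h1 := integral_image_eq_integral_abs_det_fderiv_smul volume hm hder hε.injOn
    fun y => fderiv ℝ χ y y
  have h2 := (integrableOn_image_iff_integrableOn_abs_det_fderiv_smul volume hm hder hε.injOn
    fun y => fderiv ℝ χ y y).1 hint.integrableOn
  rw [setIntegral_eq_integral_of_forall_compl_eq_zero (fun y hy => by
    rw [hε.fderiv_cutoff_eq_zero hf hδ fun h => hy (collar_subset_image hδε h)]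
    rfl)] at h1
  rw [← integrable_indicator_iff hm] at h2
  rw [h1, ← integral_indicator hm, integral_eq_integral_prod] at hle
  have h3 := integrable_prod_of_integrable h2
  have h4 : ∀ z : S2 × Set.Ioi (0 : ℝ), (annulus ε).indicator (fun x =>
      |(fderiv ℝ (tube f) x).det| • fderiv ℝ χ (tube f x) (tube f x)) ((z.2 : ℝ) • (z.1 : E3))
      = ((z.2 : ℝ) ^ 2)⁻¹ * (deriv (transition δ) z.2 * parallelSupport f z.2 z.1) := by
    rintro ⟨p, r, hr⟩
    have hr' : 0 < r := hr
    by_cases hx : r • (p : E3) ∈ annulus ε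
    · rw [Set.indicator_of_mem hx]
      exact hε.abs_det_mul_fderiv_cutoff hf hr' hx
    · rw [Set.indicator_of_notMem hx]
      have h5 : r < 1 ∨ 1 + δ < r := by
        by_contra hc
        push Not at hc
        apply hx
        rw [mem_annulus_iff, norm_smul_coe hr']
        exact ⟨by linarith [hε.pos], by linarith⟩
      simp [deriv_transition_eq_zero hδ h5]
  simp only [h4] at hle h3
  rw [integral_prod_symm _ h3] at hle
  simp only [integral_const_mul] at hle
  rw [integral_volumeIoiPow_two fun r =>
    (r ^ 2)⁻¹ * (deriv (transition δ) r * ∫ p, parallelSupport f r p ∂σ)] at hle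
  -- The density `r²` of polar coordinates cancels the factor `(r ^ 2)⁻¹` from the cofactor of the
  -- tube derivative.
  refine le_of_eq_of_le (setIntegral_congr_fun measurableSet_Ioi fun r hr => ?_) hle
  have hr' : r ≠ 0 := ne_of_gt hr
  field_simp

end IsTubeRadius

/-- The volume of an embedded sphere with inner normal is nonnegative. -/
theorem IsEmbeddedSphere.algVolume_nonneg (hf : IsEmbeddedSphere f) : 0 ≤ algVolume f := by
  have hI := hf.isSmoothImmersion
  obtain ⟨ε, hε0, hε1, hinj, hdet⟩ := hf.exists_tube
  have hε : IsTubeRadius f ε := ⟨hε0, hε1, hinj, hdet⟩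
  rw [hI.algVolume_eq]
  simp only [← parallelSupport_one]
  set I : ℝ → ℝ := fun r => ∫ p, parallelSupport f r p ∂(volume : Measure E3).toSphere with hIdef
  have hIc : Continuous I := by
    have h := continuous_parametric_integral_of_continuous (μ := (volume : Measure E3).toSphere)
      hI.continuous_parallelSupport isCompact_univ
    simpa only [Measure.restrict_univ] using h
  -- The derivative of the transition is a probability density supported in `[1, 1 + δ]`. If `I 1 >
  -- 0`, then for small `δ` the average of `I` against it would be at least `I 1 / 2 > 0`.
  have key : I 1 ≤ 0 := by
    by_contra hpos
    push Not at hpos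
    have hev : ∀ᶠ r in 𝓝 (1 : ℝ), I 1 / 2 < I r :=
      hIc.continuousAt.eventually (lt_mem_nhds (by linarith))
    obtain ⟨η, hη, hηI⟩ := Metric.eventually_nhds_iff.1 hev
    set δ := min (ε / 2) (η / 2) with hδdef
    have hδ : 0 < δ := by positivity
    have hδε : δ < ε := (min_le_left _ _).trans_lt (by linarith)
    have hle := hε.integral_parallelSupport_le hf hδ hδε
    have hc := continuous_deriv_transition (δ := δ)
    have hcs := hasCompactSupport_deriv_transition hδ
    have h1 : ∫ r in Set.Ioi 0, deriv (transition δ) r * (I 1 / 2)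
        ≤ ∫ r in Set.Ioi 0, deriv (transition δ) r * I r := by
      refine setIntegral_mono
        ((hc.integrable_of_hasCompactSupport hcs).mul_const _).integrableOn
        ((hc.mul hIc).integrable_of_hasCompactSupport hcs.mul_right).integrableOn fun r => ?_
      by_cases hr : r < 1 ∨ 1 + δ < r
      · simp [deriv_transition_eq_zero hδ hr]
      · push Not at hr
        have h2 : dist r 1 < η := by
          rw [Real.dist_eq, abs_lt]
          have := min_le_right (ε / 2) (η / 2)
          exact ⟨by linarith, by linarith⟩
        exact mul_le_mul_of_nonneg_left (hηI h2).le (monotone_transition hδ).deriv_nonneg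
    rw [integral_mul_const, integral_deriv_transition hδ] at h1
    linarith
  have h : ∫ p : S2, parallelSupport f 1 p ∂(volume : Measure E3).toSphere = I 1 := rfl
  rw [h]
  linarith

/-- The penalized energy of every embedded sphere exceeds the energy of a round sphere in the limit
of vanishing radius. -/
theorem IsEmbeddedSphere.four_pi_lt_penalizedEnergy (hf : IsEmbeddedSphere f) {c₀ lam p : ℝ}
    (hc₀ : c₀ < 0) (hlam : 0 ≤ lam) (hp : 0 ≤ p) : 4 * Real.pi < penalizedEnergy c₀ lam p f := by
  have h1 := hf.four_pi_lt_helfrich hc₀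
  have h2 := mul_nonneg hp hf.algVolume_nonneg
  have h3 : 0 ≤ lam * area f :=
    mul_nonneg hlam (integral_nonneg fun _ => zero_le_one)
  unfold penalizedEnergy
  linarith

end

end HelfrichLiYau

end

/-! ### The main theorem -/

theorem mainTheorem10 :
    (∀ (V : HelfrichLiYau.OrientedVarifold)
        (H : HelfrichLiYau.E3 → HelfrichLiYau.E3)
        (c₀ : ℝ) (x₀ : HelfrichLiYau.E3),
      HelfrichLiYau.MemL2Loc H V.weight →
      V.HasMeanCurvature H →
      IsCompact V.weight.support →
      c₀ < 0 →
      1 ≤ HelfrichLiYau.upperDensity V.weight x₀ →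
      0 < V.concentratedVolume x₀ →
      ENNReal.ofReal (4 * Real.pi) < V.helfrich H c₀) ∧
    (∀ c₀ lam p : ℝ, c₀ < 0 → 0 ≤ lam → 0 ≤ p →
      (⨅ f : {f // HelfrichLiYau.IsEmbeddedSphere f},
          (HelfrichLiYau.penalizedEnergy c₀ lam p f : EReal)) ≤ ((4 * Real.pi : ℝ) : EReal) ∧
      ¬ ∃ f : {f // HelfrichLiYau.IsEmbeddedSphere f},
          (HelfrichLiYau.penalizedEnergy c₀ lam p f : EReal) =
            ⨅ g : {g // HelfrichLiYau.IsEmbeddedSphere g},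
              (HelfrichLiYau.penalizedEnergy c₀ lam p g : EReal)) := by
  refine ⟨fun V H c₀ x₀ hH hV hc hc₀ hd hvol => hV.four_pi_lt_helfrich hc hH hc₀ hd hvol,
    fun c₀ lam p hc₀ hlam hp => ?_⟩
  have hle := HelfrichLiYau.iInf_penalizedEnergy_le c₀ lam p
  refine ⟨hle, ?_⟩
  rintro ⟨⟨f, hf⟩, hinf⟩
  rw [← hinf, EReal.coe_le_coe_iff] at hle
  exact absurd hle (not_le.2 (hf.four_pi_lt_penalizedEnergy hc₀ hlam hp))
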